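/- Let $A$ be a finite set (of basic actions) with $\tau,\delta\notin A$, put $A_{\tau\delta}=A\cup\{\tau,\delta\}$, and let $\gamma:A_{\tau\delta}\times A_{\tau\delta}\to A_{\tau\delta}$ be commutative and associative with $\gamma(\tau,a)=\gamma(\delta,a)=\delta$ for all $a\in A_{\tau\delta}$. **Theories without recursion.** The signature of $\mathrm{ACP}^\tau_{drt}$ has constants $\underline{a}$ ($a\in A_{\tau\delta}$), binary operators $+$, $\cdot$, $\parallel$ (parallel composition), $\lfloor\!\lfloor$ (left merge), $\mid$ (communication merge), and unary operators $\sigma$ (one-time-slice delay), $\partial_H$ and $\tau_I$ for $H,I\subseteq A$ (encapsulation, abstraction), and $\nu$ (current-time-slice time-out). Variables are taken from a countably infinite set. The operator $\cdot$ binds strongest and $+$ weakest. With $a,b$ ranging over $A_{\tau\delta}$, the axioms are: * $x+y=y+x$; $(x+y)+z=x+(y+z)$; $x+x=x$; $(x+y)\cdot z=x\cdot z+y\cdot z$; $(x\cdot y)\cdot z=x\cdot(y\cdot z)$; $x+\underline\delta=x$; $\underline\delta\cdot x=\underline\delta$; $\sigma(x)+\sigma(y)=\sigma(x+y)$; $\sigma(x)\cdot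 y=\sigma(x\cdot y)$; * $\tau_I(\underline a)=\underline a$ if $a\notin I$; $\tau_I(\underline a)=\underline\tau$ if $a\in I$; $\tau_I(x+y)=\tau_I(x)+\tau_I(y)$; $\tau_I(x\cdot y)=\tau_I(x)\cdot\tau_I(y)$; $\tau_I(\sigma(x))=\sigma(\tau_I(x))$; * $\nu(\underline a)=\underline a$; $\nu(x+y)=\nu(x)+\nu(y)$; $\nu(x\cdot y)=\nu(x)\cdot y$; $\nu(\sigma(x))=\underline\delta$; * $\underline a\cdot\underline\tau=\underline a$; $\underline a\cdot(\underline\tau\cdot(\nu(x)+y)+\nu(x))=\underline a\cdot(\nu(x)+y)$; $\underline a\cdot(\underline\tau\cdot(\nu(x)+y)+y)=\underline a\cdot(\nu(x)+y)$; $\underline a\cdot(\sigma(\underline\tau\cdot x)+\nu(y))=\underline a\cdot(\sigma(x)+\nu(y))$; * $\partial_H(\underline a)=\underline a$ if $a\notin H$; $\partial_H(\underline a)=\underline\delta$ if $a\in H$; $\partial_H(x+y)=\partial_H(x)+\partial_H(y)$; $\partial_H(x\cdot y)=\partial_H(x)\cdot\partial_H(y)$; $\partial_H(\sigma(x))=\sigma(\partial_H(x))$;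 * $x\parallel y=(x\lfloor\!\lfloor y+y\lfloor\!\lfloor x)+x\mid y$; $\underline a\lfloor\!\lfloor x=\underline a\cdot x$; $\underline a\cdot x\lfloor\!\lfloor y=\underline a\cdot(x\parallel y)$; $(x+y)\lfloor\!\lfloor z=x\lfloor\!\lfloor z+y\lfloor\!\lfloor z$; $\sigma(x)\lfloor\!\lfloor\nu(y)=\underline\delta$; $\sigma(x)\lfloor\!\lfloor(\nu(y)+\sigma(z))=\sigma(x\lfloor\!\lfloor z)$; * $\underline a\cdot x\mid\underline b=(\underline a\mid\underline b)\cdot x$; $\underline a\mid\underline b\cdot x=(\underline a\mid\underline b)\cdot x$; $\underline a\cdot x\mid\underline b\cdot y=(\underline a\mid\underline b)\cdot(x\parallel y)$; $\nu(x)\mid\sigma(y)=\underline\delta$; $\sigma(x)\mid\nu(y)=\underline\delta$; $\sigma(x)\mid\sigma(y)=\sigma(x\mid y)$; $(x+y)\mid z=x\mid z+y\mid z$; $x\mid(y+z)=x\mid y+x\mid z$; $\underline a\mid\underline b=\underline{\gamma(a,b)}$. $\mathrm{BPA}^\tau_{drt}$ is obtained by omitting $\parallel,\lfloor\!\lfloor,\mid,\partial_H$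 and the axioms (the last three groups) in which they occur; it retains $\tau_I$ and $\nu$. **Recursion.** A recursive specification over a signature $\Sigma$ is a (possibly infinite) set $E=\{X_i=t_i\mid i\in I\}$ with distinct variables $X_i$, where each $t_i$ is a term over $\Sigma$ containing only variables from $\{X_i\mid i\in I\}$. An occurrence of a variable in a term $t$ is guarded if no abstraction operator occurs in $t$ (recursion constants being atomic symbols) and the occurrence lies in a term $t'$ such that $\underline a\cdot t'$ with $a\in A$, or $\sigma(t')$, is a subterm of $t$. A term is guarded if all occurrences of variables in it are guarded. $E$ is guarded modulo $\Phi$ if each $t_i$ can be rewritten, within the terms over $\Sigma$ and in finitely many steps, to a guarded term by using the (unconditional) equations from $\Phi$ in either direction and the equations $X_j=t_j$ of $E$ with $j\ne i$ from left to right. For $T\in\{\mathrm{ACP}^\tau_{drt},\mathrm{BPA}^\tau_{drt}\}$ let $\Sigma_0,\Phi_0$ be the signature and axioms of $T$. Let $\Sigma_{n+1}$ be $\Sigma_n$ with added, for each recursive specification $E$ over $\Sigma_n$ that is guarded modulo $\Phi_n$ and each variable $X$ of $E$, a constant $\langle X|E\rangle$. Let $\Phi_{n+1}$ be $\Phi_n$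 with added, for each such $E$ and $X$, the equation $\langle X|E\rangle=\langle t|E\rangle$, where $X=t$ is in $E$ and $\langle t|E\rangle$ is $t$ with every variable $Y$ of $E$ replaced by $\langle Y|E\rangle$ (RDP), and the conditional equation $E\Rightarrow X=\langle X|E\rangle$ (RSP). The theory $T\mathrm{REC}$ has signature $\bigcup_n\Sigma_n$ and axioms $\bigcup_n\Phi_n$. Derivability is derivability in conditional equational logic, where a conditional equation may have infinitely many premises. **Theorem.** For every closed $\mathrm{ACP}^\tau_{drt}\mathrm{REC}$ term $t$ in which no abstraction operator occurs (neither in $t$ itself nor, at any depth of nesting, in the recursive specifications $E$ of the recursion constants $\langle X|E\rangle$ of $t$), there exists a closed $\mathrm{ACP}^\tau_{drt}\mathrm{REC}$ term $t'$ that is a closed $\mathrm{BPA}^\tau_{drt}\mathrm{REC}$ term such that $t=t'$ is derivable from the axioms of $\mathrm{ACP}^\tau_{drt}\mathrm{REC}$. -/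

import Mathlib

namespace ACPdrt

/-- The set `A ∪ {τ, δ}` of basic actions, silent step and deadlock. -/
inductive Atom (A : Type*) where
  | act (a : A)
  | tau
  | dead

/-- A communication function: commutative, associative, and yielding deadlock as soon as one
of the arguments is the silent step or deadlock. -/
structure Communication (A : Type*) where
  comm : Atom A → Atom A → Atom A
  comm_symm : ∀ a b, comm a b = comm b a
  comm_assoc : ∀ a b c, comm (comm a b) c = comm a (comm b c)
  comm_tau : ∀ a, comm .tau a = .dead
  comm_dead : ∀ a, comm .dead a = .dead

/-- Raw process terms. Variables are natural numbers. `recur V E X` is the recursion constant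
`⟨X | E⟩`, where `E` is the (possibly infinite) set of equations `{Y = E Y | Y ∈ V}`. It is a
constant: the variables in `E` do not count as variables of the term. Which raw terms are terms
of a given theory is determined by `IsTerm` below. -/
inductive Term (A : Type*) where
  | var (x : ℕ)
  | atom (a : Atom A)
  | alt (s t : Term A)
  | seq (s t : Term A)
  | delay (t : Term A)
  | par (s t : Term A)
  | lmerge (s t : Term A)
  | cmerge (s t : Term A)
  | encap (H : Set A) (t : Term A)
  | abstr (I : Set A) (t : Term A)
  | timeout (t : Term A)
  | recur (V : Set ℕ) (E : V → Term A) (X : V)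

/-- The two theories: `acp` has all operators, `bpa` lacks parallel composition, left merge,
communication merge and encapsulation. -/
inductive Theory where
  | bpa
  | acp

namespace Term

variable {A : Type*}

/-- The variables occurring in a term. -/
def vars : Term A → Set ℕ
  | var x => {x}
  | atom _ => ∅
  | alt s t => s.vars ∪ t.vars
  | seq s t => s.vars ∪ t.vars
  | delay t => t.vars
  | par s t => s.vars ∪ t.vars
  | lmerge s t => s.vars ∪ t.vars
  | cmerge s t => s.vars ∪ t.vars
  | encap _ t => t.vars
  | abstr _ t => t.vars
  | timeout t => t.vars
  | recur _ _ _ => ∅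

/-- Substitution of terms for variables. -/
def subst (σ : ℕ → Term A) : Term A → Term A
  | var x => σ x
  | atom a => atom a
  | alt s t => alt (s.subst σ) (t.subst σ)
  | seq s t => seq (s.subst σ) (t.subst σ)
  | delay t => delay (t.subst σ)
  | par s t => par (s.subst σ) (t.subst σ)
  | lmerge s t => lmerge (s.subst σ) (t.subst σ)
  | cmerge s t => cmerge (s.subst σ) (t.subst σ)
  | encap H t => encap H (t.subst σ)
  | abstr I t => abstr I (t.subst σ)
  | timeout t => timeout (t.subst σ)
  | recur V E X => recur V E X

open Classical in
/-- `⟨t | E⟩`: every variable `X` of `E` in `t` is replaced by the constant `⟨X | E⟩`. -/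
noncomputable def recClose (V : Set ℕ) (E : V → Term A) (t : Term A) : Term A :=
  t.subst fun x => if h : x ∈ V then recur V E ⟨x, h⟩ else var x

/-- `t` is a term over the signature of the theory `T` (without recursion) enlarged with the
recursion constants `⟨X | E⟩` of the specifications `E` satisfying `C`. -/
def IsOver (T : Theory) (C : (V : Set ℕ) → (V → Term A) → Prop) : Term A → Prop
  | var _ => True
  | atom _ => True
  | alt s t => s.IsOver T C ∧ t.IsOver T C
  | seq s t => s.IsOver T C ∧ t.IsOver T C
  | delay t => t.IsOver T C
  | par s t => T = .acp ∧ s.IsOver T C ∧ t.IsOver T C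
  | lmerge s t => T = .acp ∧ s.IsOver T C ∧ t.IsOver T C
  | cmerge s t => T = .acp ∧ s.IsOver T C ∧ t.IsOver T C
  | encap _ t => T = .acp ∧ t.IsOver T C
  | abstr _ t => t.IsOver T C
  | timeout t => t.IsOver T C
  | recur V E _ => C V E

/-- No abstraction operator is applied in `t`, a recursion constant being an atomic symbol. -/
def NoAbstr : Term A → Prop
  | var _ => True
  | atom _ => True
  | alt s t => s.NoAbstr ∧ t.NoAbstr
  | seq s t => s.NoAbstr ∧ t.NoAbstr
  | delay t => t.NoAbstr
  | par s t => s.NoAbstr ∧ t.NoAbstr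
  | lmerge s t => s.NoAbstr ∧ t.NoAbstr
  | cmerge s t => s.NoAbstr ∧ t.NoAbstr
  | encap _ t => t.NoAbstr
  | abstr _ _ => False
  | timeout t => t.NoAbstr
  | recur _ _ _ => True

/-- No abstraction operator occurs in `t`, neither outside nor (at any depth of nesting) inside
the recursive specifications that belong to the recursion constants of `t`. -/
def AbstrFree : Term A → Prop
  | var _ => True
  | atom _ => True
  | alt s t => s.AbstrFree ∧ t.AbstrFree
  | seq s t => s.AbstrFree ∧ t.AbstrFree
  | delay t => t.AbstrFree
  | par s t => s.AbstrFree ∧ t.AbstrFree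
  | lmerge s t => s.AbstrFree ∧ t.AbstrFree
  | cmerge s t => s.AbstrFree ∧ t.AbstrFree
  | encap _ t => t.AbstrFree
  | abstr _ _ => False
  | timeout t => t.AbstrFree
  | recur _ E _ => ∀ j, (E j).AbstrFree

/-- Every occurrence of a variable in `t` lies in a `t'` for which `a ⬝ t'`, with `a` a basic
action (neither `τ` nor `δ`), or `delay t'` is a subterm of `t`. -/
def Prefixed : Term A → Prop
  | var _ => False
  | atom _ => True
  | alt s t => s.Prefixed ∧ t.Prefixed
  | seq s t => s.Prefixed ∧ ((∃ a, s = atom (.act a)) ∨ t.Prefixed)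
  | delay _ => True
  | par s t => s.Prefixed ∧ t.Prefixed
  | lmerge s t => s.Prefixed ∧ t.Prefixed
  | cmerge s t => s.Prefixed ∧ t.Prefixed
  | encap _ t => t.Prefixed
  | abstr _ t => t.Prefixed
  | timeout t => t.Prefixed
  | recur _ _ _ => True

/-- All occurrences of variables in `t` are guarded. An occurrence of a variable is guarded if no
abstraction operator occurs in `t` and the occurrence is prefixed by a basic action or a delay;
so a term without variables is guarded. -/
def Guarded (t : Term A) : Prop :=
  t.vars = ∅ ∨ (t.NoAbstr ∧ t.Prefixed)

end Term

open Term

section Axioms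

variable {A : Type*}

/-- All substitution instances of the axioms of `BPA` with silent step and discrete relative
timing. -/
inductive BPAAxiom : Term A → Term A → Prop
  | A1 x y : BPAAxiom (alt x y) (alt y x)
  | A2 x y z : BPAAxiom (alt (alt x y) z) (alt x (alt y z))
  | A3 x : BPAAxiom (alt x x) x
  | A4 x y z : BPAAxiom (seq (alt x y) z) (alt (seq x z) (seq y z))
  | A5 x y z : BPAAxiom (seq (seq x y) z) (seq x (seq y z))
  | A6DR x : BPAAxiom (alt x (atom .dead)) x
  | A7DR x : BPAAxiom (seq (atom .dead) x) (atom .dead)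
  | DRT1 x y : BPAAxiom (alt (delay x) (delay y)) (delay (alt x y))
  | DRT2 x y : BPAAxiom (seq (delay x) y) (delay (seq x y))
  | TI1DR (I : Set A) (a : Atom A) (h : a ∉ Atom.act '' I) :
      BPAAxiom (abstr I (atom a)) (atom a)
  | TI2DR (I : Set A) (a : Atom A) (h : a ∈ Atom.act '' I) :
      BPAAxiom (abstr I (atom a)) (atom .tau)
  | TI3 I x y : BPAAxiom (abstr I (alt x y)) (alt (abstr I x) (abstr I y))
  | TI4 I x y : BPAAxiom (abstr I (seq x y)) (seq (abstr I x) (abstr I y))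
  | DRTI I x : BPAAxiom (abstr I (delay x)) (delay (abstr I x))
  | DRTO1 a : BPAAxiom (timeout (atom a)) (atom a)
  | DRTO2 x y : BPAAxiom (timeout (alt x y)) (alt (timeout x) (timeout y))
  | DRTO3 x y : BPAAxiom (timeout (seq x y)) (seq (timeout x) y)
  | DRTO4 x : BPAAxiom (timeout (delay x)) (atom .dead)
  | DRB1 a : BPAAxiom (seq (atom a) (atom .tau)) (atom a)
  | DRB2 a x y : BPAAxiom
      (seq (atom a) (alt (seq (atom .tau) (alt (timeout x) y)) (timeout x)))
      (seq (atom a) (alt (timeout x) y))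
  | DRB3 a x y : BPAAxiom
      (seq (atom a) (alt (seq (atom .tau) (alt (timeout x) y)) y))
      (seq (atom a) (alt (timeout x) y))
  | DRB4 a x y : BPAAxiom
      (seq (atom a) (alt (delay (seq (atom .tau) x)) (timeout y)))
      (seq (atom a) (alt (delay x) (timeout y)))

/-- All substitution instances of the axioms of `ACP` with abstraction and discrete relative
timing. -/
inductive ACPAxiom (γ : Communication A) : Term A → Term A → Prop
  | bpa {s t} (h : BPAAxiom s t) : ACPAxiom γ s t
  | D1DR (H : Set A) (a : Atom A) (h : a ∉ Atom.act '' H) :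
      ACPAxiom γ (encap H (atom a)) (atom a)
  | D2DR (H : Set A) (a : Atom A) (h : a ∈ Atom.act '' H) :
      ACPAxiom γ (encap H (atom a)) (atom .dead)
  | D3 H x y : ACPAxiom γ (encap H (alt x y)) (alt (encap H x) (encap H y))
  | D4 H x y : ACPAxiom γ (encap H (seq x y)) (seq (encap H x) (encap H y))
  | DRD H x : ACPAxiom γ (encap H (delay x)) (delay (encap H x))
  | CM1 x y : ACPAxiom γ (par x y) (alt (alt (lmerge x y) (lmerge y x)) (cmerge x y))
  | CM2DR a x : ACPAxiom γ (lmerge (atom a) x) (seq (atom a) x)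
  | CM3DR a x y : ACPAxiom γ (lmerge (seq (atom a) x) y) (seq (atom a) (par x y))
  | DRCM1 x y : ACPAxiom γ (lmerge (delay x) (timeout y)) (atom .dead)
  | DRCM2 x y z : ACPAxiom γ
      (lmerge (delay x) (alt (timeout y) (delay z))) (delay (lmerge x z))
  | CM4 x y z : ACPAxiom γ (lmerge (alt x y) z) (alt (lmerge x z) (lmerge y z))
  | CM5DR a b x : ACPAxiom γ
      (cmerge (seq (atom a) x) (atom b)) (seq (cmerge (atom a) (atom b)) x)
  | CM6DR a b x : ACPAxiom γ
      (cmerge (atom a) (seq (atom b) x)) (seq (cmerge (atom a) (atom b)) x)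
  | CM7DR a b x y : ACPAxiom γ
      (cmerge (seq (atom a) x) (seq (atom b) y))
      (seq (cmerge (atom a) (atom b)) (par x y))
  | DRCM3 x y : ACPAxiom γ (cmerge (timeout x) (delay y)) (atom .dead)
  | DRCM4 x y : ACPAxiom γ (cmerge (delay x) (timeout y)) (atom .dead)
  | DRCM5 x y : ACPAxiom γ (cmerge (delay x) (delay y)) (delay (cmerge x y))
  | CM8 x y z : ACPAxiom γ (cmerge (alt x y) z) (alt (cmerge x z) (cmerge y z))
  | CM9 x y z : ACPAxiom γ (cmerge x (alt y z)) (alt (cmerge x y) (cmerge x z))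
  | CFDR (a b : Atom A) : ACPAxiom γ (cmerge (atom a) (atom b)) (atom (γ.comm a b))

/-- The instances of the axioms of a theory without recursion. -/
def BaseAxiom (γ : Communication A) : Theory → Term A → Term A → Prop
  | .bpa => BPAAxiom
  | .acp => ACPAxiom γ

/-- `RDP` for the specifications satisfying `C`: the equations `⟨X | E⟩ = ⟨t | E⟩`, where
`X = t` is the equation for `X` in `E`. -/
inductive RDPAxiom (C : (V : Set ℕ) → (V → Term A) → Prop) : Term A → Term A → Prop
  | rdp (V : Set ℕ) (E : V → Term A) (X : V) (h : C V E) :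
      RDPAxiom C (recur V E X) (recClose V E (E X))

/-- Replacement of one subterm: `R` is applied in an arbitrary context. -/
inductive InContext (R : Term A → Term A → Prop) : Term A → Term A → Prop
  | base {s t} (h : R s t) : InContext R s t
  | alt_left {s s'} (t) (h : InContext R s s') : InContext R (alt s t) (alt s' t)
  | alt_right (s) {t t'} (h : InContext R t t') : InContext R (alt s t) (alt s t')
  | seq_left {s s'} (t) (h : InContext R s s') : InContext R (seq s t) (seq s' t)
  | seq_right (s) {t t'} (h : InContext R t t') : InContext R (seq s t) (seq s t')
  | delay {t t'} (h : InContext R t t') : InContext R (delay t) (delay t')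
  | par_left {s s'} (t) (h : InContext R s s') : InContext R (par s t) (par s' t)
  | par_right (s) {t t'} (h : InContext R t t') : InContext R (par s t) (par s t')
  | lmerge_left {s s'} (t) (h : InContext R s s') : InContext R (lmerge s t) (lmerge s' t)
  | lmerge_right (s) {t t'} (h : InContext R t t') : InContext R (lmerge s t) (lmerge s t')
  | cmerge_left {s s'} (t) (h : InContext R s s') : InContext R (cmerge s t) (cmerge s' t)
  | cmerge_right (s) {t t'} (h : InContext R t t') : InContext R (cmerge s t) (cmerge s t')
  | encap (H) {t t'} (h : InContext R t t') : InContext R (encap H t) (encap H t')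
  | abstr (I) {t t'} (h : InContext R t t') : InContext R (abstr I t) (abstr I t')
  | timeout {t t'} (h : InContext R t t') : InContext R (timeout t) (timeout t')

/-- One step in the rewriting of the right-hand side of the equation for `i` in `E`: an equation
of `Φ` is used in either direction, or the equation of `E` for some `j ≠ i` is used from left to
right. All terms are over the given signature. -/
def RewriteStep (Sig : Term A → Prop) (Φ : Term A → Term A → Prop)
    (V : Set ℕ) (E : V → Term A) (i : V) (s t : Term A) : Prop :=
  Sig s ∧ Sig t ∧
    InContext (fun l r => Φ l r ∨ Φ r l ∨ ∃ j : V, j ≠ i ∧ l = var j ∧ r = E j) s t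

/-- The recursive specification `E` over the signature `Sig` is guarded modulo `Φ`. -/
def GuardedModulo (Sig : Term A → Prop) (Φ : Term A → Term A → Prop)
    (V : Set ℕ) (E : V → Term A) : Prop :=
  ∀ i : V, ∃ g : Term A,
    Relation.ReflTransGen (RewriteStep Sig Φ V E i) (E i) g ∧ g.Guarded

/-- `E` is a recursive specification over the signature `Sig`. -/
def IsRecSpec (Sig : Term A → Prop) (V : Set ℕ) (E : V → Term A) : Prop :=
  ∀ i : V, Sig (E i) ∧ (E i).vars ⊆ V

/-- `RecLevel γ T n V E`: the constants `⟨X | E⟩`, for `X ∈ V`, belong to the `n`-th signature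
in the construction of the extension of `T` with nested guarded recursion. -/
def RecLevel (γ : Communication A) (T : Theory) :
    ℕ → (V : Set ℕ) → (V → Term A) → Prop
  | 0 => fun _ _ => False
  | n + 1 => fun V E =>
      RecLevel γ T n V E ∨
        (IsRecSpec (IsOver T (RecLevel γ T n)) V E ∧
          GuardedModulo (IsOver T (RecLevel γ T n))
            (fun s t => BaseAxiom γ T s t ∨ RDPAxiom (RecLevel γ T n) s t) V E)

/-- The recursive specifications whose constants belong to the theory `T` with recursion. -/
def IsRec (γ : Communication A) (T : Theory) (V : Set ℕ) (E : V → Term A) : Prop :=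
  ∃ n, RecLevel γ T n V E

/-- The terms of the theory `T` with nested guarded recursion. -/
def IsTerm (γ : Communication A) (T : Theory) (t : Term A) : Prop :=
  t.IsOver T (IsRec γ T)

/-- The closed terms of the theory `T` with nested guarded recursion. -/
def IsClosedTerm (γ : Communication A) (T : Theory) (t : Term A) : Prop :=
  IsTerm γ T t ∧ t.vars = ∅

/-- `Derivable γ T s t`: the equation `s = t` is derivable, by conditional equational logic,
from the axioms of the theory `T` with nested guarded recursion, that is, from the axioms of `T`,
the equations `RDP` and the conditional equations `RSP` (`E ⇒ X = ⟨X | E⟩`, with one premise for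
each of the possibly infinitely many equations of `E`). All terms involved are terms of that
theory. -/
inductive Derivable (γ : Communication A) (T : Theory) : Term A → Term A → Prop
  | refl {t} (h : IsTerm γ T t) : Derivable γ T t t
  | symm {s t} (h : Derivable γ T s t) : Derivable γ T t s
  | trans {s t u} (h : Derivable γ T s t) (h' : Derivable γ T t u) : Derivable γ T s u
  | alt {s s' t t'} (h : Derivable γ T s s') (h' : Derivable γ T t t') :
      Derivable γ T (alt s t) (alt s' t')
  | seq {s s' t t'} (h : Derivable γ T s s') (h' : Derivable γ T t t') :
      Derivable γ T (seq s t) (seq s' t')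
  | delay {t t'} (h : Derivable γ T t t') : Derivable γ T (delay t) (delay t')
  | par {s s' t t'} (hT : T = .acp) (h : Derivable γ T s s') (h' : Derivable γ T t t') :
      Derivable γ T (par s t) (par s' t')
  | lmerge {s s' t t'} (hT : T = .acp) (h : Derivable γ T s s') (h' : Derivable γ T t t') :
      Derivable γ T (lmerge s t) (lmerge s' t')
  | cmerge {s s' t t'} (hT : T = .acp) (h : Derivable γ T s s') (h' : Derivable γ T t t') :
      Derivable γ T (cmerge s t) (cmerge s' t')
  | encap (H) {t t'} (hT : T = .acp) (h : Derivable γ T t t') :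
      Derivable γ T (encap H t) (encap H t')
  | abstr (I) {t t'} (h : Derivable γ T t t') : Derivable γ T (abstr I t) (abstr I t')
  | timeout {t t'} (h : Derivable γ T t t') : Derivable γ T (timeout t) (timeout t')
  | base {s t} (hs : IsTerm γ T s) (ht : IsTerm γ T t) (h : BaseAxiom γ T s t) :
      Derivable γ T s t
  | rdp {s t} (h : RDPAxiom (IsRec γ T) s t) : Derivable γ T s t
  | rsp (V : Set ℕ) (E : V → Term A) (hE : IsRec γ T V E)
      (σ : ℕ → Term A) (hσ : ∀ x, IsTerm γ T (σ x))
      (h : ∀ j : V, Derivable γ T (σ j) ((E j).subst σ)) (X : V) :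
      Derivable γ T (σ X) (recur V E X)

end Axioms

end ACPdrt

namespace ACPdrt

open Term

variable {A : Type*}

/-! ### Signatures -/

/-! The argument takes place in the algebra `Proc γ` of ACP terms modulo derivable equality. Suppose
a set `R` of processes contains the class of `t`, and each member of `R` equals a `Tree` over `R`: a
finite sum of atoms, `a·k`, `σ(k)` and `τ·g`, with `k ∈ R` and `g` again a tree. Only countably many
processes are reachable from `t` by unfolding trees, so the trees form a specification in the
available variables. It is literally guarded and lies in the signature of both theories, and RSP in
ACP equates `t` with one of its constants (`Proc.exists_recur`).

Since `τ` does not guard, a process has such a tree only if it has a head normal form in which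
chains of silent steps can be unfolded to an end. This is what `Proc.Res` expresses; there are two
cases.

If some `γ(a,b)` is `τ`, then `X = a·X ∣ b` is guarded although it amounts to `X = τ·X`. By RSP its
solution is unique, which forces `τ·x = τ` for every `x` (`Proc.tau_mul_of_silent`). Silent chains
collapse, and head normal forms suffice; they are read off from the guarded term to which each
right-hand side rewrites (`Proc.HasHNF.recur`).

If communication is never silent, that guarded term does not suffice: rewriting may introduce
abstraction, and a term like `τ_I(⟨X | X = a·X⟩)` with `a ∈ I` diverges silently. Instead a trace
model is used that validates all axioms and in which guarded specifications have unique solutions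
(`GuardedModulo.gfp_le_lfp`). To the least solution, marks of unknown behaviour are added at each
variable whose process is not yet known to split into a current and a delayed part, to have a head
normal form, or to have well-founded silent chains. The operators propagate marks in such a way that
a composite process has each property whose mark is absent (`Proc.Faithful.pev`). So the marked
valuation is a post-fixed point; it lies below the greatest solution, hence below the least one,
which has no marks (`known_ev`). Thus no mark was ever added (`Proc.Faithful.recur`). -/

theorem Term.IsOver.mono {T : Theory} {C D : (V : Set ℕ) → (V → Term A) → Prop}
    (hCD : ∀ V E, C V E → D V E) : ∀ {t : Term A}, t.IsOver T C → t.IsOver T D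
  | var _, _ => trivial
  | atom _, _ => trivial
  | alt _ _, h => ⟨h.1.mono hCD, h.2.mono hCD⟩
  | seq _ _, h => ⟨h.1.mono hCD, h.2.mono hCD⟩
  | delay t, h => mono hCD (t := t) h
  | par _ _, h => ⟨h.1, h.2.1.mono hCD, h.2.2.mono hCD⟩
  | lmerge _ _, h => ⟨h.1, h.2.1.mono hCD, h.2.2.mono hCD⟩
  | cmerge _ _, h => ⟨h.1, h.2.1.mono hCD, h.2.2.mono hCD⟩
  | encap _ _, h => ⟨h.1, h.2.mono hCD⟩
  | abstr _ t, h => mono hCD (t := t) h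
  | timeout t, h => mono hCD (t := t) h
  | recur V E _, h => hCD V E h

theorem Term.IsOver.subst {T : Theory} {C : (V : Set ℕ) → (V → Term A) → Prop} {σ : ℕ → Term A} :
    ∀ {t : Term A}, t.IsOver T C → (∀ x ∈ t.vars, (σ x).IsOver T C) → (t.subst σ).IsOver T C
  | var x, _, hσ => hσ x rfl
  | atom _, _, _ => trivial
  | alt _ _, h, hσ => ⟨h.1.subst fun x hx => hσ x (.inl hx), h.2.subst fun x hx => hσ x (.inr hx)⟩
  | seq _ _, h, hσ => ⟨h.1.subst fun x hx => hσ x (.inl hx), h.2.subst fun x hx => hσ x (.inr hx)⟩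
  | delay t, h, hσ => subst (t := t) h hσ
  | par _ _, h, hσ =>
    ⟨h.1, h.2.1.subst fun x hx => hσ x (.inl hx), h.2.2.subst fun x hx => hσ x (.inr hx)⟩
  | lmerge _ _, h, hσ =>
    ⟨h.1, h.2.1.subst fun x hx => hσ x (.inl hx), h.2.2.subst fun x hx => hσ x (.inr hx)⟩
  | cmerge _ _, h, hσ =>
    ⟨h.1, h.2.1.subst fun x hx => hσ x (.inl hx), h.2.2.subst fun x hx => hσ x (.inr hx)⟩
  | encap _ _, h, hσ => ⟨h.1, h.2.subst hσ⟩
  | abstr _ t, h, hσ => subst (t := t) h hσ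
  | timeout t, h, hσ => subst (t := t) h hσ
  | recur _ _ _, h, _ => h

theorem RecLevel.spec {γ : Communication A} {T : Theory} : ∀ {n : ℕ} {V : Set ℕ} {E : V → Term A},
    RecLevel γ T n V E → IsRecSpec (IsOver T (IsRec γ T)) V E
  | 0, _, _, h => h.elim
  | _ + 1, _, _, .inl h => h.spec
  | n + 1, _, _, .inr h => fun i => ⟨(h.1 i).1.mono fun _ _ h => ⟨n, h⟩, (h.1 i).2⟩

theorem IsRec.spec {γ : Communication A} {T : Theory} {V : Set ℕ} {E : V → Term A}
    (h : IsRec γ T V E) : IsRecSpec (IsOver T (IsRec γ T)) V E :=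
  h.choose_spec.spec

theorem IsRec.isTerm_recClose {γ : Communication A} {T : Theory} {V : Set ℕ} {E : V → Term A}
    (h : IsRec γ T V E) {t : Term A} (ht : IsTerm γ T t) : IsTerm γ T (recClose V E t) := by
  refine Term.IsOver.subst ht fun x _ => ?_
  split
  · exact h
  · trivial

/-! ### The algebra of terms modulo derivability -/

/-- Derivable equality of terms of the theory with parallel composition. -/
def procSetoid (γ : Communication A) : Setoid {t : Term A // IsTerm γ .acp t} where
  r s t := Derivable γ .acp s.1 t.1
  iseqv := ⟨fun t => .refl t.2, .symm, .trans⟩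

/-- Terms modulo derivable equality. -/
def Proc (γ : Communication A) := Quotient (procSetoid γ)

namespace Proc

variable {γ : Communication A}

def mk (t : Term A) (h : IsTerm γ .acp t) : Proc γ := Quotient.mk (procSetoid γ) ⟨t, h⟩

theorem mk_eq {s t : Term A} {hs : IsTerm γ .acp s} {ht : IsTerm γ .acp t} :
    mk s hs = mk t ht ↔ Derivable γ .acp s t :=
  ⟨fun h => Quotient.exact h, fun h => Quotient.sound h⟩

theorem mk_axiom {s t : Term A} {hs : IsTerm γ .acp s} {ht : IsTerm γ .acp t}
    (h : ACPAxiom γ s t) : mk s hs = mk t ht :=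
  mk_eq.2 (.base hs ht h)

theorem ind {p : Proc γ → Prop} (h : ∀ t ht, p (mk t ht)) (x : Proc γ) : p x :=
  Quotient.ind (fun t => h t.1 t.2) x

def at' (a : Atom A) : Proc γ := mk (atom a) trivial

instance : Add (Proc γ) := ⟨Quotient.map₂ (fun s t => ⟨alt s.1 t.1, s.2, t.2⟩)
  fun _ _ h _ _ h' => Derivable.alt h h'⟩

instance : Mul (Proc γ) := ⟨Quotient.map₂ (fun s t => ⟨seq s.1 t.1, s.2, t.2⟩)
  fun _ _ h _ _ h' => Derivable.seq h h'⟩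

def dl : Proc γ → Proc γ := Quotient.map (fun t => ⟨delay t.1, t.2⟩) fun _ _ h => Derivable.delay h

def par : Proc γ → Proc γ → Proc γ := Quotient.map₂ (fun s t => ⟨Term.par s.1 t.1, rfl, s.2, t.2⟩)
  fun _ _ h _ _ h' => Derivable.par rfl h h'

def lm : Proc γ → Proc γ → Proc γ := Quotient.map₂ (fun s t => ⟨lmerge s.1 t.1, rfl, s.2, t.2⟩)
  fun _ _ h _ _ h' => Derivable.lmerge rfl h h'

def cm : Proc γ → Proc γ → Proc γ := Quotient.map₂ (fun s t => ⟨cmerge s.1 t.1, rfl, s.2, t.2⟩)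
  fun _ _ h _ _ h' => Derivable.cmerge rfl h h'

def enc (H : Set A) : Proc γ → Proc γ := Quotient.map (fun t => ⟨encap H t.1, rfl, t.2⟩)
  fun _ _ h => Derivable.encap H rfl h

def abs (I : Set A) : Proc γ → Proc γ := Quotient.map (fun t => ⟨abstr I t.1, t.2⟩)
  fun _ _ h => Derivable.abstr I h

def tmo : Proc γ → Proc γ := Quotient.map (fun t => ⟨timeout t.1, t.2⟩)
  fun _ _ h => Derivable.timeout h

instance : Zero (Proc γ) := ⟨at' .dead⟩

theorem at_dead : at' .dead = (0 : Proc γ) := rfl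

/-! ### The axioms as equations between processes. -/

protected theorem add_comm (x y : Proc γ) : x + y = y + x := by
  induction x using ind; induction y using ind
  exact mk_axiom (.bpa (.A1 _ _))

protected theorem add_assoc (x y z : Proc γ) : x + y + z = x + (y + z) := by
  induction x using ind; induction y using ind; induction z using ind
  exact mk_axiom (.bpa (.A2 _ _ _))

protected theorem add_zero (x : Proc γ) : x + 0 = x := by
  induction x using ind
  exact mk_axiom (.bpa (.A6DR _))

instance : AddCommMonoid (Proc γ) where
  add_assoc := Proc.add_assoc
  zero_add x := by rw [Proc.add_comm, Proc.add_zero]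
  add_zero := Proc.add_zero
  add_comm := Proc.add_comm
  nsmul := nsmulRec

theorem add_self (x : Proc γ) : x + x = x := by
  induction x using ind
  exact mk_axiom (.bpa (.A3 _))

protected theorem add_mul (x y z : Proc γ) : (x + y) * z = x * z + y * z := by
  induction x using ind; induction y using ind; induction z using ind
  exact mk_axiom (.bpa (.A4 _ _ _))

protected theorem mul_assoc (x y z : Proc γ) : x * y * z = x * (y * z) := by
  induction x using ind; induction y using ind; induction z using ind
  exact mk_axiom (.bpa (.A5 _ _ _))

protected theorem zero_mul (x : Proc γ) : 0 * x = 0 := by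
  induction x using ind
  exact mk_axiom (.bpa (.A7DR _))

theorem dl_add (x y : Proc γ) : dl x + dl y = dl (x + y) := by
  induction x using ind; induction y using ind
  exact mk_axiom (.bpa (.DRT1 _ _))

theorem dl_mul (x y : Proc γ) : dl x * y = dl (x * y) := by
  induction x using ind; induction y using ind
  exact mk_axiom (.bpa (.DRT2 _ _))

theorem abs_at_of_notMem {I : Set A} {a : Atom A} (h : a ∉ Atom.act '' I) :
    abs I (at' a : Proc γ) = at' a :=
  mk_axiom (.bpa (.TI1DR I a h))

theorem abs_at_of_mem {I : Set A} {a : Atom A} (h : a ∈ Atom.act '' I) :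
    abs I (at' a : Proc γ) = at' .tau :=
  mk_axiom (.bpa (.TI2DR I a h))

theorem abs_add (I : Set A) (x y : Proc γ) : abs I (x + y) = abs I x + abs I y := by
  induction x using ind; induction y using ind
  exact mk_axiom (.bpa (.TI3 _ _ _))

theorem abs_mul (I : Set A) (x y : Proc γ) : abs I (x * y) = abs I x * abs I y := by
  induction x using ind; induction y using ind
  exact mk_axiom (.bpa (.TI4 _ _ _))

theorem abs_dl (I : Set A) (x : Proc γ) : abs I (dl x) = dl (abs I x) := by
  induction x using ind
  exact mk_axiom (.bpa (.DRTI _ _))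

theorem to_at (a : Atom A) : tmo (at' a : Proc γ) = at' a :=
  mk_axiom (.bpa (.DRTO1 a))

theorem to_add (x y : Proc γ) : tmo (x + y) = tmo x + tmo y := by
  induction x using ind; induction y using ind
  exact mk_axiom (.bpa (.DRTO2 _ _))

theorem to_mul (x y : Proc γ) : tmo (x * y) = tmo x * y := by
  induction x using ind; induction y using ind
  exact mk_axiom (.bpa (.DRTO3 _ _))

theorem to_dl (x : Proc γ) : tmo (dl x) = 0 := by
  induction x using ind
  exact mk_axiom (.bpa (.DRTO4 _))

theorem at_mul_tau (a : Atom A) : at' a * at' .tau = (at' a : Proc γ) :=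
  mk_axiom (.bpa (.DRB1 a))

theorem drb2 (a : Atom A) (x y : Proc γ) :
    at' a * (at' .tau * (tmo x + y) + tmo x) = at' a * (tmo x + y) := by
  induction x using ind; induction y using ind
  exact mk_axiom (.bpa (.DRB2 _ _ _))

theorem drb3 (a : Atom A) (x y : Proc γ) :
    at' a * (at' .tau * (tmo x + y) + y) = at' a * (tmo x + y) := by
  induction x using ind; induction y using ind
  exact mk_axiom (.bpa (.DRB3 _ _ _))

theorem drb4 (a : Atom A) (x y : Proc γ) :
    at' a * (dl (at' .tau * x) + tmo y) = at' a * (dl x + tmo y) := by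
  induction x using ind; induction y using ind
  exact mk_axiom (.bpa (.DRB4 _ _ _))

theorem enc_at_of_notMem {H : Set A} {a : Atom A} (h : a ∉ Atom.act '' H) :
    enc H (at' a : Proc γ) = at' a :=
  mk_axiom (.D1DR H a h)

theorem enc_at_of_mem {H : Set A} {a : Atom A} (h : a ∈ Atom.act '' H) :
    enc H (at' a : Proc γ) = 0 :=
  mk_axiom (.D2DR H a h)

theorem enc_add (H : Set A) (x y : Proc γ) : enc H (x + y) = enc H x + enc H y := by
  induction x using ind; induction y using ind
  exact mk_axiom (.D3 _ _ _)

theorem enc_mul (H : Set A) (x y : Proc γ) : enc H (x * y) = enc H x * enc H y := by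
  induction x using ind; induction y using ind
  exact mk_axiom (.D4 _ _ _)

theorem enc_dl (H : Set A) (x : Proc γ) : enc H (dl x) = dl (enc H x) := by
  induction x using ind
  exact mk_axiom (.DRD _ _)

theorem par_eq (x y : Proc γ) : par x y = lm x y + lm y x + cm x y := by
  induction x using ind; induction y using ind
  exact mk_axiom (.CM1 _ _)

theorem at_lm (a : Atom A) (x : Proc γ) : lm (at' a) x = at' a * x := by
  induction x using ind
  exact mk_axiom (.CM2DR _ _)

theorem at_mul_lm (a : Atom A) (x y : Proc γ) : lm (at' a * x) y = at' a * par x y := by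
  induction x using ind; induction y using ind
  exact mk_axiom (.CM3DR _ _ _)

theorem dl_lm_to (x y : Proc γ) : lm (dl x) (tmo y) = 0 := by
  induction x using ind; induction y using ind
  exact mk_axiom (.DRCM1 _ _)

theorem dl_lm_add (x y z : Proc γ) : lm (dl x) (tmo y + dl z) = dl (lm x z) := by
  induction x using ind; induction y using ind; induction z using ind
  exact mk_axiom (.DRCM2 _ _ _)

theorem add_lm (x y z : Proc γ) : lm (x + y) z = lm x z + lm y z := by
  induction x using ind; induction y using ind; induction z using ind
  exact mk_axiom (.CM4 _ _ _)

theorem cm5 (a b : Atom A) (x : Proc γ) :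
    cm (at' a * x) (at' b) = cm (at' a) (at' b) * x := by
  induction x using ind
  exact mk_axiom (.CM5DR _ _ _)

theorem cm6 (a b : Atom A) (x : Proc γ) :
    cm (at' a) (at' b * x) = cm (at' a) (at' b) * x := by
  induction x using ind
  exact mk_axiom (.CM6DR _ _ _)

theorem cm7 (a b : Atom A) (x y : Proc γ) :
    cm (at' a * x) (at' b * y) = cm (at' a) (at' b) * par x y := by
  induction x using ind; induction y using ind
  exact mk_axiom (.CM7DR _ _ _ _)

theorem to_cm_dl (x y : Proc γ) : cm (tmo x) (dl y) = 0 := by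
  induction x using ind; induction y using ind
  exact mk_axiom (.DRCM3 _ _)

theorem dl_cm_to (x y : Proc γ) : cm (dl x) (tmo y) = 0 := by
  induction x using ind; induction y using ind
  exact mk_axiom (.DRCM4 _ _)

theorem dl_cm_dl (x y : Proc γ) : cm (dl x) (dl y) = dl (cm x y) := by
  induction x using ind; induction y using ind
  exact mk_axiom (.DRCM5 _ _)

theorem add_cm (x y z : Proc γ) : cm (x + y) z = cm x z + cm y z := by
  induction x using ind; induction y using ind; induction z using ind
  exact mk_axiom (.CM8 _ _ _)

theorem cm_add (x y z : Proc γ) : cm x (y + z) = cm x y + cm x z := by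
  induction x using ind; induction y using ind; induction z using ind
  exact mk_axiom (.CM9 _ _ _)

theorem cm_at (a b : Atom A) : cm (at' a) (at' b) = (at' (γ.comm a b) : Proc γ) :=
  mk_axiom (.CFDR a b)

open Classical in
/-- The class of a term; terms that are not terms of the theory are sent to deadlock. -/
noncomputable def cls (γ : Communication A) (t : Term A) : Proc γ :=
  if h : IsTerm γ .acp t then mk t h else 0

theorem cls_of {t : Term A} (h : IsTerm γ .acp t) : cls γ t = mk t h := dif_pos h

theorem cls_eq {s t : Term A} (hs : IsTerm γ .acp s) (ht : IsTerm γ .acp t) :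
    cls γ s = cls γ t ↔ Derivable γ .acp s t := by
  rw [cls_of hs, cls_of ht, mk_eq]

theorem exists_cls (x : Proc γ) : ∃ t, IsTerm γ .acp t ∧ cls γ t = x := by
  induction x using ind with | h t ht => exact ⟨t, ht, cls_of ht⟩

/-- Evaluation of terms in the algebra of terms modulo derivable equality. -/
noncomputable def pev (ρ : ℕ → Proc γ) : Term A → Proc γ
  | var x => ρ x
  | atom a => at' a
  | alt s t => pev ρ s + pev ρ t
  | seq s t => pev ρ s * pev ρ t
  | delay t => dl (pev ρ t)
  | .par s t => par (pev ρ s) (pev ρ t)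
  | lmerge s t => lm (pev ρ s) (pev ρ t)
  | cmerge s t => cm (pev ρ s) (pev ρ t)
  | encap H t => enc H (pev ρ t)
  | abstr I t => abs I (pev ρ t)
  | timeout t => tmo (pev ρ t)
  | recur V E X => cls γ (recur V E X)

theorem pev_subst (ρ : ℕ → Proc γ) (σ : ℕ → Term A) (t : Term A) :
    pev ρ (t.subst σ) = pev (fun x => pev ρ (σ x)) t := by
  induction t <;> simp_all [pev, subst]

theorem pev_congr {ρ ρ' : ℕ → Proc γ} {t : Term A} (h : ∀ x ∈ t.vars, ρ x = ρ' x) :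
    pev ρ t = pev ρ' t := by
  induction t <;> simp_all [pev, vars, or_imp, forall_and]

theorem pev_cls {t : Term A} (ht : IsTerm γ .acp t) : pev (fun x => cls γ (var x)) t = cls γ t := by
  rw [cls_of ht]
  induction t with
  | var x => exact cls_of _
  | atom a => rfl
  | alt s t ihs iht => rw [pev, ihs ht.1, iht ht.2]; rfl
  | seq s t ihs iht => rw [pev, ihs ht.1, iht ht.2]; rfl
  | par s t ihs iht => rw [pev, ihs ht.2.1, iht ht.2.2]; rfl
  | lmerge s t ihs iht => rw [pev, ihs ht.2.1, iht ht.2.2]; rfl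
  | cmerge s t ihs iht => rw [pev, ihs ht.2.1, iht ht.2.2]; rfl
  | delay t iht => rw [pev, iht ht]; rfl
  | encap H t iht => rw [pev, iht ht.2]; rfl
  | abstr I t iht => rw [pev, iht ht]; rfl
  | timeout t iht => rw [pev, iht ht]; rfl
  | recur V E X => exact cls_of _

theorem pev_eq_cls {t : Term A} (ht : IsTerm γ .acp t) (hv : t.vars = ∅) (ρ : ℕ → Proc γ) :
    pev ρ t = cls γ t := by
  rw [← pev_cls ht]
  exact pev_congr (by simp [hv])

theorem cls_subst {t : Term A} (ht : IsTerm γ .acp t) {σ : ℕ → Term A}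
    (hσ : ∀ x, IsTerm γ .acp (σ x)) : cls γ (t.subst σ) = pev (fun x => cls γ (σ x)) t := by
  rw [← pev_cls (Term.IsOver.subst ht fun x _ => hσ x), pev_subst]
  congr 1; funext x; exact pev_cls (hσ x)

theorem pev_axiom {s t : Term A} (h : ACPAxiom γ s t) (ρ : ℕ → Proc γ) : pev ρ s = pev ρ t := by
  induction h with
  | bpa h =>
    induction h with
    | A1 => exact Proc.add_comm _ _
    | A2 => exact Proc.add_assoc _ _ _
    | A3 => exact add_self _
    | A4 => exact Proc.add_mul _ _ _
    | A5 => exact Proc.mul_assoc _ _ _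
    | A6DR => exact Proc.add_zero _
    | A7DR => exact Proc.zero_mul _
    | DRT1 => exact dl_add _ _
    | DRT2 => exact dl_mul _ _
    | TI1DR _ _ h => exact abs_at_of_notMem h
    | TI2DR _ _ h => exact abs_at_of_mem h
    | TI3 => exact abs_add _ _ _
    | TI4 => exact abs_mul _ _ _
    | DRTI => exact abs_dl _ _
    | DRTO1 => exact to_at _
    | DRTO2 => exact to_add _ _
    | DRTO3 => exact to_mul _ _
    | DRTO4 => exact to_dl _
    | DRB1 => exact at_mul_tau _
    | DRB2 => exact drb2 _ _ _
    | DRB3 => exact drb3 _ _ _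
    | DRB4 => exact drb4 _ _ _
  | D1DR _ _ h => exact enc_at_of_notMem h
  | D2DR _ _ h => exact enc_at_of_mem h
  | D3 => exact enc_add _ _ _
  | D4 => exact enc_mul _ _ _
  | DRD => exact enc_dl _ _
  | CM1 => exact par_eq _ _
  | CM2DR => exact at_lm _ _
  | CM3DR => exact at_mul_lm _ _ _
  | DRCM1 => exact dl_lm_to _ _
  | DRCM2 => exact dl_lm_add _ _ _
  | CM4 => exact add_lm _ _ _
  | CM5DR => exact cm5 _ _ _
  | CM6DR => exact cm6 _ _ _
  | CM7DR => exact cm7 _ _ _ _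
  | DRCM3 => exact to_cm_dl _ _
  | DRCM4 => exact dl_cm_to _ _
  | DRCM5 => exact dl_cm_dl _ _
  | CM8 => exact add_cm _ _ _
  | CM9 => exact cm_add _ _ _
  | CFDR => exact cm_at _ _

open Classical in
/-- The valuation sending the variables of a specification to its recursion constants, and all
other variables to deadlock. -/
noncomputable def recVal (γ : Communication A) (V : Set ℕ) (E : V → Term A) (x : ℕ) : Proc γ :=
  if h : x ∈ V then cls γ (recur V E ⟨x, h⟩) else 0

/-- `RDP` in the algebra of terms modulo derivable equality. -/
theorem cls_recur {V : Set ℕ} {E : V → Term A} (h : IsRec γ .acp V E) (X : V) :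
    cls γ (recur V E X) = pev (recVal γ V E) (E X) := by
  rw [(cls_eq (show IsTerm γ .acp (recur V E X) from h) (h.isTerm_recClose (h.spec X).1)).2 (.rdp (.rdp V E X h)), recClose, cls_subst]
  · refine pev_congr fun x hx => ?_
    simp [recVal, (h.spec X).2 hx]
  · exact (h.spec X).1
  · intro x
    split
    · exact h
    · trivial

theorem pev_rdp {s t : Term A} (h : RDPAxiom (IsRec γ .acp) s t) (ρ : ℕ → Proc γ) :
    pev ρ s = pev ρ t := by
  obtain ⟨V, E, X, h⟩ := h
  rw [pev, cls_recur h, recClose, pev_subst]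
  refine pev_congr fun x hx => ?_
  simp [recVal, (h.spec X).2 hx, pev]

theorem pev_inContext {R : Term A → Term A → Prop} {ρ : ℕ → Proc γ}
    (hR : ∀ s t, R s t → pev ρ s = pev ρ t) {s t : Term A} (h : InContext R s t) :
    pev ρ s = pev ρ t := by
  induction h with
  | base h => exact hR _ _ h
  | _ => simp_all [pev]

end Proc

/-! ### Head normal forms -/

/-- An executable atom: a basic action, or the silent step `none`. -/
def exec : Option A → Atom A
  | none => .tau
  | some a => .act a

/-- The executable atom that an atom stands for, if it is not deadlock. -/
def Atom.exec? : Atom A → Option (Option A)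
  | .dead => none
  | .tau => some none
  | .act a => some (some a)

theorem Atom.exec?_eq_some {a : Atom A} {b : Option A} : a.exec? = some b ↔ a = exec b := by
  cases a <;> cases b <;> simp [Atom.exec?, exec]

theorem Atom.exec?_eq_none {a : Atom A} : a.exec? = none ↔ a = .dead := by
  cases a <;> simp [Atom.exec?]

theorem Communication.comm_dead' (γ : Communication A) (a : Atom A) :
    γ.comm a .dead = .dead := by rw [γ.comm_symm, γ.comm_dead]

theorem Communication.comm_tau' (γ : Communication A) (a : Atom A) :
    γ.comm a .tau = .dead := by rw [γ.comm_symm, γ.comm_tau]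

namespace Proc

variable {γ : Communication A}

/-- Terms modulo derivable equality that are represented by closed terms, if `b` holds by closed
terms without abstraction. -/
def K (γ : Communication A) (b : Prop) : Set (Proc γ) :=
  {x | ∃ t, IsTerm γ .acp t ∧ (b → t.AbstrFree) ∧ pev (fun _ => 0) t = x}

/-! ### Closure of the represented processes under the operators. -/

section K

variable {b : Prop} {x y : Proc γ}

theorem K.at' (a : Atom A) : (at' a : Proc γ) ∈ K γ b := ⟨atom a, trivial, fun _ => trivial, rfl⟩

theorem K.zero : (0 : Proc γ) ∈ K γ b := K.at' .dead

theorem K.add (hx : x ∈ K γ b) (hy : y ∈ K γ b) : x + y ∈ K γ b := by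
  obtain ⟨s, hs, hs', rfl⟩ := hx; obtain ⟨t, ht, ht', rfl⟩ := hy
  exact ⟨alt s t, ⟨hs, ht⟩, fun h => ⟨hs' h, ht' h⟩, rfl⟩

theorem K.mul (hx : x ∈ K γ b) (hy : y ∈ K γ b) : x * y ∈ K γ b := by
  obtain ⟨s, hs, hs', rfl⟩ := hx; obtain ⟨t, ht, ht', rfl⟩ := hy
  exact ⟨seq s t, ⟨hs, ht⟩, fun h => ⟨hs' h, ht' h⟩, rfl⟩

theorem K.dl (hx : x ∈ K γ b) : dl x ∈ K γ b := by
  obtain ⟨s, hs, hs', rfl⟩ := hx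
  exact ⟨delay s, hs, hs', rfl⟩

theorem K.par (hx : x ∈ K γ b) (hy : y ∈ K γ b) : par x y ∈ K γ b := by
  obtain ⟨s, hs, hs', rfl⟩ := hx; obtain ⟨t, ht, ht', rfl⟩ := hy
  exact ⟨.par s t, ⟨rfl, hs, ht⟩, fun h => ⟨hs' h, ht' h⟩, rfl⟩

theorem K.lm (hx : x ∈ K γ b) (hy : y ∈ K γ b) : lm x y ∈ K γ b := by
  obtain ⟨s, hs, hs', rfl⟩ := hx; obtain ⟨t, ht, ht', rfl⟩ := hy
  exact ⟨lmerge s t, ⟨rfl, hs, ht⟩, fun h => ⟨hs' h, ht' h⟩, rfl⟩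

theorem K.cm (hx : x ∈ K γ b) (hy : y ∈ K γ b) : cm x y ∈ K γ b := by
  obtain ⟨s, hs, hs', rfl⟩ := hx; obtain ⟨t, ht, ht', rfl⟩ := hy
  exact ⟨cmerge s t, ⟨rfl, hs, ht⟩, fun h => ⟨hs' h, ht' h⟩, rfl⟩

theorem K.enc (H : Set A) (hx : x ∈ K γ b) : enc H x ∈ K γ b := by
  obtain ⟨s, hs, hs', rfl⟩ := hx
  exact ⟨encap H s, ⟨rfl, hs⟩, hs', rfl⟩

theorem K.abs (hb : ¬b) (I : Set A) (hx : x ∈ K γ b) : abs I x ∈ K γ b := by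
  obtain ⟨s, hs, hs', rfl⟩ := hx
  exact ⟨abstr I s, hs, fun h => (hb h).elim, rfl⟩

theorem K.tmo (hx : x ∈ K γ b) : tmo x ∈ K γ b := by
  obtain ⟨s, hs, hs', rfl⟩ := hx
  exact ⟨timeout s, hs, hs', rfl⟩

theorem K.recur {V : Set ℕ} {E : V → Term A} (h : IsRec γ .acp V E)
    (hE : b → ∀ j, (E j).AbstrFree) (X : V) : cls γ (recur V E X) ∈ K γ b :=
  ⟨Term.recur V E X, h, hE, rfl⟩

end K

/-- The summands of head normal forms. -/
inductive Summand (γ : Communication A)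
  | fin (b : Option A)
  | pre (b : Option A) (k : Proc γ)
  | del (k : Proc γ)

/-! ### Operators acting on single summands. -/

namespace Summand

def val : Summand γ → Proc γ
  | fin b => at' (exec b)
  | pre b k => at' (exec b) * k
  | del k => dl k

def Over (b : Prop) : Summand γ → Prop
  | fin _ => True
  | pre _ k => k ∈ K γ b
  | del k => k ∈ K γ b

def mulRight (y : Proc γ) : Summand γ → Summand γ
  | fin b => pre b y
  | pre b k => pre b (k * y)
  | del k => del (k * y)

/-- Here and below, `none` stands for a summand that becomes deadlock and drops out of the sum. -/
def tmo : Summand γ → Option (Summand γ)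
  | fin b => some (fin b)
  | pre b k => some (pre b k)
  | del _ => none

open Classical in
noncomputable def enc (H : Set A) : Summand γ → Option (Summand γ)
  | fin b => if exec b ∈ Atom.act '' H then none else some (fin b)
  | pre b k => if exec b ∈ Atom.act '' H then none else some (pre b (Proc.enc H k))
  | del k => some (del (Proc.enc H k))

open Classical in
noncomputable def abs (I : Set A) : Summand γ → Summand γ
  | fin b => fin (if exec b ∈ Atom.act '' I then none else b)
  | pre b k => pre (if exec b ∈ Atom.act '' I then none else b) (Proc.abs I k)
  | del k => del (Proc.abs I k)

/-- The summand of the left merge with a process `y` whose delayed part is given by `o`. -/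
def lm (y : Proc γ) (o : Option (Proc γ)) : Summand γ → Option (Summand γ)
  | fin b => some (pre b y)
  | pre b k => some (pre b (par k y))
  | del k => o.map fun m => del (Proc.lm k m)

def cm : Summand γ → Summand γ → Option (Summand γ)
  | fin b, fin b' => (γ.comm (exec b) (exec b')).exec?.map fin
  | fin b, pre b' k' => (γ.comm (exec b) (exec b')).exec?.map (pre · k')
  | pre b k, fin b' => (γ.comm (exec b) (exec b')).exec?.map (pre · k)
  | pre b k, pre b' k' => (γ.comm (exec b) (exec b')).exec?.map (pre · (par k k'))
  | del k, del k' => some (del (Proc.cm k k'))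
  | _, _ => none

end Summand

def sumOf (l : List (Summand γ)) : Proc γ := (l.map Summand.val).sum

@[simp] theorem sumOf_nil : sumOf ([] : List (Summand γ)) = 0 := rfl

@[simp] theorem sumOf_cons (s : Summand γ) (l : List (Summand γ)) :
    sumOf (s :: l) = s.val + sumOf l := by simp [sumOf]

theorem sumOf_append (l l' : List (Summand γ)) : sumOf (l ++ l') = sumOf l + sumOf l' := by
  simp [sumOf]

/-- An operator that distributes over sums is determined on head normal forms by its effect on
single summands. -/
theorem map_sumOf (F : Proc γ → Proc γ) (h0 : F 0 = 0) (hF : ∀ x y, F (x + y) = F x + F y)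
    (f : Summand γ → Option (Summand γ)) {l : List (Summand γ)}
    (hf : ∀ s ∈ l, F s.val = ((f s).map Summand.val).getD 0) :
    F (sumOf l) = sumOf (l.filterMap f) := by
  induction l with
  | nil => simpa using h0
  | cons s l ih =>
    rw [sumOf_cons, hF, hf s (by simp), ih fun s hs => hf s (by simp [hs]), List.filterMap_cons]
    cases f s <;> simp

theorem map_sumOf' (F : Proc γ → Proc γ) (h0 : F 0 = 0) (hF : ∀ x y, F (x + y) = F x + F y)
    (f : Summand γ → Summand γ) {l : List (Summand γ)} (hf : ∀ s ∈ l, F s.val = (f s).val) :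
    F (sumOf l) = sumOf (l.map f) := by
  rw [map_sumOf F h0 hF (fun s => some (f s)) hf]
  simp

theorem sumOf_mul (l : List (Summand γ)) (y : Proc γ) :
    sumOf l * y = sumOf (l.map (Summand.mulRight y)) :=
  map_sumOf' (· * y) (Proc.zero_mul y) (Proc.add_mul · · y) _ fun s _ => by
    cases s
    · rfl
    · exact Proc.mul_assoc _ _ _
    · exact dl_mul _ _

theorem tmo_zero : tmo (0 : Proc γ) = 0 := to_at _

theorem tmo_sumOf (l : List (Summand γ)) : tmo (sumOf l) = sumOf (l.filterMap Summand.tmo) :=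
  map_sumOf tmo tmo_zero to_add _ fun s _ => by
    cases s
    · exact to_at _
    · exact (to_mul _ _).trans (by rw [to_at]; rfl)
    · exact to_dl _

theorem enc_zero (H : Set A) : enc H (0 : Proc γ) = 0 := enc_at_of_notMem (by simp)

theorem abs_zero (H : Set A) : abs H (0 : Proc γ) = 0 := abs_at_of_notMem (by simp)

theorem enc_sumOf (H : Set A) (l : List (Summand γ)) :
    enc H (sumOf l) = sumOf (l.filterMap (Summand.enc H)) :=
  map_sumOf (enc H) (enc_zero H) (enc_add H) _ fun s _ => by
    cases s with
    | fin b =>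
      simp only [Summand.val, Summand.enc]
      split_ifs with h
      · exact enc_at_of_mem h
      · exact enc_at_of_notMem h
    | pre b k =>
      simp only [Summand.val, Summand.enc, enc_mul]
      split_ifs with h
      · rw [enc_at_of_mem h, Proc.zero_mul]; rfl
      · rw [enc_at_of_notMem h]; rfl
    | del k => exact enc_dl _ _

theorem abs_sumOf (I : Set A) (l : List (Summand γ)) :
    abs I (sumOf l) = sumOf (l.map (Summand.abs I)) :=
  map_sumOf' (abs I) (abs_zero I) (abs_add I) _ fun s _ => by
    cases s with
    | fin b =>
      simp only [Summand.val, Summand.abs]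
      split_ifs with h
      · exact abs_at_of_mem h
      · exact abs_at_of_notMem h
    | pre b k =>
      simp only [Summand.val, Summand.abs, abs_mul]
      split_ifs with h
      · rw [abs_at_of_mem h]; rfl
      · rw [abs_at_of_notMem h]
    | del k => exact abs_dl _ _

/-- An optional delayed process. -/
def odl : Option (Proc γ) → Proc γ
  | none => 0
  | some m => dl m

theorem zero_lm (y : Proc γ) : lm 0 y = 0 := by
  rw [← at_dead, at_lm, at_dead, Proc.zero_mul]

/-- The axioms evaluate `σ(m) ⌊⌊ y` only when `y` is of the form `ν(k)` or `ν(k) + σ(z)`. Such a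
splitting of `y` is demanded only if `l` has a delayed summand at all. -/
theorem lm_sumOf {l : List (Summand γ)} {y k : Proc γ} {o : Option (Proc γ)}
    (hy : ∀ m, .del m ∈ l → y = tmo k + odl o) :
    lm (sumOf l) y = sumOf (l.filterMap (Summand.lm y o)) :=
  map_sumOf (lm · y) (zero_lm y) (add_lm · · y) _ fun s hs => by
    cases s with
    | fin b => exact at_lm _ _
    | pre b k => exact at_mul_lm _ _ _
    | del m =>
      rw [hy m hs]
      cases o with
      | none => simpa [odl, Summand.lm, Summand.val] using dl_lm_to _ _
      | some m' => exact dl_lm_add _ _ _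

/-- There is no axiom `x ∣ δ = δ`. For time-outs it follows by expanding `ν(x) ∣ (σ(δ) + δ)` in two
ways, since `ν(x) ∣ σ(δ) = δ`. -/
theorem tmo_cm_zero (x : Proc γ) : cm (tmo x) 0 = 0 := by
  have h := cm_add (tmo x) (dl 0) 0
  rwa [add_zero, to_cm_dl, zero_add, eq_comm] at h

theorem zero_cm_tmo (x : Proc γ) : cm 0 (tmo x) = 0 := by
  have h := add_cm (dl 0) 0 (tmo x)
  rwa [add_zero, dl_cm_to, zero_add, eq_comm] at h

theorem dl_cm_zero (x : Proc γ) : cm (dl x) 0 = 0 := by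
  conv_lhs => rw [← tmo_zero]
  exact dl_cm_to _ _

theorem zero_cm_dl (x : Proc γ) : cm 0 (dl x) = 0 := by
  conv_lhs => rw [← tmo_zero]
  exact to_cm_dl _ _

theorem tmo_val_fin (b : Option A) : tmo (Summand.fin b : Summand γ).val = (Summand.fin b).val :=
  to_at _

theorem tmo_val_pre (b : Option A) (k : Proc γ) :
    tmo (Summand.pre b k).val = (Summand.pre b k).val := by
  simp only [Summand.val, to_mul, to_at]

theorem val_cm_zero (s : Summand γ) : cm s.val 0 = 0 := by
  cases s with
  | fin b => rw [← tmo_val_fin]; exact tmo_cm_zero _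
  | pre b k => rw [← tmo_val_pre]; exact tmo_cm_zero _
  | del k => exact dl_cm_zero k

theorem zero_cm_val (s : Summand γ) : cm 0 s.val = 0 := by
  cases s with
  | fin b => rw [← tmo_val_fin]; exact zero_cm_tmo _
  | pre b k => rw [← tmo_val_pre]; exact zero_cm_tmo _
  | del k => exact zero_cm_dl k

theorem zero_cm_sumOf (l : List (Summand γ)) : cm 0 (sumOf l) = 0 := by
  rw [map_sumOf (cm 0) (by rw [← at_dead, cm_at, γ.comm_dead]) (cm_add 0) (fun _ => none)
    fun s _ => zero_cm_val s]
  simp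

theorem at_eq_exec? (a : Atom A) (k : Proc γ) :
    at' a * k = ((a.exec?.map fun c => Summand.pre c k).map Summand.val).getD 0 := by
  cases a
  · rfl
  · rfl
  · exact Proc.zero_mul k

theorem at_eq_exec?' (a : Atom A) :
    (at' a : Proc γ) = ((a.exec?.map Summand.fin).map Summand.val).getD 0 := by
  cases a <;> rfl

theorem val_cm_val (s s' : Summand γ) :
    cm s.val s'.val = ((s.cm s').map Summand.val).getD 0 := by
  cases s with
  | fin b =>
    cases s' with
    | fin b' => simp only [Summand.val, cm_at]; exact at_eq_exec?' _
    | pre b' k' => simp only [Summand.val, cm6, cm_at]; exact at_eq_exec? _ _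
    | del k' => rw [← tmo_val_fin]; exact to_cm_dl _ _
  | pre b k =>
    cases s' with
    | fin b' => simp only [Summand.val, cm5, cm_at]; exact at_eq_exec? _ _
    | pre b' k' => simp only [Summand.val, cm7, cm_at]; exact at_eq_exec? _ _
    | del k' => rw [← tmo_val_pre]; exact to_cm_dl _ _
  | del k =>
    cases s' with
    | fin b' => rw [← tmo_val_fin]; exact dl_cm_to _ _
    | pre b' k' => rw [← tmo_val_pre]; exact dl_cm_to _ _
    | del k' => exact dl_cm_dl _ _

theorem val_cm_sumOf (s : Summand γ) (l : List (Summand γ)) :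
    cm s.val (sumOf l) = sumOf (l.filterMap s.cm) :=
  map_sumOf (cm s.val) (val_cm_zero s) (cm_add _) _ fun s' _ => val_cm_val s s'

theorem sumOf_cm_sumOf (l l' : List (Summand γ)) :
    cm (sumOf l) (sumOf l') = sumOf (l.flatMap fun s => l'.filterMap s.cm) := by
  induction l with
  | nil => exact zero_cm_sumOf l'
  | cons s l ih => rw [sumOf_cons, add_cm, ih, val_cm_sumOf, List.flatMap_cons, sumOf_append]

theorem par_sumOf {l l' : List (Summand γ)} {k k' : Proc γ} {o o' : Option (Proc γ)}
    (h : ∀ m, .del m ∈ l' → sumOf l = tmo k + odl o)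
    (h' : ∀ m, .del m ∈ l → sumOf l' = tmo k' + odl o') :
    par (sumOf l) (sumOf l') = sumOf (l.filterMap (Summand.lm (sumOf l') o') ++
      l'.filterMap (Summand.lm (sumOf l) o) ++ l.flatMap fun s => l'.filterMap s.cm) := by
  rw [par_eq, lm_sumOf h', lm_sumOf h, sumOf_cm_sumOf, sumOf_append, sumOf_append]

/-- A sum of summands splits into a part in the current time slice and a delayed part. -/
theorem sumOf_split {b : Prop} (l : List (Summand γ)) (hl : ∀ s ∈ l, s.Over b) :
    ∃ o : Option (Proc γ), sumOf l = tmo (sumOf l) + odl o ∧ (∀ m ∈ o, m ∈ K γ b) ∧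
      (o ≠ none → ∃ m, .del m ∈ l) := by
  induction l with
  | nil => exact ⟨none, by simp [odl, tmo_zero], by simp, by simp⟩
  | cons s l ih =>
    obtain ⟨o, h1, h2, h3⟩ := ih fun s hs => hl s (by simp [hs])
    have hs := hl s (by simp)
    cases s with
    | fin b =>
      refine ⟨o, ?_, h2, fun h => ?_⟩
      · rw [sumOf_cons, to_add, tmo_val_fin, add_assoc, ← h1]
      · obtain ⟨m, hm⟩ := h3 h; exact ⟨m, by simp [hm]⟩
    | pre b k =>
      refine ⟨o, ?_, h2, fun h => ?_⟩
      · rw [sumOf_cons, to_add, tmo_val_pre, add_assoc, ← h1]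
      · obtain ⟨m, hm⟩ := h3 h; exact ⟨m, by simp [hm]⟩
    | del k =>
      -- All delayed summands are gathered into one by `σ(x) + σ(y) = σ(x + y)`.
      refine ⟨some ((o.map (k + ·)).getD k), ?_, ?_, fun _ => ⟨k, by simp⟩⟩
      · rw [sumOf_cons, to_add]
        simp only [Summand.val, to_dl, zero_add]
        cases o with
        | none => simp only [odl, add_zero] at h1; rw [← h1, add_comm]; rfl
        | some m =>
          simp only [odl] at h1
          simp only [odl, Option.map_some, Option.getD_some, ← dl_add]
          rw [add_left_comm, ← h1]
      · cases o with
        | none => simpa using (show k ∈ K γ b from hs)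
        | some m => simpa using K.add hs (h2 m rfl)

/-- `x` has a head normal form with well-founded chains of silent steps, at the end of which `x`
terminates only if `p` holds. -/
inductive Res (b p : Prop) : Proc γ → Prop
  | mk (l : List (Summand γ)) (hl : ∀ s ∈ l, s.Over b) (hp : .fin none ∈ l → p)
      (h : ∀ k, .pre none k ∈ l → Res b p k) : Res b p (sumOf l)

/-! ### Closure of well-founded silent behaviour under the operators. -/

variable {b p q : Prop} {x y : Proc γ}

theorem Res.mono (hpq : p → q) (h : Res b p x) : Res b q x := by
  induction h with
  | mk l hl hp _ ih => exact .mk l hl (fun h => hpq (hp h)) ih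

theorem Summand.Over.mulRight {s : Summand γ} (hs : s.Over b) (hy : y ∈ K γ b) :
    (s.mulRight y).Over b := by
  cases s
  · exact hy
  · exact K.mul hs hy
  · exact K.mul hs hy

/-- A silent chain of `x` is continued by `y` only after silent termination of `x`, which requires
`p`. Silent termination of the product is then decided by `y` alone, whence the change from `p` to
`q`. -/
theorem Res.mul (hx : Res b p x) (hyK : y ∈ K γ b) (hy : p → Res b q y) : Res b q (x * y) := by
  induction hx with
  | mk l hl hp _ ih =>
    rw [sumOf_mul]
    refine .mk _ ?_ ?_ ?_
    · simp only [List.mem_map, forall_exists_index, and_imp]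
      rintro _ s hs rfl
      exact (hl s hs).mulRight hyK
    · simp only [List.mem_map, forall_exists_index, and_imp]
      rintro s hs h
      cases s <;> simp [Summand.mulRight] at h
    · simp only [List.mem_map, forall_exists_index, and_imp]
      rintro k s hs h
      cases s <;> simp [Summand.mulRight] at h
      · obtain ⟨rfl, rfl⟩ := h; exact hy (hp hs)
      · obtain ⟨rfl, rfl⟩ := h; exact ih _ hs

theorem Summand.Over.enc {s s' : Summand γ} {H : Set A} (hs : s.Over b)
    (h : s.enc H = some s') : s'.Over b := by
  cases s <;> simp only [Summand.enc] at h
  · split_ifs at h; cases h; trivial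
  · split_ifs at h; cases h; exact K.enc H hs
  · cases h; exact K.enc H hs

theorem Res.enc (H : Set A) (hx : Res b p x) : Res b p (enc H x) := by
  induction hx with
  | mk l hl hp _ ih =>
    rw [enc_sumOf]
    refine .mk _ ?_ ?_ ?_
    · simp only [List.mem_filterMap, forall_exists_index, and_imp]
      intro _ s hs h
      exact (hl s hs).enc h
    · simp only [List.mem_filterMap, forall_exists_index, and_imp]
      rintro s hs h
      cases s <;> simp [Summand.enc] at h
      obtain ⟨-, rfl⟩ := h
      exact hp hs
    · simp only [List.mem_filterMap, forall_exists_index, and_imp]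
      rintro k s hs h
      cases s <;> simp [Summand.enc] at h
      obtain ⟨-, rfl, rfl⟩ := h
      exact ih _ hs

theorem Summand.Over.lm {s s' : Summand γ} {o : Option (Proc γ)} (hs : s.Over b)
    (hy : y ∈ K γ b) (ho : ∀ m ∈ o, m ∈ K γ b) (h : s.lm y o = some s') : s'.Over b := by
  cases s
  · cases h; exact hy
  · cases h; exact K.par hs hy
  · simp only [Summand.lm, Option.map_eq_some_iff] at h
    obtain ⟨m, hm, rfl⟩ := h
    exact K.lm hs (ho m hm)

theorem Summand.Over.cm {s s' r : Summand γ} (hs : s.Over b) (hs' : s'.Over b)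
    (h : s.cm s' = some r) : r.Over b := by
  cases s <;> cases s' <;> simp only [Summand.cm, Option.map_eq_some_iff, reduceCtorEq] at h
  · obtain ⟨c, -, rfl⟩ := h; trivial
  · obtain ⟨c, -, rfl⟩ := h; exact hs'
  · obtain ⟨c, -, rfl⟩ := h; exact hs
  · obtain ⟨c, -, rfl⟩ := h; exact K.par hs hs'
  · cases h; exact K.cm hs hs'

theorem Summand.lm_eq_fin {s : Summand γ} {o : Option (Proc γ)} {c : Option A} :
    s.lm y o ≠ some (fin c) := by
  cases s <;> simp [Summand.lm]

theorem Summand.lm_eq_pre {s : Summand γ} {o : Option (Proc γ)} {c : Option A} {k : Proc γ}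
    (h : s.lm y o = some (pre c k)) : (s = fin c ∧ k = y) ∨ ∃ k', s = pre c k' ∧ k = Proc.par k' y := by
  cases s <;> simp [Summand.lm] at h
  · exact .inl ⟨by rw [h.1], h.2.symm⟩
  · exact .inr ⟨_, by rw [h.1], h.2.symm⟩

/-- Communication never yields a silent step. -/
def Visible (γ : Communication A) : Prop := ∀ a a', γ.comm (.act a) (.act a') ≠ .tau

theorem Visible.exec (hγ : Visible γ) (c c' : Option A) : γ.comm (exec c) (exec c') ≠ .tau := by
  cases c with
  | none => simp [ACPdrt.exec, γ.comm_tau]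
  | some a => cases c' with
    | none => simp [ACPdrt.exec, γ.comm_tau']
    | some a' => exact hγ a a'

theorem Summand.cm_ne_fin (hγ : Visible γ) {s s' : Summand γ} : s.cm s' ≠ some (fin none) := by
  cases s <;> cases s' <;>
    simp [Summand.cm, Option.map_eq_some_iff, Atom.exec?_eq_some]
  exact hγ.exec _ _

theorem Summand.cm_ne_pre (hγ : Visible γ) {s s' : Summand γ} {k : Proc γ} :
    s.cm s' ≠ some (pre none k) := by
  cases s <;> cases s' <;>
    simp [Summand.cm, Option.map_eq_some_iff, Atom.exec?_eq_some] <;>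
  exact fun h => (hγ.exec _ _ h).elim

theorem sumOf_mem_K {l : List (Summand γ)} (hl : ∀ s ∈ l, s.Over b) : sumOf l ∈ K γ b := by
  induction l with
  | nil => exact K.zero
  | cons s l ih =>
    rw [sumOf_cons]
    refine K.add ?_ (ih fun s hs => hl s (by simp [hs]))
    have := hl s (by simp)
    cases s
    · exact K.at' _
    · exact K.mul (K.at' _) this
    · exact K.dl this

/-- Nested induction on the silent chains of `x` and `y`: a silent step of one side leaves the other
unchanged, and visible communication adds no silent steps. The two orders are proved together
because the left merge puts the component that moved first. The composition terminates silently only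
after both components have, whence `p ∧ q`. -/
theorem Res.par (hγ : Visible γ) (hx : Res b p x) (hy : Res b q y) :
    Res b (p ∧ q) (par x y) ∧ Res b (p ∧ q) (par y x) := by
  induction hx generalizing y with
  | mk l hl hp hl' ih =>
    induction hy with
    | mk r hr hq hr' ihr =>
      obtain ⟨o, h1, h2, -⟩ := sumOf_split l hl
      obtain ⟨o', h1', h2', -⟩ := sumOf_split r hr
      have hxr := Res.mk l hl hp hl'
      have hyr := Res.mk r hr hq hr'
      -- Stated for arbitrary head normal forms because it serves both orders of the arguments.
      have key : ∀ (l r : List (Summand γ)) (o o' : Option (Proc γ)),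
          (∀ s ∈ l, s.Over b) → (∀ s ∈ r, s.Over b) → (∀ m ∈ o, m ∈ K γ b) →
          (∀ m ∈ o', m ∈ K γ b) →
          (.fin none ∈ l → Res b (p ∧ q) (sumOf r)) → (.fin none ∈ r → Res b (p ∧ q) (sumOf l)) →
          (∀ k, .pre none k ∈ l → Res b (p ∧ q) (Proc.par k (sumOf r))) →
          (∀ k, .pre none k ∈ r → Res b (p ∧ q) (Proc.par k (sumOf l))) →
          Res b (p ∧ q) (sumOf (l.filterMap (Summand.lm (sumOf r) o') ++
            r.filterMap (Summand.lm (sumOf l) o) ++ l.flatMap fun s => r.filterMap s.cm)) := by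
        intro l r o o' hl hr ho ho' h1 h2 h3 h4
        refine .mk _ ?_ ?_ ?_
        · intro s hs
          simp only [List.mem_append, List.mem_filterMap, List.mem_flatMap] at hs
          obtain (⟨t, ht, h⟩ | ⟨t, ht, h⟩) | ⟨t, ht, t', ht', h⟩ := hs
          · exact (hl t ht).lm (sumOf_mem_K hr) ho' h
          · exact (hr t ht).lm (sumOf_mem_K hl) ho h
          · exact (hl t ht).cm (hr t' ht') h
        · intro hs
          simp only [List.mem_append, List.mem_filterMap, List.mem_flatMap] at hs
          obtain (⟨t, ht, h⟩ | ⟨t, ht, h⟩) | ⟨t, ht, t', ht', h⟩ := hs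
          · exact (Summand.lm_eq_fin h).elim
          · exact (Summand.lm_eq_fin h).elim
          · exact (Summand.cm_ne_fin hγ h).elim
        · intro k hs
          simp only [List.mem_append, List.mem_filterMap, List.mem_flatMap] at hs
          obtain (⟨t, ht, h⟩ | ⟨t, ht, h⟩) | ⟨t, ht, t', ht', h⟩ := hs
          · obtain ⟨rfl, rfl⟩ | ⟨k', rfl, rfl⟩ := Summand.lm_eq_pre h
            · exact h1 ht
            · exact h3 k' ht
          · obtain ⟨rfl, rfl⟩ | ⟨k', rfl, rfl⟩ := Summand.lm_eq_pre h
            · exact h2 ht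
            · exact h4 k' ht
          · exact (Summand.cm_ne_pre hγ h).elim
      have hfl : .fin none ∈ l → Res b (p ∧ q) (sumOf r) := fun h => hyr.mono fun hq => ⟨hp h, hq⟩
      have hfr : .fin none ∈ r → Res b (p ∧ q) (sumOf l) := fun h => hxr.mono fun hp => ⟨hp, hq h⟩
      constructor
      · rw [par_sumOf (fun _ _ => h1) (fun _ _ => h1')]
        exact key l r o o' hl hr h2 h2' hfl hfr (fun k hk => (ih k hk hyr).1)
          fun k hk => (ihr k hk).2
      · rw [par_sumOf (fun _ _ => h1') (fun _ _ => h1)]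
        exact key r l o' o hr hl h2' h2 hfr hfl (fun k hk => (ihr k hk).2)
          fun k hk => (ih k hk hyr).1

end Proc

/-! ### A trace model that records the exposure of unknown behaviour -/

/-- Status of a trace: it may be unfinished, end in termination, or end in unknown behaviour. -/
inductive St
  | part
  | term
  | unk

/-- Observations in the current time slice: unknown behaviour (`raw`), unknown behaviour below a
time-out (`now`), a delay, an initial action, and a trace, of which only the first action may be
silent. -/
inductive Obs (A : Type*)
  | raw
  | now
  | del
  | hd (b : Option A)
  | tr (b : Option A) (u : List A) (s : St)

open Obs St

/-- Unknown behaviour after a silent step. -/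
abbrev Obs.late : Obs A := tr none [] unk

/-- Termination after a silent step. -/
abbrev Obs.silent : Obs A := tr none [] term

/-- Merging traces; communications are visible. -/
inductive Mrg (γ : Communication A) : List A → List A → List A → Prop
  | nil : Mrg γ [] [] []
  | left (a) {u v w} (h : Mrg γ u v w) : Mrg γ (a :: u) v (a :: w)
  | right (b) {u v w} (h : Mrg γ u v w) : Mrg γ u (b :: v) (b :: w)
  | comm {a b c} (hc : γ.comm (.act a) (.act b) = .act c) {u v w} (h : Mrg γ u v w) :
      Mrg γ (a :: u) (b :: v) (c :: w)

namespace Mrg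

variable {γ : Communication A} {u v w : List A}

theorem symm (h : Mrg γ u v w) : Mrg γ v u w := by
  induction h with
  | nil => exact .nil
  | left a _ ih => exact .right a ih
  | right a _ ih => exact .left a ih
  | comm hc _ ih => exact .comm (by rw [γ.comm_symm, hc]) ih

theorem nil_left : Mrg γ [] v w ↔ w = v := by
  constructor
  · intro h
    induction v generalizing w with
    | nil => cases h; rfl
    | cons b v ih => cases h with | right _ h => rw [ih h]
  · rintro rfl
    induction w with
    | nil => exact .nil
    | cons b v ih => exact .right b ih

theorem nil_right : Mrg γ u [] w ↔ w = u :=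
  ⟨fun h => nil_left.1 h.symm, fun h => (nil_left.2 h).symm⟩

theorem length_left (h : Mrg γ u v w) : u.length ≤ w.length := by
  induction h <;> simp <;> omega

theorem length_right (h : Mrg γ u v w) : v.length ≤ w.length := h.symm.length_left

end Mrg

/-- The status of the merge of two traces. -/
inductive Join : St → St → St → Prop
  | part : Join part part part
  | term : Join term term term
  | left (s) : Join unk s unk
  | right (s) : Join s unk unk

theorem Join.symm {s t r : St} (h : Join s t r) : Join t s r := by
  cases h <;> constructor

namespace Model

/-- The traces of a process that is not at the root: silent steps are invisible. -/
def NT (x : Set (Obs A)) (u : List A) (s : St) : Prop :=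
  (u = [] ∧ s = part) ∨ (u = [] ∧ s = unk ∧ (raw ∈ x ∨ now ∈ x)) ∨ tr none u s ∈ x ∨
    ∃ a v, u = a :: v ∧ tr (some a) v s ∈ x

/-- No `exec b` is deadlock, so deadlock has no observations. -/
def atom (a : Atom A) : Set (Obs A) := {o | match o with
  | hd b => a = exec b
  | tr b u s => a = exec b ∧ u = [] ∧ s ≠ unk
  | _ => False}

/-- A trace of `x` that terminates has to be continued by `y`, whose silent steps are no longer at
the root and hence are read through `NT`; other traces of `x` are kept. -/
def seq (x y : Set (Obs A)) : Set (Obs A) := {o | match o with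
  | tr b u s => (tr b u s ∈ x ∧ s ≠ term) ∨ ∃ v w, u = v ++ w ∧ tr b v term ∈ x ∧ NT y w s
  | o => o ∈ x}

/-- What follows a delay is not observed at all. This makes a delay a perfect guard and trivializes
the axioms that act below it. -/
def delay : Set (Obs A) := {del}

/-- A time-out weakens `raw` to `now`: even if nothing is known about `x`, the process `ν(x)` is
split, with no delayed part. -/
def timeout (x : Set (Obs A)) : Set (Obs A) := {o | match o with
  | raw => False
  | now => raw ∈ x ∨ now ∈ x
  | del => False
  | o => o ∈ x}

/-- The left merge of `x` and `y` depends on unknown behaviour. -/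
def LCond (x y : Set (Obs A)) : Prop := raw ∈ x ∨ now ∈ x ∨ (del ∈ x ∧ raw ∈ y)

/-- The communication merge of `x` and `y` depends on unknown behaviour. -/
def CCond (x y : Set (Obs A)) : Prop := raw ∈ x ∨ raw ∈ y ∨ (now ∈ x ∧ now ∈ y) ∨
  (now ∈ x ∧ ∃ b, hd b ∈ y) ∨ ((∃ b, hd b ∈ x) ∧ now ∈ y)

/-- Computing a left merge takes a head normal form of `x` and, if `x` has a delayed summand, a
splitting of `y`. A mere `now` in `y` must not count, because `σ(x) ⌊⌊ ν(y) = δ` has to hold. When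
the condition holds, `raw`, `now` and `late` are all recorded. -/
def lmerge (γ : Communication A) (x y : Set (Obs A)) : Set (Obs A) := {o | match o with
  | raw => LCond x y
  | now => LCond x y
  | del => del ∈ x ∧ del ∈ y
  | hd b => hd b ∈ x
  | tr b w s => (LCond x y ∧ b = none ∧ w = [] ∧ s = unk) ∨
      ∃ u s₁ v s₂, tr b u s₁ ∈ x ∧ NT y v s₂ ∧ Mrg γ u v w ∧ Join s₁ s₂ s}

/-- By `ν(x) ∣ σ(y) = δ`, a `now` on one side must leave no mark when the other side has only
delays; it counts only against an initial action or another `now`. Only visible communications are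
represented. -/
def cmerge (γ : Communication A) (x y : Set (Obs A)) : Set (Obs A) := {o | match o with
  | raw => CCond x y
  | now => CCond x y
  | del => del ∈ x ∧ del ∈ y
  | hd b => ∃ a a' c, b = some c ∧ hd (some a) ∈ x ∧ hd (some a') ∈ y ∧
      γ.comm (.act a) (.act a') = .act c
  | tr b w s => (CCond x y ∧ b = none ∧ w = [] ∧ s = unk) ∨
      ∃ a a' c, b = some c ∧ γ.comm (.act a) (.act a') = .act c ∧
        ∃ u s₁ v s₂, tr (some a) u s₁ ∈ x ∧ tr (some a') v s₂ ∈ y ∧ Mrg γ u v w ∧ Join s₁ s₂ s}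

def par (γ : Communication A) (x y : Set (Obs A)) : Set (Obs A) :=
  lmerge γ x y ∪ lmerge γ y x ∪ cmerge γ x y

/-- A `now` is strengthened to `raw`: no axiom relates encapsulation to time-out, so a splitting of
the result is obtained only from a head normal form of `x`. -/
def encap (H : Set A) (x : Set (Obs A)) : Set (Obs A) := {o | match o with
  | raw => raw ∈ x ∨ now ∈ x
  | now => raw ∈ x ∨ now ∈ x
  | del => del ∈ x
  | hd b => exec b ∉ Atom.act '' H ∧ hd b ∈ x
  | tr b u s => exec b ∉ Atom.act '' H ∧ (∀ a ∈ u, a ∉ H) ∧ tr b u s ∈ x}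

open Classical in
noncomputable def hide (I : Set A) (b : Option A) : Option A :=
  if exec b ∈ Atom.act '' I then none else b

open Classical in
def abstr (I : Set A) (x : Set (Obs A)) : Set (Obs A) := {o | match o with
  | raw => raw ∈ x ∨ now ∈ x
  | now => raw ∈ x ∨ now ∈ x
  | del => del ∈ x
  | hd b => ∃ b', hide I b' = b ∧ hd b' ∈ x
  | tr b u s => ∃ b' u', hide I b' = b ∧ u'.filter (· ∉ I) = u ∧ tr b' u' s ∈ x}

/-! ### Traces of composite processes below the root. -/

variable {γ : Communication A} {x y z x' y' : Set (Obs A)}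

theorem NT_nil_part (x : Set (Obs A)) : NT x [] part := .inl ⟨rfl, rfl⟩

theorem NT_union {u : List A} {s : St} : NT (x ∪ y) u s ↔ NT x u s ∨ NT y u s := by
  simp only [NT, Set.mem_union]
  grind

theorem NT_seq {u : List A} {s : St} : NT (seq x y) u s ↔
    (NT x u s ∧ s ≠ term) ∨ ∃ v w, u = v ++ w ∧ NT x v term ∧ NT y w s := by
  constructor
  · rintro (⟨rfl, rfl⟩ | ⟨rfl, rfl, h⟩ | (h | ⟨v, w, rfl, h, h'⟩) | ⟨a, v, rfl, h | ⟨v, w, rfl, h, h'⟩⟩)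
    · exact .inl ⟨NT_nil_part x, by simp⟩
    · exact .inl ⟨.inr (.inl ⟨rfl, rfl, h⟩), by simp⟩
    · exact .inl ⟨.inr (.inr (.inl h.1)), h.2⟩
    · exact .inr ⟨v, w, rfl, .inr (.inr (.inl h)), h'⟩
    · exact .inl ⟨.inr (.inr (.inr ⟨a, v, rfl, h.1⟩)), h.2⟩
    · exact .inr ⟨a :: v, w, rfl, .inr (.inr (.inr ⟨a, v, rfl, h⟩)), h'⟩
  · rintro (⟨⟨rfl, rfl⟩ | ⟨rfl, rfl, h⟩ | h | ⟨a, v, rfl, h⟩, hs⟩ |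
      ⟨v, w, rfl, ⟨-, h⟩ | ⟨-, h, -⟩ | h | ⟨a, v, rfl, h⟩, h'⟩)
    · exact NT_nil_part _
    · exact .inr (.inl ⟨rfl, rfl, h⟩)
    · exact .inr (.inr (.inl (.inl ⟨h, hs⟩)))
    · exact .inr (.inr (.inr ⟨a, v, rfl, .inl ⟨h, hs⟩⟩))
    · cases h
    · cases h
    · exact .inr (.inr (.inl (.inr ⟨v, w, rfl, h, h'⟩)))
    · exact .inr (.inr (.inr ⟨a, v ++ w, rfl, .inr ⟨v, w, rfl, h, h'⟩⟩))

theorem NT_tau {u : List A} {s : St} : NT (atom .tau : Set (Obs A)) u s ↔ u = [] ∧ s ≠ unk := by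
  simp only [NT, atom, exec, Set.mem_ofPred_eq, true_and, reduceCtorEq, false_and, and_false,
    exists_false, or_false, false_or]
  grind

theorem NT_tau_seq {u : List A} {s : St} : NT (seq (atom .tau) x) u s ↔ NT x u s := by
  rw [NT_seq]
  simp only [NT_tau]
  constructor
  · rintro (⟨⟨rfl, h⟩, h'⟩ | ⟨v, w, rfl, ⟨rfl, -⟩, h⟩)
    · cases s
      · exact NT_nil_part x
      · exact (h' rfl).elim
      · exact (h rfl).elim
    · exact h
  · intro h; exact .inr ⟨[], u, rfl, ⟨rfl, by simp⟩, h⟩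

theorem tr_mem_atom_seq {a : Atom A} {b : Option A} {u : List A} {s : St} :
    tr b u s ∈ seq (atom a) x ↔ a = exec b ∧ NT x u s := by
  simp only [seq, atom, Set.mem_ofPred_eq]
  constructor
  · rintro (⟨⟨rfl, rfl, h⟩, h'⟩ | ⟨v, w, rfl, ⟨rfl, rfl, -⟩, h⟩)
    · cases s
      · exact ⟨rfl, NT_nil_part x⟩
      · exact (h' rfl).elim
      · exact (h rfl).elim
    · exact ⟨rfl, h⟩
  · rintro ⟨rfl, h⟩
    exact .inr ⟨[], u, rfl, ⟨rfl, rfl, by simp⟩, h⟩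

theorem atom_seq (a : Atom A) : seq (atom a) x = {o | match o with
    | hd b => a = exec b
    | tr b u s => a = exec b ∧ NT x u s
    | _ => False} := by
  ext o
  rcases o with _ | _ | _ | b | ⟨b, u, s⟩
  case tr => exact tr_mem_atom_seq
  all_goals exact Iff.rfl

theorem tr_mem_seq {b : Option A} {u : List A} {s : St} : tr b u s ∈ seq x y ↔
    (tr b u s ∈ x ∧ s ≠ term) ∨ ∃ v w, u = v ++ w ∧ tr b v term ∈ x ∧ NT y w s := Iff.rfl

theorem tr_mem_encap {H : Set A} {b : Option A} {u : List A} {s : St} : tr b u s ∈ encap H x ↔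
    exec b ∉ Atom.act '' H ∧ (∀ a ∈ u, a ∉ H) ∧ tr b u s ∈ x := Iff.rfl

open Classical in
theorem tr_mem_abstr {I : Set A} {b : Option A} {u : List A} {s : St} : tr b u s ∈ abstr I x ↔
    ∃ b' u', hide I b' = b ∧ u'.filter (· ∉ I) = u ∧ tr b' u' s ∈ x := Iff.rfl

/-- Behind an atom only the traces in `NT` matter. This is what validates the laws that remove
silent steps. -/
theorem atom_seq_congr (a : Atom A) (h : ∀ u s, NT x u s ↔ NT y u s) :
    seq (atom a) x = seq (atom a) y := by
  simp only [atom_seq, h]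

theorem atom_seq_tau (a : Atom A) : seq (atom a) (atom .tau) = atom a := by
  ext o
  rcases o with _ | _ | _ | b | ⟨b, u, s⟩
  case tr => rw [tr_mem_atom_seq, NT_tau]; exact Iff.rfl
  all_goals exact Iff.rfl

/-- Merging sets of traces. -/
def Merge (γ : Communication A) (P Q : List A → St → Prop) (w : List A) (s : St) : Prop :=
  ∃ u s₁ v s₂, P u s₁ ∧ Q v s₂ ∧ Mrg γ u v w ∧ Join s₁ s₂ s

/-- Merging below the root is compatible with the invisibility of silent steps, which makes `a·x ⌊⌊
y = a·(x ∥ y)` valid although its left side looks at the first step of `a·x` only. For the converse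
direction, a silent first step on either side is performed by the corresponding left merge;
otherwise the first visible action of the merged trace decides which of the three parts of the
parallel composition supplies it. -/
theorem NT_par {w : List A} {s : St} : NT (par γ x y) w s ↔ Merge γ (NT x) (NT y) w s := by
  -- A `now` that is ignored by the communication merge is still recorded by one of the two left
  -- merges.
  have hraw : (raw ∈ par γ x y ∨ now ∈ par γ x y) ↔ raw ∈ x ∨ now ∈ x ∨ raw ∈ y ∨ now ∈ y := by
    simp only [par, Set.mem_union, lmerge, cmerge, Set.mem_ofPred_eq, LCond, CCond]
    tauto
  have hunk : (raw ∈ x ∨ now ∈ x ∨ raw ∈ y ∨ now ∈ y) → Merge γ (NT x) (NT y) [] unk := by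
    rintro (h | h | h | h)
    · exact ⟨[], unk, [], part, .inr (.inl ⟨rfl, rfl, .inl h⟩), NT_nil_part y, .nil, .left _⟩
    · exact ⟨[], unk, [], part, .inr (.inl ⟨rfl, rfl, .inr h⟩), NT_nil_part y, .nil, .left _⟩
    · exact ⟨[], part, [], unk, NT_nil_part x, .inr (.inl ⟨rfl, rfl, .inl h⟩), .nil, .right _⟩
    · exact ⟨[], part, [], unk, NT_nil_part x, .inr (.inl ⟨rfl, rfl, .inr h⟩), .nil, .right _⟩
  constructor
  · rintro (⟨rfl, rfl⟩ | ⟨rfl, rfl, h⟩ | h | ⟨a, v, rfl, h⟩)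
    · exact ⟨[], part, [], part, NT_nil_part x, NT_nil_part y, .nil, .part⟩
    · exact hunk (hraw.1 h)
    · obtain ((⟨h, -, rfl, rfl⟩ | ⟨u, s₁, v, s₂, h1, h2, h3, h4⟩) |
        (⟨h, -, rfl, rfl⟩ | ⟨u, s₁, v, s₂, h1, h2, h3, h4⟩)) |
        (⟨h, -, rfl, rfl⟩ | ⟨a, a', c, h, -⟩) := h
      · exact hunk (by simp only [LCond] at h; tauto)
      · exact ⟨u, s₁, v, s₂, .inr (.inr (.inl h1)), h2, h3, h4⟩
      · exact hunk (by simp only [LCond] at h; tauto)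
      · exact ⟨v, s₂, u, s₁, h2, .inr (.inr (.inl h1)), h3.symm, h4.symm⟩
      · exact hunk (by simp only [CCond] at h; tauto)
      · cases h
    · obtain ((⟨-, h, -⟩ | ⟨u, s₁, v', s₂, h1, h2, h3, h4⟩) |
        (⟨-, h, -⟩ | ⟨u, s₁, v', s₂, h1, h2, h3, h4⟩)) |
        (⟨-, h, -⟩ | ⟨b, b', c, h, hc, u, s₁, v', s₂, h1, h2, h3, h4⟩) := h
      · cases h
      · exact ⟨a :: u, s₁, v', s₂, .inr (.inr (.inr ⟨a, u, rfl, h1⟩)), h2, .left a h3, h4⟩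
      · cases h
      · exact ⟨v', s₂, a :: u, s₁, h2, .inr (.inr (.inr ⟨a, u, rfl, h1⟩)), .right a h3.symm, h4.symm⟩
      · cases h
      · cases h
        exact ⟨b :: u, s₁, b' :: v', s₂, .inr (.inr (.inr ⟨b, u, rfl, h1⟩)),
          .inr (.inr (.inr ⟨b', v', rfl, h2⟩)), .comm hc h3, h4⟩
  · rintro ⟨u, s₁, v, s₂, hx, hy, hm, hj⟩
    by_cases hx0 : tr none u s₁ ∈ x
    · exact .inr (.inr (.inl (.inl (.inl (.inr ⟨u, s₁, v, s₂, hx0, hy, hm, hj⟩)))))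
    by_cases hy0 : tr none v s₂ ∈ y
    · exact .inr (.inr (.inl (.inl (.inr (.inr ⟨v, s₂, u, s₁, hy0, hx, hm.symm, hj.symm⟩)))))
    by_cases hu : u = []
    · by_cases hv : v = []
      · subst hu hv
        have hw := Mrg.nil_left.1 hm
        subst hw
        by_cases h : raw ∈ x ∨ now ∈ x ∨ raw ∈ y ∨ now ∈ y
        · cases hj
          · exact NT_nil_part _
          · simp [NT, hx0] at hx
          all_goals exact .inr (.inl ⟨rfl, rfl, hraw.2 h⟩)
        · simp only [not_or] at h
          have h1 : s₁ = part := by simpa [NT, hx0, h] using hx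
          have h2 : s₂ = part := by simpa [NT, hy0, h] using hy
          subst h1 h2
          cases hj
          exact NT_nil_part _
      · subst hu
        have hw := Mrg.nil_left.1 hm
        subst hw
        obtain ⟨b, v', rfl, hb⟩ : ∃ a v', w = a :: v' ∧ tr (some a) v' s₂ ∈ y := by
          simpa [NT, hy0, hv] using hy
        exact .inr (.inr (.inr ⟨b, v', rfl, .inl (.inr (.inr
          ⟨v', s₂, [], s₁, hb, hx, Mrg.nil_right.2 rfl, hj.symm⟩))⟩))
    · obtain ⟨a, u', rfl, ha⟩ : ∃ a v', u = a :: v' ∧ tr (some a) v' s₁ ∈ x := by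
        simpa [NT, hx0, hu] using hx
      by_cases hv : v = []
      · subst hv
        have hw := Mrg.nil_right.1 hm
        subst hw
        exact .inr (.inr (.inr ⟨a, u', rfl, .inl (.inl (.inr
          ⟨u', s₁, [], s₂, ha, hy, Mrg.nil_right.2 rfl, hj⟩))⟩))
      · obtain ⟨b, v', rfl, hb⟩ : ∃ a v', v = a :: v' ∧ tr (some a) v' s₂ ∈ y := by
          simpa [NT, hy0, hv] using hy
        cases hm with
        | left _ hm =>
          exact .inr (.inr (.inr ⟨a, _, rfl, .inl (.inl (.inr ⟨u', s₁, _, s₂, ha, hy, hm, hj⟩))⟩))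
        | right _ hm =>
          exact .inr (.inr (.inr ⟨b, _, rfl, .inl (.inr (.inr
            ⟨v', s₂, _, s₁, hb, hx, hm.symm, hj.symm⟩))⟩))
        | comm hc hm =>
          exact .inr (.inr (.inr ⟨_, _, rfl, .inr (.inr
            ⟨a, b, _, rfl, hc, u', s₁, v', s₂, ha, hb, hm, hj⟩)⟩))

theorem par_comm_mem (x y : Set (Obs A)) {w : List A} {s : St} :
    NT (par γ x y) w s ↔ NT (par γ y x) w s := by
  rw [NT_par, NT_par]
  constructor <;> exact fun ⟨u, s₁, v, s₂, h1, h2, h3, h4⟩ =>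
    ⟨v, s₂, u, s₁, h2, h1, h3.symm, h4.symm⟩

theorem NT_tau_par {w : List A} {s : St} : NT (par γ (atom .tau) y) w s ↔ NT y w s := by
  rw [NT_par]
  constructor
  · rintro ⟨u, s₁, v, s₂, h1, h2, h3, h4⟩
    obtain ⟨rfl, h1'⟩ := NT_tau.1 h1
    obtain rfl := Mrg.nil_left.1 h3
    cases h4
    · exact h2
    · exact h2
    · exact (h1' rfl).elim
    · exact h2
  · intro h
    cases s
    · exact ⟨[], part, w, part, NT_nil_part _, h, Mrg.nil_left.2 rfl, .part⟩
    · exact ⟨[], term, w, term, NT_tau.2 ⟨rfl, by simp⟩, h, Mrg.nil_left.2 rfl, .term⟩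
    · exact ⟨[], part, w, unk, NT_nil_part _, h, Mrg.nil_left.2 rfl, .right _⟩

theorem lmerge_atom_seq (a : Atom A) :
    lmerge γ (seq (atom a) x) y = seq (atom a) (par γ x y) := by
  ext o
  rcases o with _ | _ | _ | b | ⟨b, w, s⟩
  case tr =>
    rw [tr_mem_atom_seq, NT_par]
    simp only [lmerge, Set.mem_ofPred_eq, tr_mem_atom_seq]
    constructor
    · rintro (⟨h, -⟩ | ⟨u, s₁, v, s₂, ⟨h, h1⟩, h2, h3, h4⟩)
      · simp [LCond, atom_seq] at h
      · exact ⟨h, u, s₁, v, s₂, h1, h2, h3, h4⟩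
    · rintro ⟨h, u, s₁, v, s₂, h1, h2, h3, h4⟩
      exact .inr ⟨u, s₁, v, s₂, ⟨h, h1⟩, h2, h3, h4⟩
  all_goals simp [lmerge, LCond, atom_seq]

theorem lmerge_atom (a : Atom A) : lmerge γ (atom a) x = seq (atom a) x := by
  rw [← atom_seq_tau a, lmerge_atom_seq, atom_seq_tau]
  exact atom_seq_congr a fun u s => NT_tau_par

theorem comm_eq_act {a b : Atom A} {c : A} (h : γ.comm a b = .act c) :
    (∃ a', a = .act a') ∧ ∃ b', b = .act b' := by
  cases a <;> cases b <;> simp_all [γ.comm_tau, γ.comm_tau', γ.comm_dead, γ.comm_dead']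

/-- Visibility is essential: the model gives communications visible results only, so a silent
`γ(a,b)` would yield traces on the right that are missing on the left. -/
theorem cmerge_atom_seq (hγ : Proc.Visible γ) (a b : Atom A) :
    cmerge γ (seq (atom a) x) (seq (atom b) y) = seq (atom (γ.comm a b)) (par γ x y) := by
  have hτ : γ.comm a b ≠ .tau := by
    intro h
    cases a with
    | tau => simp [γ.comm_tau] at h
    | dead => simp [γ.comm_dead] at h
    | act a => cases b with
      | tau => simp [γ.comm_tau'] at h
      | dead => simp [γ.comm_dead'] at h
      | act b => exact hγ a b h
  have hC : ¬CCond (seq (atom a) x) (seq (atom b) y) := by simp [CCond, atom_seq]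
  ext o
  rcases o with _ | _ | _ | b | ⟨b, w, s⟩
  case tr =>
    rw [tr_mem_atom_seq, NT_par]
    simp only [cmerge, Set.mem_ofPred_eq, tr_mem_atom_seq, hC, false_and, false_or]
    constructor
    · rintro ⟨a, a', c, rfl, hc, u, s₁, v, s₂, ⟨rfl, h1⟩, ⟨rfl, h2⟩, h3, h4⟩
      exact ⟨hc, u, s₁, v, s₂, h1, h2, h3, h4⟩
    · rintro ⟨h, u, s₁, v, s₂, h1, h2, h3, h4⟩
      cases b with
      | none => exact (hτ h).elim
      | some c =>
        obtain ⟨⟨a', rfl⟩, ⟨b', rfl⟩⟩ := comm_eq_act h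
        exact ⟨a', b', c, rfl, h, u, s₁, v, s₂, ⟨rfl, h1⟩, ⟨rfl, h2⟩, h3, h4⟩
  case hd =>
    simp only [atom_seq, cmerge, Set.mem_ofPred_eq]
    constructor
    · rintro ⟨a, a', c, rfl, rfl, rfl, hc⟩
      exact hc
    · intro h
      cases b with
      | none => exact (hτ h).elim
      | some c =>
        obtain ⟨⟨a', rfl⟩, ⟨b', rfl⟩⟩ := comm_eq_act h
        exact ⟨a', b', c, rfl, rfl, rfl, h⟩
  case raw => exact iff_of_false hC (by simp [atom_seq])
  case now => exact iff_of_false hC (by simp [atom_seq])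
  case del => simp [cmerge, atom_seq]

theorem cmerge_atom (hγ : Proc.Visible γ) (a b : Atom A) :
    cmerge γ (atom a) (atom b) = atom (γ.comm a b) := by
  conv_lhs => rw [← atom_seq_tau a, ← atom_seq_tau b]
  rw [cmerge_atom_seq hγ]
  exact (atom_seq_congr _ fun u s => NT_tau_par).trans (atom_seq_tau _)

theorem NT_encap {H : Set A} {u : List A} {s : St} :
    NT (encap H x) u s ↔ (∀ a ∈ u, a ∉ H) ∧ NT x u s := by
  simp only [NT, encap, exec, Set.mem_ofPred_eq, Set.mem_image]
  constructor
  · rintro (⟨rfl, rfl⟩ | ⟨rfl, rfl, h⟩ | h | ⟨a, v, rfl, h⟩)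
    · simp
    · exact ⟨by simp, .inr (.inl ⟨rfl, rfl, by simpa using h⟩)⟩
    · exact ⟨h.2.1, .inr (.inr (.inl h.2.2))⟩
    · refine ⟨?_, .inr (.inr (.inr ⟨a, v, rfl, h.2.2⟩))⟩
      simpa using ⟨fun h' => h.1 ⟨a, h', rfl⟩, h.2.1⟩
  · rintro ⟨h, ⟨rfl, rfl⟩ | ⟨rfl, rfl, h'⟩ | h' | ⟨a, v, rfl, h'⟩⟩
    · simp
    · exact .inr (.inl ⟨rfl, rfl, by simpa using h'⟩)
    · exact .inr (.inr (.inl ⟨by simp, h, h'⟩))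
    · refine .inr (.inr (.inr ⟨a, v, rfl, ?_, fun a h' => h a (by simp [h']), h'⟩))
      simpa using h a (by simp)

open Classical in
theorem NT_abstr {I : Set A} {u : List A} {s : St} :
    NT (abstr I x) u s ↔ ∃ u', u'.filter (· ∉ I) = u ∧ NT x u' s := by
  constructor
  · rintro (⟨rfl, rfl⟩ | ⟨rfl, rfl, h⟩ | ⟨b, u', hb, rfl, h⟩ | ⟨a, v, rfl, b, u', hb, rfl, h⟩)
    · exact ⟨[], rfl, NT_nil_part x⟩
    · exact ⟨[], rfl, .inr (.inl ⟨rfl, rfl, by simpa [abstr] using h⟩)⟩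
    · cases b with
      | none => exact ⟨u', rfl, .inr (.inr (.inl h))⟩
      | some a =>
        refine ⟨a :: u', ?_, .inr (.inr (.inr ⟨a, u', rfl, h⟩))⟩
        have : a ∈ I := by simpa [hide, exec] using hb
        simp [this]
    · cases b with
      | none => simp [hide] at hb
      | some a' =>
        have h1 : a' ∉ I ∧ a' = a := by
          by_cases h' : a' ∈ I <;> simp [hide, exec, h'] at hb
          exact ⟨h', hb⟩
        obtain ⟨h1, rfl⟩ := h1
        exact ⟨a' :: u', by simp [h1], .inr (.inr (.inr ⟨a', u', rfl, h⟩))⟩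
  · rintro ⟨u', rfl, ⟨rfl, rfl⟩ | ⟨rfl, rfl, h'⟩ | h' | ⟨a, v, rfl, h'⟩⟩
    · exact NT_nil_part _
    · exact .inr (.inl ⟨rfl, rfl, .inl h'⟩)
    · exact .inr (.inr (.inl ⟨none, u', by simp [hide], rfl, h'⟩))
    · by_cases ha : a ∈ I
      · refine .inr (.inr (.inl ⟨some a, v, by simp [hide, exec, ha], by simp [ha], h'⟩))
      · exact .inr (.inr (.inr ⟨a, _, List.filter_cons_of_pos (by simpa using ha), some a, v, by simp [hide, exec, ha],
          rfl, h'⟩))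

/-! ### Validity of the axioms in the model. -/

theorem union_seq : seq (x ∪ y) z = seq x z ∪ seq y z := by
  ext o
  rcases o with _ | _ | _ | b | ⟨b, w, s⟩
  case tr => simp only [seq, Set.mem_ofPred_eq, Set.mem_union]; grind
  all_goals simp [seq]

theorem seq_assoc : seq (seq x y) z = seq x (seq y z) := by
  ext o
  rcases o with _ | _ | _ | b | ⟨b, w, s⟩
  case tr =>
    simp only [seq, Set.mem_ofPred_eq]
    constructor
    · rintro (⟨h | ⟨v, w, rfl, h, h'⟩, hs⟩ | ⟨v, w, rfl, ⟨-, h⟩ | ⟨v', w', rfl, h, h'⟩, h''⟩)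
      · exact .inl h
      · exact .inr ⟨v, w, rfl, h, NT_seq.2 (.inl ⟨h', hs⟩)⟩
      · exact (h rfl).elim
      · exact .inr ⟨v', w' ++ w, by simp, h, NT_seq.2 (.inr ⟨w', w, rfl, h', h''⟩)⟩
    · rintro (h | ⟨v, w, rfl, h, h'⟩)
      · exact .inl ⟨.inl h, h.2⟩
      · obtain h' | ⟨v', w', rfl, h', h''⟩ := NT_seq.1 h'
        · exact .inl ⟨.inr ⟨v, w, rfl, h, h'.1⟩, h'.2⟩
        · exact .inr ⟨v ++ v', w', by simp, .inr ⟨v, v', rfl, h, h'⟩, h''⟩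
  all_goals simp [seq]

theorem dead_eq : (atom .dead : Set (Obs A)) = ∅ := by
  ext o
  rcases o with _ | _ | _ | (_ | b) | ⟨_ | b, w, s⟩ <;> simp [atom, exec]

theorem empty_seq : seq ∅ x = ∅ := by
  ext o
  rcases o with _ | _ | _ | b | ⟨b, w, s⟩ <;> simp [seq]

theorem delay_seq : seq delay x = delay := by
  ext o
  rcases o with _ | _ | _ | b | ⟨b, w, s⟩ <;> simp [seq, delay]

theorem timeout_atom (a : Atom A) : timeout (atom a) = atom a := by
  ext o
  rcases o with _ | _ | _ | b | ⟨b, w, s⟩ <;> simp [timeout, atom]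

theorem timeout_union : timeout (x ∪ y) = timeout x ∪ timeout y := by
  ext o
  rcases o with _ | _ | _ | b | ⟨b, w, s⟩ <;> simp [timeout]
  tauto

theorem timeout_seq : timeout (seq x y) = seq (timeout x) y := by
  ext o
  rcases o with _ | _ | _ | b | ⟨b, w, s⟩ <;> simp [timeout, seq]

theorem timeout_delay : timeout delay = (∅ : Set (Obs A)) := by
  ext o
  rcases o with _ | _ | _ | b | ⟨b, w, s⟩ <;> simp [timeout, delay]

theorem drb2 (a : Atom A) : seq (atom a) (seq (atom .tau) (timeout x ∪ y) ∪ timeout x) =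
    seq (atom a) (timeout x ∪ y) :=
  atom_seq_congr a fun u s => by
    simp only [NT_union, NT_tau_seq]; tauto

theorem drb3 (a : Atom A) : seq (atom a) (seq (atom .tau) (timeout x ∪ y) ∪ y) =
    seq (atom a) (timeout x ∪ y) :=
  atom_seq_congr a fun u s => by
    simp only [NT_union, NT_tau_seq]; tauto

theorem encap_atom_of_notMem {H : Set A} {a : Atom A} (h : a ∉ Atom.act '' H) :
    encap H (atom a) = atom a := by
  ext o
  rcases o with _ | _ | _ | b | ⟨b, w, s⟩ <;> simp only [encap, atom, Set.mem_ofPred_eq]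
  · simp
  · simp
  · constructor
    · exact fun h => h.2
    · rintro rfl; exact ⟨h, rfl⟩
  · constructor
    · exact fun h => h.2.2
    · rintro ⟨rfl, rfl, hs⟩; exact ⟨h, by simp, rfl, rfl, hs⟩

theorem encap_atom_of_mem {H : Set A} {a : Atom A} (h : a ∈ Atom.act '' H) :
    encap H (atom a) = ∅ := by
  ext o
  rcases o with _ | _ | _ | b | ⟨b, w, s⟩ <;>
    simp only [encap, atom, Set.mem_ofPred_eq, Set.mem_empty_iff_false, or_self, iff_false]
  · rintro ⟨h', rfl⟩; exact h' h
  · rintro ⟨h', -, rfl, -⟩; exact h' h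

theorem encap_union {H : Set A} : encap H (x ∪ y) = encap H x ∪ encap H y := by
  ext o
  rcases o with _ | _ | _ | b | ⟨b, w, s⟩ <;> simp only [encap, Set.mem_ofPred_eq, Set.mem_union]
  all_goals tauto

theorem encap_seq {H : Set A} : encap H (seq x y) = seq (encap H x) (encap H y) := by
  ext o
  rcases o with _ | _ | _ | b | ⟨b, w, s⟩
  case tr =>
    simp only [tr_mem_encap, tr_mem_seq, NT_encap]
    constructor
    · rintro ⟨h1, h2, h3 | ⟨v, w, rfl, h3, h4⟩⟩
      · exact .inl ⟨⟨h1, h2, h3.1⟩, h3.2⟩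
      · exact .inr ⟨v, w, rfl, ⟨h1, fun a ha => h2 a (by simp [ha]), h3⟩,
          fun a ha => h2 a (by simp [ha]), h4⟩
    · rintro (⟨⟨h1, h2, h3⟩, h4⟩ | ⟨v, w, rfl, ⟨h1, h2, h3⟩, h4, h5⟩)
      · exact ⟨h1, h2, .inl ⟨h3, h4⟩⟩
      · refine ⟨h1, fun a ha => ?_, .inr ⟨v, w, rfl, h3, h5⟩⟩
        rcases List.mem_append.1 ha with ha | ha
        · exact h2 a ha
        · exact h4 a ha
  all_goals exact Iff.rfl

theorem encap_delay {H : Set A} : encap H delay = delay := by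
  ext o
  rcases o with _ | _ | _ | b | ⟨b, w, s⟩ <;> simp [encap, delay]

theorem abstr_atom_of_notMem {I : Set A} {a : Atom A} (h : a ∉ Atom.act '' I) :
    abstr I (atom a) = atom a := by
  ext o
  rcases o with _ | _ | _ | b | ⟨b, w, s⟩ <;> simp only [abstr, atom, Set.mem_ofPred_eq]
  · simp
  · simp
  · constructor
    · rintro ⟨b', hb, rfl⟩; rw [← hb, hide, if_neg h]
    · rintro rfl; exact ⟨b, by rw [hide, if_neg h], rfl⟩
  · constructor
    · rintro ⟨b', u', hb, rfl, rfl, rfl, hs⟩; rw [← hb, hide, if_neg h]; exact ⟨rfl, rfl, hs⟩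
    · rintro ⟨rfl, rfl, hs⟩; exact ⟨b, [], by rw [hide, if_neg h], rfl, rfl, rfl, hs⟩

theorem abstr_atom_of_mem {I : Set A} {a : Atom A} (h : a ∈ Atom.act '' I) :
    abstr I (atom a) = atom .tau := by
  obtain ⟨a, ha, rfl⟩ := h
  have hex : ∀ b : Option A, Atom.act a = exec b ↔ b = some a := by
    rintro (_ | b) <;> simp [exec, eq_comm]
  have hτ : ∀ b : Option A, Atom.tau = exec b ↔ b = none := by
    rintro (_ | b) <;> simp [exec]
  ext o
  rcases o with _ | _ | _ | b | ⟨b, w, s⟩ <;>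
    simp only [abstr, atom, Set.mem_ofPred_eq, hex, hτ, or_self]
  · constructor
    · rintro ⟨b', rfl, rfl⟩; simp [hide, exec, ha]
    · rintro rfl; exact ⟨_, by simp [hide, exec, ha], rfl⟩
  · constructor
    · rintro ⟨b', u', rfl, rfl, rfl, rfl, hs⟩; simp [hide, exec, ha, hs]
    · rintro ⟨rfl, rfl, hs⟩; exact ⟨_, [], by simp [hide, exec, ha], rfl, rfl, rfl, hs⟩

theorem abstr_union {I : Set A} : abstr I (x ∪ y) = abstr I x ∪ abstr I y := by
  ext o
  rcases o with _ | _ | _ | b | ⟨b, w, s⟩ <;> simp only [abstr, Set.mem_ofPred_eq, Set.mem_union]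
  · tauto
  · tauto
  · grind
  · grind

theorem abstr_seq {I : Set A} : abstr I (seq x y) = seq (abstr I x) (abstr I y) := by
  ext o
  rcases o with _ | _ | _ | b | ⟨b, w, s⟩
  case tr =>
    simp only [tr_mem_abstr, tr_mem_seq, NT_abstr]
    constructor
    · rintro ⟨b', u', hb, rfl, h | ⟨v, w, rfl, h, h'⟩⟩
      · exact .inl ⟨⟨b', u', hb, rfl, h.1⟩, h.2⟩
      · exact .inr ⟨_, _, List.filter_append _ _, ⟨b', v, hb, rfl, h⟩, w, rfl, h'⟩
    · rintro (⟨⟨b', u', hb, rfl, h⟩, hs⟩ | ⟨_, _, rfl, ⟨b', v, hb, rfl, h⟩, w, rfl, h'⟩)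
      · exact ⟨b', u', hb, rfl, .inl ⟨h, hs⟩⟩
      · exact ⟨b', v ++ w, hb, List.filter_append _ _, .inr ⟨v, w, rfl, h, h'⟩⟩
  all_goals exact Iff.rfl

theorem abstr_delay {I : Set A} : abstr I delay = delay := by
  ext o
  rcases o with _ | _ | _ | b | ⟨b, w, s⟩ <;> simp [abstr, delay]

theorem delay_lmerge_timeout : lmerge γ delay (timeout x) = ∅ := by
  ext o
  rcases o with _ | _ | _ | b | ⟨b, w, s⟩ <;> simp [lmerge, delay, timeout, LCond]

theorem delay_lmerge_union : lmerge γ delay (timeout x ∪ delay) = delay := by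
  ext o
  rcases o with _ | _ | _ | b | ⟨b, w, s⟩ <;> simp [lmerge, delay, timeout, LCond]

theorem LCond.union : LCond (x ∪ y) z ↔ LCond x z ∨ LCond y z := by
  simp only [LCond, Set.mem_union]; tauto

theorem CCond.union : CCond (x ∪ y) z ↔ CCond x z ∨ CCond y z := by
  simp only [CCond, Set.mem_union, exists_or]; tauto

theorem CCond.symm (h : CCond x y) : CCond y x := by
  simp only [CCond] at *; tauto

theorem union_lmerge : lmerge γ (x ∪ y) z = lmerge γ x z ∪ lmerge γ y z := by
  ext o
  rcases o with _ | _ | _ | b | ⟨b, w, s⟩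
  · exact LCond.union
  · exact LCond.union
  · exact or_and_right
  · exact Iff.rfl
  · constructor
    · rintro (⟨h, h'⟩ | ⟨u, s₁, v, s₂, h | h, h'⟩)
      · exact (LCond.union.1 h).imp (fun h => .inl ⟨h, h'⟩) (fun h => .inl ⟨h, h'⟩)
      · exact .inl (.inr ⟨u, s₁, v, s₂, h, h'⟩)
      · exact .inr (.inr ⟨u, s₁, v, s₂, h, h'⟩)
    · rintro ((⟨h, h'⟩ | ⟨u, s₁, v, s₂, h, h'⟩) | (⟨h, h'⟩ | ⟨u, s₁, v, s₂, h, h'⟩))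
      · exact .inl ⟨LCond.union.2 (.inl h), h'⟩
      · exact .inr ⟨u, s₁, v, s₂, .inl h, h'⟩
      · exact .inl ⟨LCond.union.2 (.inr h), h'⟩
      · exact .inr ⟨u, s₁, v, s₂, .inr h, h'⟩

theorem cmerge_symm : cmerge γ x y ⊆ cmerge γ y x := by
  rintro (_ | _ | _ | b | ⟨b, w, s⟩) h
  · exact CCond.symm h
  · exact CCond.symm h
  · exact And.symm h
  · obtain ⟨a, a', c, rfl, h1, h2, hc⟩ := h
    exact ⟨a', a, c, rfl, h2, h1, by rw [γ.comm_symm, hc]⟩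
  · obtain ⟨h, h'⟩ | ⟨a, a', c, rfl, hc, u, s₁, v, s₂, h1, h2, h3, h4⟩ := h
    · exact .inl ⟨CCond.symm h, h'⟩
    · exact .inr ⟨a', a, c, rfl, by rw [γ.comm_symm, hc], v, s₂, u, s₁, h2, h1, h3.symm, h4.symm⟩

theorem cmerge_comm : cmerge γ x y = cmerge γ y x := cmerge_symm.antisymm cmerge_symm

theorem timeout_cmerge_delay : cmerge γ (timeout x) delay = ∅ := by
  ext o
  rcases o with _ | _ | _ | b | ⟨b, w, s⟩ <;> simp [cmerge, delay, timeout, CCond]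

theorem delay_cmerge_timeout : cmerge γ delay (timeout x) = ∅ := by
  rw [cmerge_comm, timeout_cmerge_delay]

theorem delay_cmerge_delay : cmerge γ delay delay = delay := by
  ext o
  rcases o with _ | _ | _ | b | ⟨b, w, s⟩ <;> simp [cmerge, delay, CCond]

theorem union_cmerge : cmerge γ (x ∪ y) z = cmerge γ x z ∪ cmerge γ y z := by
  ext o
  rcases o with _ | _ | _ | b | ⟨b, w, s⟩
  · exact CCond.union
  · exact CCond.union
  · exact or_and_right
  · constructor
    · rintro ⟨a, a', c, hb, h | h, h'⟩
      · exact .inl ⟨a, a', c, hb, h, h'⟩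
      · exact .inr ⟨a, a', c, hb, h, h'⟩
    · rintro (⟨a, a', c, hb, h, h'⟩ | ⟨a, a', c, hb, h, h'⟩)
      · exact ⟨a, a', c, hb, .inl h, h'⟩
      · exact ⟨a, a', c, hb, .inr h, h'⟩
  · constructor
    · rintro (⟨h, h'⟩ | ⟨a, a', c, hb, hc, u, s₁, v, s₂, h | h, h'⟩)
      · exact (CCond.union.1 h).imp (fun h => .inl ⟨h, h'⟩) (fun h => .inl ⟨h, h'⟩)
      · exact .inl (.inr ⟨a, a', c, hb, hc, u, s₁, v, s₂, h, h'⟩)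
      · exact .inr (.inr ⟨a, a', c, hb, hc, u, s₁, v, s₂, h, h'⟩)
    · rintro ((⟨h, h'⟩ | ⟨a, a', c, hb, hc, u, s₁, v, s₂, h, h'⟩) |
        (⟨h, h'⟩ | ⟨a, a', c, hb, hc, u, s₁, v, s₂, h, h'⟩))
      · exact .inl ⟨CCond.union.2 (.inl h), h'⟩
      · exact .inr ⟨a, a', c, hb, hc, u, s₁, v, s₂, .inl h, h'⟩
      · exact .inl ⟨CCond.union.2 (.inr h), h'⟩
      · exact .inr ⟨a, a', c, hb, hc, u, s₁, v, s₂, .inr h, h'⟩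

theorem cmerge_union : cmerge γ x (y ∪ z) = cmerge γ x y ∪ cmerge γ x z := by
  simp only [cmerge_comm (x := x), union_cmerge]

end Model

/-! ### Interpretation of terms in the trace model -/

/-- Interpretation of terms; recursion constants denote least solutions. -/
def ev (γ : Communication A) : Term A → (ℕ → Set (Obs A)) → Set (Obs A)
  | var x, ρ => ρ x
  | atom a, _ => Model.atom a
  | alt s t, ρ => ev γ s ρ ∪ ev γ t ρ
  | seq s t, ρ => Model.seq (ev γ s ρ) (ev γ t ρ)
  | delay _, _ => Model.delay
  | par s t, ρ => Model.par γ (ev γ s ρ) (ev γ t ρ)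
  | lmerge s t, ρ => Model.lmerge γ (ev γ s ρ) (ev γ t ρ)
  | cmerge s t, ρ => Model.cmerge γ (ev γ s ρ) (ev γ t ρ)
  | encap H t, ρ => Model.encap H (ev γ t ρ)
  | abstr I t, ρ => Model.abstr I (ev γ t ρ)
  | timeout t, ρ => Model.timeout (ev γ t ρ)
  | recur V E X, _ => sInf {S : ℕ → Set (Obs A) | ∀ j : V, ev γ (E j) S ⊆ S j} X

variable {γ : Communication A}

theorem ev_subst (ρ : ℕ → Set (Obs A)) (σ : ℕ → Term A) (t : Term A) :
    ev γ (t.subst σ) ρ = ev γ t (fun x => ev γ (σ x) ρ) := by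
  induction t with
  | recur => rfl
  | _ => simp_all [ev, subst]

theorem ev_congr {ρ ρ' : ℕ → Set (Obs A)} {t : Term A} (h : ∀ x ∈ t.vars, ρ x = ρ' x) :
    ev γ t ρ = ev γ t ρ' := by
  induction t with
  | recur => rfl
  | _ => simp_all [ev, vars, or_imp, forall_and]

theorem ev_axiom (hγ : Proc.Visible γ) {s t : Term A} (h : ACPAxiom γ s t)
    (ρ : ℕ → Set (Obs A)) : ev γ s ρ = ev γ t ρ := by
  induction h with
  | bpa h =>
    induction h with
    | A1 => exact Set.union_comm _ _
    | A2 => exact Set.union_assoc _ _ _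
    | A3 => exact Set.union_self _
    | A4 => exact Model.union_seq
    | A5 => exact Model.seq_assoc
    | A6DR => simp only [ev, Model.dead_eq, Set.union_empty]
    | A7DR => simp only [ev, Model.dead_eq, Model.empty_seq]
    | DRT1 => exact Set.union_self _
    | DRT2 => exact Model.delay_seq
    | TI1DR _ _ h => exact Model.abstr_atom_of_notMem h
    | TI2DR _ _ h => exact Model.abstr_atom_of_mem h
    | TI3 => exact Model.abstr_union
    | TI4 => exact Model.abstr_seq
    | DRTI => exact Model.abstr_delay
    | DRTO1 => exact Model.timeout_atom _
    | DRTO2 => exact Model.timeout_union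
    | DRTO3 => exact Model.timeout_seq
    | DRTO4 => exact Model.timeout_delay.trans Model.dead_eq.symm
    | DRB1 => exact Model.atom_seq_tau _
    | DRB2 => exact Model.drb2 _
    | DRB3 => exact Model.drb3 _
    | DRB4 => rfl
  | D1DR _ _ h => exact Model.encap_atom_of_notMem h
  | D2DR _ _ h => exact (Model.encap_atom_of_mem h).trans Model.dead_eq.symm
  | D3 => exact Model.encap_union
  | D4 => exact Model.encap_seq
  | DRD => exact Model.encap_delay
  | CM1 => rfl
  | CM2DR => exact Model.lmerge_atom _
  | CM3DR => exact Model.lmerge_atom_seq _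
  | DRCM1 => exact Model.delay_lmerge_timeout.trans Model.dead_eq.symm
  | DRCM2 => exact Model.delay_lmerge_union
  | CM4 => exact Model.union_lmerge
  | CM5DR a b x =>
    simp only [ev]
    rw [Model.cmerge_atom hγ, ← Model.atom_seq_tau b, Model.cmerge_atom_seq hγ]
    refine Model.atom_seq_congr _ fun u s => ?_
    rw [Model.par_comm_mem, Model.NT_tau_par]
  | CM6DR a b x =>
    simp only [ev]
    rw [Model.cmerge_atom hγ, ← Model.atom_seq_tau a, Model.cmerge_atom_seq hγ]
    exact Model.atom_seq_congr _ fun u s => Model.NT_tau_par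
  | CM7DR =>
    simp only [ev]
    rw [Model.cmerge_atom hγ, Model.cmerge_atom_seq hγ]
  | DRCM3 => exact Model.timeout_cmerge_delay.trans Model.dead_eq.symm
  | DRCM4 => exact Model.delay_cmerge_timeout.trans Model.dead_eq.symm
  | DRCM5 => exact Model.delay_cmerge_delay
  | CM8 => exact Model.union_cmerge
  | CM9 => exact Model.cmerge_union
  | CFDR => exact Model.cmerge_atom hγ _ _

theorem ev_inContext {R : Term A → Term A → Prop} {ρ : ℕ → Set (Obs A)}
    (hR : ∀ s t, R s t → ev γ s ρ = ev γ t ρ) {s t : Term A} (h : InContext R s t) :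
    ev γ s ρ = ev γ t ρ := by
  induction h with
  | base h => exact hR _ _ h
  | _ => simp_all [ev]

/-! ### Comparison of observations up to length and up to unknown behaviour. -/

namespace Model

/-- Length of an observation. -/
def rank : Obs A → ℕ
  | tr none u _ => u.length
  | tr (some _) u _ => u.length + 1
  | _ => 0

/-- Observations of unknown behaviour. -/
def Unk : Obs A → Prop
  | raw => True
  | now => True
  | tr _ _ s => s = unk
  | _ => False

/-- `x` is included in `y` as far as observations with a length satisfying `P` are concerned that,
if `U` fails, are not observations of unknown behaviour. -/
def Le (P : ℕ → Prop) (U : Prop) (x y : Set (Obs A)) : Prop :=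
  ∀ o ∈ x, P (rank o) → (Unk o → U) → o ∈ y

variable {P : ℕ → Prop} {U : Prop} {x y x' y' : Set (Obs A)}

/-- This and the following lemmas rest on two facts. Observations of a composite arise from
observations of the arguments with no more visible actions, abstraction excepted; and known
observations arise from known ones only. -/
theorem Le.union (hx : Le P U x x') (hy : Le P U y y') : Le P U (x ∪ y) (x' ∪ y') :=
  fun o ho h h' => ho.imp (fun ho => hx o ho h h') (fun ho => hy o ho h h')

theorem Le.NT (hx : Le P U x x') {u : List A} {s : St} (h : NT x u s) (hP : P u.length)
    (hU : s = unk → U) : NT x' u s := by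
  obtain ⟨rfl, rfl⟩ | ⟨rfl, rfl, h | h⟩ | h | ⟨a, v, rfl, h⟩ := h
  · exact NT_nil_part _
  · exact .inr (.inl ⟨rfl, rfl, .inl (hx _ h hP fun _ => hU rfl)⟩)
  · exact .inr (.inl ⟨rfl, rfl, .inr (hx _ h hP fun _ => hU rfl)⟩)
  · exact .inr (.inr (.inl (hx _ h hP hU)))
  · exact .inr (.inr (.inr ⟨a, v, rfl, hx _ h hP hU⟩))

theorem rank_append_left {b : Option A} {u v : List A} {s s' : St} :
    rank (tr b u s) ≤ rank (tr b (u ++ v) s') := by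
  cases b <;> simp [rank]

theorem length_le_rank {b : Option A} {u : List A} {s : St} : u.length ≤ rank (tr b u s) := by
  cases b <;> simp [rank]

theorem rank_mono {b : Option A} {u v : List A} {s s' : St} (h : u.length ≤ v.length) :
    rank (tr b u s) ≤ rank (tr b v s') := by
  cases b <;> simp [rank, h]

theorem Le.seq (hP : ∀ m n, m ≤ n → P n → P m) (hx : Le P U x x') (hy : Le P U y y') :
    Le P U (seq x y) (seq x' y') := by
  rintro (_ | _ | _ | b | ⟨b, u, s⟩) ho h h'
  case tr =>
    obtain ⟨ho, hs⟩ | ⟨v, w, rfl, h1, h2⟩ := ho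
    · exact .inl ⟨hx _ ho h h', hs⟩
    · refine .inr ⟨v, w, rfl, hx _ h1 (hP _ _ rank_append_left h) (fun h => nomatch h),
        hy.NT h2 (hP _ _ ?_ h) h'⟩
      exact le_trans (by simp) length_le_rank
  all_goals exact hx _ ho h h'

/-- The gain from a guard: a trace of `a·y` has one visible action more than the trace of `y` it
comes from. A silent prefix would gain nothing, since `rank` counts visible actions only. -/
theorem Le.act_seq {P' : ℕ → Prop} (hP : ∀ n, P' (n + 1) → P n) (hy : Le P U y y') (a : A) :
    Le P' U (Model.seq (atom (.act a)) y) (Model.seq (atom (.act a)) y') := by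
  rintro (_ | _ | _ | b | ⟨b, u, s⟩) ho h h'
  case tr =>
    rw [tr_mem_atom_seq] at ho ⊢
    refine ⟨ho.1, hy.NT ho.2 (hP _ ?_) h'⟩
    cases b with
    | none => cases ho.1
    | some b => exact h
  all_goals exact ho

theorem Le.timeout (hx : Le P U x x') : Le P U (timeout x) (timeout x') := by
  rintro (_ | _ | _ | b | ⟨b, u, s⟩) ho h h'
  · exact ho
  · exact ho.imp (fun ho => hx _ ho h h') (fun ho => hx _ ho h h')
  · exact ho
  · exact hx _ ho h h'
  · exact hx _ ho h h'

theorem Le.lcond (hU : U) (h0 : P 0) (hx : Le P U x x') (hy : Le P U y y') (h : LCond x y) :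
    LCond x' y' :=
  h.imp (fun h => hx _ h h0 fun _ => hU) (Or.imp (fun h => hx _ h h0 fun _ => hU)
    (And.imp (fun h => hx _ h h0 fun _ => hU) (fun h => hy _ h h0 fun _ => hU)))

theorem Le.ccond (hU : U) (h0 : P 0) (hx : Le P U x x') (hy : Le P U y y') (h : CCond x y) :
    CCond x' y' := by
  have hx' : ∀ o, rank o = 0 → o ∈ x → o ∈ x' := fun o h1 h2 => hx o h2 (h1 ▸ h0) fun _ => hU
  have hy' : ∀ o, rank o = 0 → o ∈ y → o ∈ y' := fun o h1 h2 => hy o h2 (h1 ▸ h0) fun _ => hU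
  obtain h | h | ⟨h, h'⟩ | ⟨h, b, h'⟩ | ⟨⟨b, h⟩, h'⟩ := h
  · exact .inl (hx' _ rfl h)
  · exact .inr (.inl (hy' _ rfl h))
  · exact .inr (.inr (.inl ⟨hx' _ rfl h, hy' _ rfl h'⟩))
  · exact .inr (.inr (.inr (.inl ⟨hx' _ rfl h, b, hy' _ rfl h'⟩)))
  · exact .inr (.inr (.inr (.inr ⟨⟨b, hx' _ rfl h⟩, hy' _ rfl h'⟩)))

theorem Join.left_unk {s t r : St} (h : Join s t r) (hs : s = unk) : r = unk := by
  cases h <;> simp_all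

theorem Join.right_unk {s t r : St} (h : Join s t r) (hs : t = unk) : r = unk := by
  cases h <;> simp_all

theorem Le.lmerge (hP : ∀ m n, m ≤ n → P n → P m) (hx : Le P U x x') (hy : Le P U y y') :
    Le P U (lmerge γ x y) (lmerge γ x' y') := by
  rintro (_ | _ | _ | b | ⟨b, w, s⟩) ho h h'
  · exact hx.lcond (h' trivial) h hy ho
  · exact hx.lcond (h' trivial) h hy ho
  · exact ⟨hx _ ho.1 h h', hy _ ho.2 h h'⟩
  · exact hx _ ho h h'
  · obtain ⟨ho, rfl, rfl, rfl⟩ | ⟨u, s₁, v, s₂, h1, h2, h3, h4⟩ := ho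
    · exact .inl ⟨hx.lcond (h' rfl) h hy ho, rfl, rfl, rfl⟩
    · exact .inr ⟨u, s₁, v, s₂, hx _ h1 (hP _ _ (rank_mono h3.length_left) h)
        fun hs => h' (Join.left_unk h4 hs),
        hy.NT h2 (hP _ _ (h3.length_right.trans length_le_rank) h)
        fun hs => h' (Join.right_unk h4 hs), h3, h4⟩

theorem Le.cmerge (hP : ∀ m n, m ≤ n → P n → P m) (hx : Le P U x x') (hy : Le P U y y') :
    Le P U (cmerge γ x y) (cmerge γ x' y') := by
  rintro (_ | _ | _ | b | ⟨b, w, s⟩) ho h h'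
  · exact hx.ccond (h' trivial) h hy ho
  · exact hx.ccond (h' trivial) h hy ho
  · exact ⟨hx _ ho.1 h h', hy _ ho.2 h h'⟩
  · obtain ⟨a, a', c, hb, h1, h2, hc⟩ := ho
    exact ⟨a, a', c, hb, hx _ h1 h (fun h => nomatch h), hy _ h2 h (fun h => nomatch h), hc⟩
  · obtain ⟨ho, rfl, rfl, rfl⟩ | ⟨a, a', c, rfl, hc, u, s₁, v, s₂, h1, h2, h3, h4⟩ := ho
    · exact .inl ⟨hx.ccond (h' rfl) h hy ho, rfl, rfl, rfl⟩
    · exact .inr ⟨a, a', c, rfl, hc, u, s₁, v, s₂,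
        hx _ h1 (hP _ _ (Nat.succ_le_succ h3.length_left) h) fun hs => h' (Join.left_unk h4 hs),
        hy _ h2 (hP _ _ (Nat.succ_le_succ h3.length_right) h) fun hs => h' (Join.right_unk h4 hs),
        h3, h4⟩

theorem Le.par (hP : ∀ m n, m ≤ n → P n → P m) (hx : Le P U x x') (hy : Le P U y y') :
    Le P U (par γ x y) (par γ x' y') :=
  ((hx.lmerge hP hy).union (hy.lmerge hP hx)).union (hx.cmerge hP hy)

theorem Le.encap (H : Set A) (hx : Le P U x x') : Le P U (encap H x) (encap H x') := by
  rintro (_ | _ | _ | b | ⟨b, u, s⟩) ho h h'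
  · exact ho.imp (fun ho => hx _ ho h h') (fun ho => hx _ ho h h')
  · exact ho.imp (fun ho => hx _ ho h h') (fun ho => hx _ ho h h')
  · exact hx _ ho h h'
  · exact ⟨ho.1, hx _ ho.2 h h'⟩
  · exact ⟨ho.1, ho.2.1, hx _ ho.2.2 h h'⟩

theorem Le.abstr (hP : ∀ n, P n) (I : Set A) (hx : Le P U x x') :
    Le P U (abstr I x) (abstr I x') := by
  rintro (_ | _ | _ | b | ⟨b, u, s⟩) ho h h'
  · exact ho.imp (fun ho => hx _ ho h h') (fun ho => hx _ ho h h')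
  · exact ho.imp (fun ho => hx _ ho h h') (fun ho => hx _ ho h h')
  · exact hx _ ho h h'
  · obtain ⟨b', hb, ho⟩ := ho
    exact ⟨b', hb, hx _ ho h fun h => nomatch h⟩
  · obtain ⟨b', u', hb, hu, ho⟩ := ho
    exact ⟨b', u', hb, hu, hx _ ho (hP _) h'⟩

end Model

open Model (Le Unk rank)

/-- There are three uses: with no restriction it is monotonicity; with `U` false it says that
unknown observations in a valuation never create known ones; with bounded length it handles the part
of a guarded term below a visible action, where abstraction must be absent. -/
theorem le_ev {P : ℕ → Prop} {U : Prop} (hP : ∀ m n, m ≤ n → P n → P m)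
    {ρ ρ' : ℕ → Set (Obs A)} (hρ : ∀ x, Le P U (ρ x) (ρ' x)) :
    ∀ {t : Term A}, (t.NoAbstr ∨ ∀ n, P n) → Le P U (ev γ t ρ) (ev γ t ρ')
  | var x, _ => hρ x
  | atom _, _ => fun _ h _ _ => h
  | alt _ _, h => (le_ev hP hρ (h.imp_left And.left)).union (le_ev hP hρ (h.imp_left And.right))
  | seq _ _, h => (le_ev hP hρ (h.imp_left And.left)).seq hP (le_ev hP hρ (h.imp_left And.right))
  | delay _, _ => fun _ h _ _ => h
  | par _ _, h => (le_ev hP hρ (h.imp_left And.left)).par hP (le_ev hP hρ (h.imp_left And.right))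
  | lmerge _ _, h =>
    (le_ev hP hρ (h.imp_left And.left)).lmerge hP (le_ev hP hρ (h.imp_left And.right))
  | cmerge _ _, h =>
    (le_ev hP hρ (h.imp_left And.left)).cmerge hP (le_ev hP hρ (h.imp_left And.right))
  | encap H t, h => (le_ev hP hρ (t := t) h).encap H
  | abstr I t, h =>
    have hn : ∀ n, P n := h.resolve_left id
    (le_ev hP hρ (t := t) (.inr hn)).abstr hn I
  | timeout t, h => (le_ev hP hρ (t := t) h).timeout
  | recur _ _ _, _ => fun _ h _ _ => h

theorem ev_mono {ρ ρ' : ℕ → Set (Obs A)} (h : ρ ≤ ρ') (t : Term A) : ev γ t ρ ⊆ ev γ t ρ' :=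
  fun _ ho => le_ev (P := fun _ => True) (U := True) (fun _ _ _ _ => trivial)
    (fun x _ ho _ _ => h x ho) (.inr fun _ => trivial) _ ho trivial fun _ => trivial

/-- In a prefixed term each variable lies below a visible action, which uses up one unit of length,
or below a delay, where it is not observed. So agreement of the valuations on shorter observations
suffices. -/
theorem le_ev_prefixed {P P' : ℕ → Prop} {U : Prop} (hP : ∀ m n, m ≤ n → P' n → P' m)
    (hPP : ∀ n, P' (n + 1) → P n) {ρ ρ' : ℕ → Set (Obs A)} (hρ : ∀ x, Le P U (ρ x) (ρ' x))
    (hP0 : ∀ m n, m ≤ n → P n → P m) :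
    ∀ {t : Term A}, t.NoAbstr → t.Prefixed → Le P' U (ev γ t ρ) (ev γ t ρ')
  | var _, _, h => h.elim
  | atom _, _, _ => fun _ h _ _ => h
  | alt _ _, h, h' =>
    (le_ev_prefixed hP hPP hρ hP0 h.1 h'.1).union (le_ev_prefixed hP hPP hρ hP0 h.2 h'.2)
  | seq s t, h, h' => by
    obtain ⟨h1, ⟨a, rfl⟩ | h2⟩ := h'
    · exact Le.act_seq hPP (le_ev hP0 hρ (.inl h.2)) a
    · exact (le_ev_prefixed hP hPP hρ hP0 h.1 h1).seq hP (le_ev_prefixed hP hPP hρ hP0 h.2 h2)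
  | delay _, _, _ => fun _ h _ _ => h
  | par _ _, h, h' =>
    (le_ev_prefixed hP hPP hρ hP0 h.1 h'.1).par hP (le_ev_prefixed hP hPP hρ hP0 h.2 h'.2)
  | lmerge _ _, h, h' =>
    (le_ev_prefixed hP hPP hρ hP0 h.1 h'.1).lmerge hP (le_ev_prefixed hP hPP hρ hP0 h.2 h'.2)
  | cmerge _ _, h, h' =>
    (le_ev_prefixed hP hPP hρ hP0 h.1 h'.1).cmerge hP (le_ev_prefixed hP hPP hρ hP0 h.2 h'.2)
  | encap H t, h, h' => (le_ev_prefixed hP hPP hρ hP0 (t := t) h h').encap H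
  | timeout t, h, h' => (le_ev_prefixed hP hPP hρ hP0 (t := t) h h').timeout
  | recur _ _ _, _, _ => fun _ h _ _ => h

/-! ### Solutions of recursive specifications -/

/-- The operator on valuations that belongs to a recursive specification. -/
def recOp (γ : Communication A) (V : Set ℕ) (E : V → Term A) :
    (ℕ → Set (Obs A)) →o (ℕ → Set (Obs A)) where
  toFun S x := {o | ∃ h : x ∈ V, o ∈ ev γ (E ⟨x, h⟩) S}
  monotone' _ _ h _ _ := fun ⟨hx, ho⟩ => ⟨hx, ev_mono h _ ho⟩

theorem recOp_apply {V : Set ℕ} {E : V → Term A} {S : ℕ → Set (Obs A)} {x : ℕ} (h : x ∈ V) :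
    recOp γ V E S x = ev γ (E ⟨x, h⟩) S := by
  ext o; exact ⟨fun ⟨_, ho⟩ => ho, fun ho => ⟨h, ho⟩⟩

theorem ev_recur {V : Set ℕ} {E : V → Term A} {X : V} {ρ : ℕ → Set (Obs A)} :
    ev γ (recur V E X) ρ = (recOp γ V E).lfp X := by
  have : {S : ℕ → Set (Obs A) | ∀ j : V, ev γ (E j) S ⊆ S j} = {S | recOp γ V E S ≤ S} := by
    ext S
    exact ⟨fun h x o ⟨hx, ho⟩ => h ⟨x, hx⟩ ho, fun h j o ho => h j ⟨j.2, ho⟩⟩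
  rw [ev, this]
  rfl

theorem ev_of_fixed {V : Set ℕ} {E : V → Term A} {S : ℕ → Set (Obs A)}
    (h : recOp γ V E S = S) (X : V) : ev γ (E X) S = S X := by
  conv_rhs => rw [← h]
  exact (recOp_apply X.2).symm

theorem ev_rdp {T : Theory} {s t : Term A} (h : RDPAxiom (IsRec γ T) s t) (ρ : ℕ → Set (Obs A)) :
    ev γ s ρ = ev γ t ρ := by
  obtain ⟨V, E, X, h⟩ := h
  rw [ev_recur, recClose, ev_subst, ← ev_of_fixed (recOp γ V E).map_lfp X]
  refine ev_congr fun x hx => ?_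
  simp [(h.spec X).2 hx, ev_recur]

/-- The axioms and RDP hold under every valuation, and the equations of `E` hold at every fixed
point. So the greatest and the least solution both respect rewriting. -/
theorem ev_rewrite (hγ : Proc.Visible γ) {n : ℕ} {V : Set ℕ} {E : V → Term A} {i : V}
    {S : ℕ → Set (Obs A)} (hS : recOp γ V E S = S) {s t : Term A}
    (h : Relation.ReflTransGen (RewriteStep (IsOver .acp (RecLevel γ .acp n))
      (fun s t => BaseAxiom γ .acp s t ∨ RDPAxiom (RecLevel γ .acp n) s t) V E i) s t) :
    ev γ s S = ev γ t S := by
  have hax : ∀ s t, BaseAxiom γ .acp s t ∨ RDPAxiom (RecLevel γ .acp n) s t →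
      ev γ s S = ev γ t S := by
    rintro s t (h | ⟨V, E, X, h⟩)
    · exact ev_axiom hγ h S
    · exact ev_rdp (T := .acp) (.rdp V E X ⟨n, h⟩) S
  induction h with
  | refl => rfl
  | tail _ h ih =>
    rw [ih]
    refine ev_inContext ?_ h.2.2
    rintro s t (h | h | ⟨j, -, rfl, rfl⟩)
    · exact hax _ _ h
    · exact (hax _ _ h).symm
    · exact (ev_of_fixed hS j).symm

/-- Guarded recursive specifications have unique solutions. -/
theorem GuardedModulo.gfp_le_lfp (hγ : Proc.Visible γ) {n : ℕ} {V : Set ℕ} {E : V → Term A}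
    (h : GuardedModulo (IsOver .acp (RecLevel γ .acp n))
      (fun s t => BaseAxiom γ .acp s t ∨ RDPAxiom (RecLevel γ .acp n) s t) V E) :
    (recOp γ V E).gfp ≤ (recOp γ V E).lfp := by
  have key : ∀ m : ℕ, ∀ x, Le (· < m) True ((recOp γ V E).gfp x) ((recOp γ V E).lfp x) := by
    intro m
    induction m with
    | zero => exact fun _ _ _ h => (Nat.not_lt_zero _ h).elim
    | succ m ih =>
      intro x
      by_cases hx : x ∈ V
      -- At both solutions the right-hand side may be replaced by its guarded form, in which the
      -- induction hypothesis for lengths below `m` settles lengths below `m + 1`.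
      · obtain ⟨g, hg, hg'⟩ := h ⟨x, hx⟩
        rw [← ev_of_fixed (recOp γ V E).map_lfp ⟨x, hx⟩,
          ← ev_of_fixed (recOp γ V E).map_gfp ⟨x, hx⟩, ev_rewrite hγ (recOp γ V E).map_lfp hg,
          ev_rewrite hγ (recOp γ V E).map_gfp hg]
        obtain hv | ⟨h1, h2⟩ := hg'
        · rw [ev_congr (ρ' := (recOp γ V E).lfp) (by simp [hv])]
          exact fun _ h _ _ => h
        · exact le_ev_prefixed (fun _ _ h h' => h.trans_lt h') (fun _ => Nat.lt_of_succ_lt_succ) ih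
            (fun _ _ h h' => h.trans_lt h') h1 h2
      · rw [← (recOp γ V E).map_gfp]
        rintro o ⟨hx', -⟩
        exact (hx hx').elim
  exact fun x o ho => key (rank o + 1) x o ho (Nat.lt_succ_self _) fun _ => trivial

/-! ### Absence of unknown behaviour. -/

namespace Model

variable {x y : Set (Obs A)}

/-- No unknown behaviour is observed. -/
def Known (x : Set (Obs A)) : Prop := ∀ o ∈ x, ¬Unk o

theorem Known.NT (hx : Known x) {u : List A} : ¬NT x u unk := by
  rintro (⟨-, h⟩ | ⟨-, -, h | h⟩ | h | ⟨a, v, rfl, h⟩)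
  · cases h
  all_goals exact hx _ h (by simp [Unk])

theorem Known.lmerge (hx : Known x) (hy : Known y) : Known (lmerge γ x y) := by
  have hc : ¬LCond x y := by
    rintro (h | h | ⟨-, h⟩)
    exacts [hx _ h trivial, hx _ h trivial, hy _ h trivial]
  rintro (_ | _ | _ | b | ⟨b, w, s⟩) ho h
  · exact hc ho
  · exact hc ho
  · exact h
  · exact h
  · obtain ⟨ho, -⟩ | ⟨u, s₁, v, s₂, h1, h2, h3, h4⟩ := ho
    · exact hc ho
    · obtain rfl : s = unk := h
      cases h4
      · exact hx _ h1 rfl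
      · exact hy.NT h2

theorem Known.cmerge (hx : Known x) (hy : Known y) : Known (cmerge γ x y) := by
  have hc : ¬CCond x y := by
    rintro (h | h | ⟨h, -⟩ | ⟨h, -⟩ | ⟨-, h⟩)
    exacts [hx _ h trivial, hy _ h trivial, hx _ h trivial, hx _ h trivial, hy _ h trivial]
  rintro (_ | _ | _ | b | ⟨b, w, s⟩) ho h
  · exact hc ho
  · exact hc ho
  · exact h
  · exact h
  · obtain ⟨ho, -⟩ | ⟨a, a', c, -, -, u, s₁, v, s₂, h1, h2, h3, h4⟩ := ho
    · exact hc ho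
    · obtain rfl : s = unk := h
      cases h4
      · exact hx _ h1 rfl
      · exact hy _ h2 rfl

theorem Known.union (hx : Known x) (hy : Known y) : Known (x ∪ y) :=
  fun o ho => ho.elim (hx o) (hy o)

end Model

open Model (Known)

/-- The operators create no unknown behaviour of their own. For a recursion constant, the valuation
by all known observations is therefore a pre-fixed point and bounds the least solution. -/
theorem known_ev (t : Term A) : ∀ {ρ : ℕ → Set (Obs A)}, (∀ x, Known (ρ x)) → Known (ev γ t ρ) := by
  induction t with
  | var x => exact fun h => h x
  | atom a => rintro ρ hρ (_ | _ | _ | b | ⟨b, w, s⟩) ho h <;> simp_all [ev, Model.atom, Unk]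
  | alt s t ihs iht => exact fun h => (ihs h).union (iht h)
  | seq s t ihs iht =>
    rintro ρ hρ (_ | _ | _ | b | ⟨b, w, s⟩) ho h
    case tr =>
      obtain ho | ⟨v, w, rfl, h1, h2⟩ := ho
      · exact ihs hρ _ ho.1 h
      · obtain rfl : s = unk := h
        exact (iht hρ).NT h2
    all_goals exact ihs hρ _ ho h
  | delay t => rintro ρ hρ o rfl h; exact h
  | par s t ihs iht =>
    exact fun h => (((ihs h).lmerge (iht h)).union ((iht h).lmerge (ihs h))).union
      ((ihs h).cmerge (iht h))
  | lmerge s t ihs iht => exact fun h => (ihs h).lmerge (iht h)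
  | cmerge s t ihs iht => exact fun h => (ihs h).cmerge (iht h)
  | encap H t iht =>
    rintro ρ hρ (_ | _ | _ | b | ⟨b, w, s⟩) ho h
    · exact ho.elim (fun ho => iht hρ _ ho trivial) (fun ho => iht hρ _ ho trivial)
    · exact ho.elim (fun ho => iht hρ _ ho trivial) (fun ho => iht hρ _ ho trivial)
    · exact h
    · exact h
    · exact iht hρ _ ho.2.2 h
  | abstr I t iht =>
    rintro ρ hρ (_ | _ | _ | b | ⟨b, w, s⟩) ho h
    · exact ho.elim (fun ho => iht hρ _ ho trivial) (fun ho => iht hρ _ ho trivial)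
    · exact ho.elim (fun ho => iht hρ _ ho trivial) (fun ho => iht hρ _ ho trivial)
    · exact h
    · exact h
    · obtain ⟨b', u', -, -, ho⟩ := ho
      exact iht hρ _ ho h
  | timeout t iht =>
    rintro ρ hρ (_ | _ | _ | b | ⟨b, w, s⟩) ho h
    · exact ho
    · exact ho.elim (fun ho => iht hρ _ ho trivial) (fun ho => iht hρ _ ho trivial)
    · exact ho
    · exact h
    · exact iht hρ _ ho h
  | recur V E X ih =>
    intro ρ _
    have hle : (recOp γ V E).lfp ≤ fun _ => {o | ¬Unk o} :=
      OrderHom.lfp_le _ fun x o ⟨hx, ho⟩ => ih ⟨x, hx⟩ (fun _ _ h => h) o ho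
    rw [ev_recur]
    exact fun o ho => hle X ho

namespace Proc

variable {γ : Communication A}

/-! ### Faithful observation of processes -/

/-- The observations that witness a summand of a head normal form. -/
def Summand.obs : Summand γ → Set (Obs A)
  | fin b => {hd b, tr b [] part, tr b [] term}
  | pre b _ => {hd b, tr b [] part}
  | del _ => {Obs.del}

/-- `x` splits into a part in the current time slice and a delayed part. -/
def Splits (x : Proc γ) (m : Set (Obs A)) : Prop :=
  ∃ k ∈ K γ True, ∃ o : Option (Proc γ), (∀ z ∈ o, z ∈ K γ True) ∧ x = tmo k + odl o ∧
    (o ≠ none → del ∈ m)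

/-- `l` is a head normal form of `x` whose summands are observed in `m`. -/
def HNF (x : Proc γ) (m : Set (Obs A)) (l : List (Summand γ)) : Prop :=
  (∀ s ∈ l, s.Over True) ∧ x = sumOf l ∧ ∀ s ∈ l, s.obs ⊆ m

/-- After a silent step of the head normal form `l`, chains of silent steps are well-founded. -/
def Settles (m : Set (Obs A)) (l : List (Summand γ)) : Prop :=
  ∀ k, .pre none k ∈ l → Res True (silent ∈ m) k

/-- As far as unknown behaviour is not observed in `m`, `x` has head normal forms. -/
structure Faithful (x : Proc γ) (m : Set (Obs A)) : Prop where
  mem_K : x ∈ K γ True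
  now_of_raw : raw ∈ m → now ∈ m
  late_of_now : now ∈ m → late ∈ m
  splits : raw ∉ m → Splits x m
  hnf : now ∉ m → ∃ l, HNF x m l
  settled : late ∉ m → ∃ l, HNF x m l ∧ Settles m l

variable {x y : Proc γ} {m m' : Set (Obs A)} {l : List (Summand γ)}

theorem Splits.mono (hm : ∀ o ∈ m, ¬Model.Unk o → o ∈ m') (h : Splits x m) : Splits x m' := by
  obtain ⟨k, hk, o, ho, hx, hd⟩ := h
  exact ⟨k, hk, o, ho, hx, fun h => hm _ (hd h) id⟩

theorem Summand.not_unk {s : Summand γ} {o : Obs A} (h : o ∈ s.obs) : ¬Model.Unk o := by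
  cases s
  · obtain rfl | rfl | rfl := h <;> simp [Model.Unk]
  · obtain rfl | rfl := h <;> simp [Model.Unk]
  · obtain rfl := h; simp [Model.Unk]

/-- Summands are witnessed by known observations, so unknown ones may be added or dropped freely. -/
theorem HNF.mono (hm : ∀ o ∈ m, ¬Model.Unk o → o ∈ m') (h : HNF x m l) : HNF x m' l :=
  ⟨h.1, h.2.1, fun s hs _ ho => hm _ (h.2.2 s hs ho) (Summand.not_unk ho)⟩

theorem Settles.mono (hm : silent ∈ m → silent ∈ m') (h : Settles m l) : Settles m' l :=
  fun k hk => (h k hk).mono hm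

theorem HNF.splits (h : HNF x m l) : Splits x m := by
  obtain ⟨h1, rfl, h2⟩ := h
  obtain ⟨o, ho, ho', ho''⟩ := sumOf_split l h1
  refine ⟨sumOf l, sumOf_mem_K h1, o, ho', ho, fun h => ?_⟩
  obtain ⟨k, hk⟩ := ho'' h
  exact h2 _ hk rfl

theorem HNF.hd_mem (h : HNF x m l) {b : Option A} (hb : .fin b ∈ l ∨ ∃ k, .pre b k ∈ l) :
    hd b ∈ m := by
  obtain hb | ⟨k, hb⟩ := hb
  · exact h.2.2 _ hb (.inl rfl)
  · exact h.2.2 _ hb (.inl rfl)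

theorem HNF.part_mem (h : HNF x m l) {b : Option A} (hb : .fin b ∈ l ∨ ∃ k, .pre b k ∈ l) :
    tr b [] part ∈ m := by
  obtain hb | ⟨k, hb⟩ := hb
  · exact h.2.2 _ hb (.inr (.inl rfl))
  · exact h.2.2 _ hb (.inr rfl)

theorem HNF.term_mem (h : HNF x m l) {b : Option A} (hb : .fin b ∈ l) : tr b [] term ∈ m :=
  h.2.2 _ hb (.inr (.inr rfl))

theorem HNF.del_mem (h : HNF x m l) {k : Proc γ} (hb : .del k ∈ l) : del ∈ m := h.2.2 _ hb rfl

theorem HNF.res (h : HNF x m l) (h' : Settles m l) : Res True (silent ∈ m) x := by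
  rw [h.2.1]
  exact .mk l h.1 (fun h'' => h.term_mem h'') h'

theorem Faithful.res (h : Faithful x m) (hm : late ∉ m) : Res True (silent ∈ m) x := by
  obtain ⟨l, h1, h2⟩ := h.settled hm
  exact h1.res h2

theorem Faithful.of_settled (h1 : raw ∈ m → now ∈ m) (h2 : now ∈ m → late ∈ m)
    (h : HNF x m l) (h' : Settles m l) : Faithful x m where
  mem_K := by rw [h.2.1]; exact sumOf_mem_K h.1
  now_of_raw := h1
  late_of_now := h2
  splits _ := h.splits
  hnf _ := ⟨l, h⟩
  settled _ := ⟨l, h, h'⟩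

theorem Faithful.zero : Faithful (0 : Proc γ) ∅ :=
  .of_settled (l := []) (fun h => h.elim) (fun h => h.elim) ⟨by simp, rfl, by simp⟩
    (fun _ h => nomatch h)

theorem Faithful.at' (a : Atom A) : Faithful (at' a : Proc γ) (Model.atom a) := by
  cases h : a.exec? with
  | none =>
    obtain rfl := Atom.exec?_eq_none.1 h
    rw [Model.dead_eq]
    exact .zero
  | some b =>
    obtain rfl := Atom.exec?_eq_some.1 h
    refine .of_settled (l := [.fin b]) (fun h => h) (fun h => h.elim) ⟨?_, ?_, ?_⟩ ?_
    · simp [Summand.Over]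
    · simp [Summand.val]
    · simp [Summand.obs, Set.insert_subset_iff, Model.atom]
    · intro k hk; simp at hk

theorem Faithful.dl (hx : x ∈ K γ True) : Faithful (dl x) Model.delay := by
  refine .of_settled (l := [.del x]) (fun h => nomatch h) (fun h => nomatch h) ⟨?_, ?_, ?_⟩ ?_
  · simpa [Summand.Over] using hx
  · simp [Summand.val]
  · simp [Summand.obs, Model.delay]
  · intro k hk; simp at hk

theorem Faithful.add (hx : Faithful x m) (hy : Faithful y m') : Faithful (x + y) (m ∪ m') where
  mem_K := K.add hx.mem_K hy.mem_K
  now_of_raw := Or.imp hx.now_of_raw hy.now_of_raw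
  late_of_now := Or.imp hx.late_of_now hy.late_of_now
  splits h := by
    obtain ⟨k, hk, o, ho, rfl, hd⟩ := hx.splits fun h' => h (.inl h')
    obtain ⟨k', hk', o', ho', rfl, hd'⟩ := hy.splits fun h' => h (.inr h')
    refine ⟨k + k', K.add hk hk', ?_⟩
    cases o with
    | none => exact ⟨o', ho', by simp [odl, to_add, add_assoc], fun h => .inr (hd' h)⟩
    | some z =>
      cases o' with
      | none =>
        exact ⟨some z, ho, by simp [odl, to_add, add_assoc, add_comm], fun h => .inl (hd h)⟩
      | some z' =>
        refine ⟨some (z + z'), ?_, ?_, fun _ => .inl (hd (by simp))⟩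
        · simpa using K.add (ho z rfl) (ho' z' rfl)
        · simp only [odl, to_add, ← dl_add]; exact add_add_add_comm _ _ _ _
  hnf h := by
    obtain ⟨l, h1, h2, h3⟩ := hx.hnf fun h' => h (.inl h')
    obtain ⟨l', h1', h2', h3'⟩ := hy.hnf fun h' => h (.inr h')
    refine ⟨l ++ l', fun s hs => ?_, by rw [h2, h2', sumOf_append], fun s hs => ?_⟩
    · exact (List.mem_append.1 hs).elim (h1 s) (h1' s)
    · exact (List.mem_append.1 hs).elim (fun hs => (h3 s hs).trans Set.subset_union_left)
        (fun hs => (h3' s hs).trans Set.subset_union_right)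
  settled h := by
    obtain ⟨l, ⟨h1, h2, h3⟩, h4⟩ := hx.settled fun h' => h (.inl h')
    obtain ⟨l', ⟨h1', h2', h3'⟩, h4'⟩ := hy.settled fun h' => h (.inr h')
    refine ⟨l ++ l', ⟨fun s hs => ?_, by rw [h2, h2', sumOf_append], fun s hs => ?_⟩, fun k hk => ?_⟩
    · exact (List.mem_append.1 hs).elim (h1 s) (h1' s)
    · exact (List.mem_append.1 hs).elim (fun hs => (h3 s hs).trans Set.subset_union_left)
        (fun hs => (h3' s hs).trans Set.subset_union_right)
    · exact (List.mem_append.1 hk).elim (fun hk => (h4 k hk).mono .inl)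
        (fun hk => (h4' k hk).mono .inr)

theorem HNF.mul (hx : HNF x m l) (hy : y ∈ K γ True) :
    HNF (x * y) (Model.seq m m') (l.map (Summand.mulRight y)) := by
  refine ⟨?_, by rw [hx.2.1, sumOf_mul], ?_⟩
  · simp only [List.mem_map, forall_exists_index, and_imp]
    rintro _ s hs rfl
    exact (hx.1 s hs).mulRight hy
  · simp only [List.mem_map, forall_exists_index, and_imp]
    rintro _ s hs rfl
    cases s with
    | fin b =>
      rintro _ (rfl | rfl)
      · exact hx.hd_mem (.inl hs)
      · exact .inl ⟨hx.part_mem (.inl hs), nofun⟩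
    | pre b k =>
      rintro _ (rfl | rfl)
      · exact hx.hd_mem (.inr ⟨k, hs⟩)
      · exact .inl ⟨hx.part_mem (.inr ⟨k, hs⟩), nofun⟩
    | del k => rintro _ rfl; exact hx.del_mem hs

theorem Faithful.mul (hx : Faithful x m) (hy : Faithful y m') :
    Faithful (x * y) (Model.seq m m') where
  mem_K := K.mul hx.mem_K hy.mem_K
  now_of_raw := hx.now_of_raw
  late_of_now h := .inl ⟨hx.late_of_now h, nofun⟩
  splits h := by
    obtain ⟨k, hk, o, ho, rfl, hd⟩ := hx.splits h
    refine ⟨k * y, K.mul hk hy.mem_K, o.map (· * y), ?_, ?_, fun h => hd (by simpa using h)⟩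
    · simp only [Option.mem_def, Option.map_eq_some_iff, forall_exists_index, and_imp]
      rintro _ z hz rfl
      exact K.mul (ho z hz) hy.mem_K
    · rw [Proc.add_mul, to_mul]
      cases o
      · simp [odl, Proc.zero_mul]
      · simp [odl, dl_mul]
  hnf h := by
    obtain ⟨l, hl⟩ := hx.hnf h
    exact ⟨_, hl.mul hy.mem_K⟩
  settled h := by
    obtain ⟨l, hl, hs⟩ := hx.settled fun h' => h (.inl ⟨h', nofun⟩)
    refine ⟨_, hl.mul hy.mem_K, fun k hk => ?_⟩
    -- If `x` can terminate silently, then unknown behaviour of `y` after a silent step would show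
    -- up as `late` in the product; so `y` is resolved exactly where this is needed.
    have key : silent ∈ m → Res True (silent ∈ Model.seq m m') y := fun hm =>
      (hy.res fun h' => h (.inr ⟨[], [], rfl, hm, .inr (.inr (.inl h'))⟩)).mono fun hm' =>
        .inr ⟨[], [], rfl, hm, .inr (.inr (.inl hm'))⟩
    obtain ⟨s, hsl, hk⟩ := List.mem_map.1 hk
    cases s <;> simp only [Summand.mulRight, Summand.pre.injEq, reduceCtorEq] at hk
    · obtain ⟨rfl, rfl⟩ := hk
      exact key (hl.term_mem hsl)
    · obtain ⟨rfl, rfl⟩ := hk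
      exact (hs _ hsl).mul hy.mem_K key

theorem HNF.tmo (hx : HNF x m l) : HNF (tmo x) (Model.timeout m) (l.filterMap Summand.tmo) := by
  refine ⟨?_, by rw [hx.2.1, tmo_sumOf], ?_⟩
  · simp only [List.mem_filterMap, forall_exists_index, and_imp]
    intro s' s hs h
    have := hx.1 s hs
    cases s <;> cases h
    · trivial
    · exact this
  · simp only [List.mem_filterMap, forall_exists_index, and_imp]
    intro s' s hs h
    have := hx.2.2 s hs
    cases s <;> cases h
    · rintro _ (rfl | rfl | rfl) <;> exact this (by simp [Summand.obs])
    · rintro _ (rfl | rfl) <;> exact this (by simp [Summand.obs])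

theorem Faithful.tmo (hx : Faithful x m) : Faithful (tmo x) (Model.timeout m) where
  mem_K := K.tmo hx.mem_K
  now_of_raw h := h.elim
  late_of_now h := hx.late_of_now (h.elim hx.now_of_raw id)
  splits _ := ⟨x, hx.mem_K, none, by simp, by simp [odl], by simp⟩
  hnf h := by
    obtain ⟨l, hl⟩ := hx.hnf fun h' => h (.inr h')
    exact ⟨_, hl.tmo⟩
  settled h := by
    obtain ⟨l, hl, hs⟩ := hx.settled h
    refine ⟨_, hl.tmo, fun k hk => ?_⟩
    obtain ⟨s, hsl, hk⟩ := List.mem_filterMap.1 hk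
    cases s <;> cases hk
    exact hs _ hsl

theorem HNF.enc (H : Set A) (hx : HNF x m l) :
    HNF (enc H x) (Model.encap H m) (l.filterMap (Summand.enc H)) := by
  refine ⟨?_, by rw [hx.2.1, enc_sumOf], ?_⟩
  · simp only [List.mem_filterMap, forall_exists_index, and_imp]
    exact fun s' s hs h => (hx.1 s hs).enc h
  · simp only [List.mem_filterMap, forall_exists_index, and_imp]
    intro s' s hs h
    have := hx.2.2 s hs
    cases s with
    | fin b =>
      simp only [Summand.enc, Option.ite_none_left_eq_some, Option.some.injEq] at h
      obtain ⟨hb, rfl⟩ := h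
      rintro _ (rfl | rfl | rfl)
      · exact ⟨hb, this (.inl rfl)⟩
      · exact ⟨hb, by simp, this (.inr (.inl rfl))⟩
      · exact ⟨hb, by simp, this (.inr (.inr rfl))⟩
    | pre b k =>
      simp only [Summand.enc, Option.ite_none_left_eq_some, Option.some.injEq] at h
      obtain ⟨hb, rfl⟩ := h
      rintro _ (rfl | rfl)
      · exact ⟨hb, this (.inl rfl)⟩
      · exact ⟨hb, by simp, this (.inr rfl)⟩
    | del k =>
      cases h
      rintro _ rfl
      exact hx.del_mem hs

theorem mem_encap_none {H : Set A} {s : St} :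
    tr none [] s ∈ Model.encap H m ↔ tr none [] s ∈ m := by
  simp [Model.encap, exec]

theorem Faithful.enc (H : Set A) (hx : Faithful x m) : Faithful (enc H x) (Model.encap H m) where
  mem_K := K.enc H hx.mem_K
  now_of_raw h := h
  late_of_now h := mem_encap_none.2 (hx.late_of_now (h.elim hx.now_of_raw id))
  splits h := by
    obtain ⟨l, hl⟩ := hx.hnf fun h' => h (.inr h')
    exact (hl.enc H).splits
  hnf h := by
    obtain ⟨l, hl⟩ := hx.hnf fun h' => h (.inr h')
    exact ⟨_, hl.enc H⟩
  settled h := by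
    obtain ⟨l, hl, hs⟩ := hx.settled fun h' => h (mem_encap_none.2 h')
    refine ⟨_, hl.enc H, fun k hk => ?_⟩
    obtain ⟨s, hsl, hk⟩ := List.mem_filterMap.1 hk
    cases s <;> simp [Summand.enc] at hk
    obtain ⟨-, rfl, rfl⟩ := hk
    exact ((hs _ hsl).enc H).mono mem_encap_none.2

theorem HNF.lm (hx : HNF x m l) (hy : Faithful y m') (h : ¬Model.LCond m m') :
    ∃ o, HNF (lm x y) (Model.lmerge γ m m') (l.filterMap (Summand.lm y o)) := by
  obtain ⟨k, o, ho, hyo, hd⟩ : ∃ (k : Proc γ) (o : Option (Proc γ)), (∀ z ∈ o, z ∈ K γ True) ∧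
      (∀ z, .del z ∈ l → y = Proc.tmo k + odl o) ∧ (o ≠ none → del ∈ m') := by
    by_cases hdel : del ∈ m
    · obtain ⟨k, -, o, ho, hy, hd⟩ := hy.splits fun h' => h (.inr (.inr ⟨hdel, h'⟩))
      exact ⟨k, o, ho, fun _ _ => hy, hd⟩
    -- There is no delayed summand in `l`, so the condition on `y` is vacuous and deadlock serves as
    -- a dummy.
    · exact ⟨0, none, by simp, fun z hz => (hdel (hx.del_mem hz)).elim, by simp⟩
  refine ⟨o, ?_, by rw [hx.2.1, lm_sumOf hyo], ?_⟩
  · simp only [List.mem_filterMap, forall_exists_index, and_imp]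
    exact fun s' s hs h => (hx.1 s hs).lm hy.mem_K ho h
  · simp only [List.mem_filterMap, forall_exists_index, and_imp]
    intro s' s hs h
    have hpart : ∀ b, tr b [] part ∈ m → tr b [] part ∈ Model.lmerge γ m m' := fun b hb =>
      .inr ⟨[], part, [], part, hb, Model.NT_nil_part _, .nil, .part⟩
    cases s with
    | fin b =>
      cases h
      rintro _ (rfl | rfl)
      · exact hx.hd_mem (.inl hs)
      · exact hpart b (hx.part_mem (.inl hs))
    | pre b k =>
      cases h
      rintro _ (rfl | rfl)
      · exact hx.hd_mem (.inr ⟨k, hs⟩)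
      · exact hpart b (hx.part_mem (.inr ⟨k, hs⟩))
    | del k =>
      simp only [Summand.lm, Option.map_eq_some_iff] at h
      obtain ⟨z, rfl, rfl⟩ := h
      rintro _ rfl
      exact ⟨hx.del_mem hs, hd (by simp)⟩

theorem Faithful.lm (hγ : Visible γ) (hx : Faithful x m) (hy : Faithful y m') :
    Faithful (lm x y) (Model.lmerge γ m m') := by
  have hnow : ¬Model.LCond m m' → now ∉ m := fun h h' => h (.inr (.inl h'))
  have hlate : ∀ s s', tr none [] s ∈ m → Model.NT m' [] s' → ∀ r, Join s s' r →
      tr none [] r ∈ Model.lmerge γ m m' := fun s s' h h' r hj =>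
    .inr ⟨[], s, [], s', h, h', .nil, hj⟩
  refine ⟨K.lm hx.mem_K hy.mem_K, id, fun h => .inl ⟨h, rfl, rfl, rfl⟩, fun h => ?_, fun h => ?_,
    fun h => ?_⟩
  · obtain ⟨l, hl⟩ := hx.hnf (hnow h)
    obtain ⟨o, ho⟩ := hl.lm hy h
    exact ho.splits
  · obtain ⟨l, hl⟩ := hx.hnf (hnow h)
    obtain ⟨o, ho⟩ := hl.lm hy h
    exact ⟨_, ho⟩
  · obtain ⟨l, hl, hs⟩ := hx.settled fun h' =>
      h (hlate unk part h' (Model.NT_nil_part _) unk (.left _))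
    obtain ⟨o, ho⟩ := hl.lm hy fun h' => h (.inl ⟨h', rfl, rfl, rfl⟩)
    refine ⟨_, ho, fun k hk => ?_⟩
    -- A silent step of `x`, witnessed by an unfinished trace, merges with `late` of `y` into
    -- `late`; so `y` must be resolved.
    have key : tr none [] part ∈ m → Res True (silent ∈ m') y := fun hm =>
      hy.res fun h' => h (hlate part unk hm (.inr (.inr (.inl h'))) unk (.right _))
    have hsil : silent ∈ m ∧ silent ∈ m' → silent ∈ Model.lmerge γ m m' := fun h' =>
      hlate term term h'.1 (.inr (.inr (.inl h'.2))) term .term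
    obtain ⟨s, hsl, hk⟩ := List.mem_filterMap.1 hk
    obtain ⟨rfl, rfl⟩ | ⟨k', rfl, rfl⟩ := Summand.lm_eq_pre hk
    · exact (key (hl.part_mem (.inl hsl))).mono fun h' => hsil ⟨hl.term_mem hsl, h'⟩
    · exact ((hs _ hsl).par hγ (key (hl.part_mem (.inr ⟨_, hsl⟩)))).1.mono hsil

theorem HNF.eq_del (hx : HNF x m l) (h : ¬∃ b, hd b ∈ m) {s : Summand γ} (hs : s ∈ l) :
    ∃ k, s = .del k := by
  cases s with
  | fin b => exact (h ⟨b, hx.hd_mem (.inl hs)⟩).elim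
  | pre b k => exact (h ⟨b, hx.hd_mem (.inr ⟨k, hs⟩)⟩).elim
  | del k => exact ⟨k, rfl⟩

theorem HNF.cm (hγ : Visible γ) {l' : List (Summand γ)} (hx : HNF x m l) (hy : HNF y m' l') :
    HNF (cm x y) (Model.cmerge γ m m') (l.flatMap fun s => l'.filterMap s.cm) := by
  refine ⟨?_, by rw [hx.2.1, hy.2.1, sumOf_cm_sumOf], ?_⟩
  · simp only [List.mem_flatMap, List.mem_filterMap]
    rintro _ ⟨s, hs, s', hs', h⟩
    exact (hx.1 s hs).cm (hy.1 s' hs') h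
  · simp only [List.mem_flatMap, List.mem_filterMap]
    rintro r ⟨s, hs, s', hs', h⟩
    have hact : ∀ {b b' c : Option A}, γ.comm (exec b) (exec b') = exec c →
        ∃ a a' e, b = some a ∧ b' = some a' ∧ c = some e ∧
          γ.comm (.act a) (.act a') = .act e := by
      intro b b' c hc
      cases c with
      | none => exact (hγ.exec _ _ hc).elim
      | some e =>
        obtain ⟨⟨a, ha⟩, ⟨a', ha'⟩⟩ := Model.comm_eq_act hc
        cases b <;> cases ha
        cases b' <;> cases ha'
        exact ⟨a, a', e, rfl, rfl, rfl, hc⟩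
    have hhd : ∀ {b b' c : Option A}, γ.comm (exec b) (exec b') = exec c → hd b ∈ m →
        hd b' ∈ m' → hd c ∈ Model.cmerge γ m m' := by
      intro b b' c hc h1 h2
      obtain ⟨a, a', e, rfl, rfl, rfl, hc⟩ := hact hc
      exact ⟨a, a', e, rfl, h1, h2, hc⟩
    have htr : ∀ {b b' c : Option A} {s : St}, γ.comm (exec b) (exec b') = exec c →
        tr b [] s ∈ m → tr b' [] s ∈ m' → Join s s s → tr c [] s ∈ Model.cmerge γ m m' := by
      intro b b' c s hc h1 h2 hj
      obtain ⟨a, a', e, rfl, rfl, rfl, hc⟩ := hact hc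
      exact .inr ⟨a, a', e, rfl, hc, [], s, [], s, h1, h2, .nil, hj⟩
    cases s with
    | fin b =>
      cases s' with
      | fin b' =>
        simp only [Summand.cm, Option.map_eq_some_iff, Atom.exec?_eq_some] at h
        obtain ⟨c, hc, rfl⟩ := h
        rintro _ (rfl | rfl | rfl)
        · exact hhd hc (hx.hd_mem (.inl hs)) (hy.hd_mem (.inl hs'))
        · exact htr hc (hx.part_mem (.inl hs)) (hy.part_mem (.inl hs')) .part
        · exact htr hc (hx.term_mem hs) (hy.term_mem hs') .term
      | pre b' k' =>
        simp only [Summand.cm, Option.map_eq_some_iff, Atom.exec?_eq_some] at h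
        obtain ⟨c, hc, rfl⟩ := h
        rintro _ (rfl | rfl)
        · exact hhd hc (hx.hd_mem (.inl hs)) (hy.hd_mem (.inr ⟨_, hs'⟩))
        · exact htr hc (hx.part_mem (.inl hs)) (hy.part_mem (.inr ⟨_, hs'⟩)) .part
      | del k' => cases h
    | pre b k =>
      cases s' with
      | fin b' =>
        simp only [Summand.cm, Option.map_eq_some_iff, Atom.exec?_eq_some] at h
        obtain ⟨c, hc, rfl⟩ := h
        rintro _ (rfl | rfl)
        · exact hhd hc (hx.hd_mem (.inr ⟨_, hs⟩)) (hy.hd_mem (.inl hs'))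
        · exact htr hc (hx.part_mem (.inr ⟨_, hs⟩)) (hy.part_mem (.inl hs')) .part
      | pre b' k' =>
        simp only [Summand.cm, Option.map_eq_some_iff, Atom.exec?_eq_some] at h
        obtain ⟨c, hc, rfl⟩ := h
        rintro _ (rfl | rfl)
        · exact hhd hc (hx.hd_mem (.inr ⟨_, hs⟩)) (hy.hd_mem (.inr ⟨_, hs'⟩))
        · exact htr hc (hx.part_mem (.inr ⟨_, hs⟩)) (hy.part_mem (.inr ⟨_, hs'⟩)) .part
      | del k' => cases h
    | del k =>
      cases s' with
      | fin b' => cases h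
      | pre b' k' => cases h
      | del k' =>
        cases h
        rintro _ rfl
        exact ⟨hx.del_mem hs, hy.del_mem hs'⟩

theorem odl_cm_zero (o : Option (Proc γ)) : Proc.cm (odl o) 0 = 0 := by
  cases o with
  | none => exact zero_cm_sumOf []
  | some m => exact dl_cm_zero m

theorem zero_cm_odl (o : Option (Proc γ)) : Proc.cm 0 (odl o) = 0 := by
  cases o with
  | none => exact zero_cm_sumOf []
  | some m => exact zero_cm_dl m

/-- When `CCond` fails, at most one argument carries `now`. That argument is still split, and the
other has delayed summands only; these give deadlock with the current part, so that only delayed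
parts communicate. If neither carries `now`, head normal forms are combined directly. The result has
no silent prefixes in any case, so that settling is vacuous. -/
theorem Faithful.cm_settled (hγ : Visible γ) (hx : Faithful x m) (hy : Faithful y m')
    (h : ¬Model.CCond m m') :
    ∃ l, HNF (cm x y) (Model.cmerge γ m m') l ∧ Settles (Model.cmerge γ m m') l := by
  simp only [Model.CCond, not_or, not_and] at h
  obtain ⟨h1, h2, h3, h4, h5⟩ := h
  by_cases hm : now ∈ m
  · obtain ⟨k, -, o, ho, rfl, hd⟩ := hx.splits h1
    obtain ⟨l', hl'⟩ := hy.hnf (h3 hm)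
    have hdel := fun {s} => hl'.eq_del (h4 hm) (s := s)
    let f : Summand γ → Option (Summand γ) := fun s => match s with
      | .del z => o.map fun w => .del (Proc.cm w z)
      | _ => none
    have hf : ∀ s ∈ l', ∀ s', f s = some s' → ∃ w z, o = some w ∧ .del z ∈ l' ∧
        s' = .del (Proc.cm w z) := by
      intro s hs s' h
      obtain ⟨z, rfl⟩ := hdel hs
      obtain ⟨w, hw, rfl⟩ := Option.map_eq_some_iff.1 h
      exact ⟨w, z, hw, hs, rfl⟩
    refine ⟨l'.filterMap f, ⟨?_, ?_, ?_⟩, ?_⟩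
    · simp only [List.mem_filterMap]
      rintro s' ⟨s, hs, h⟩
      obtain ⟨w, z, rfl, hz, rfl⟩ := hf s hs s' h
      exact K.cm (ho w rfl) (hl'.1 _ hz)
    · rw [hl'.2.1]
      refine map_sumOf _ ?_ (cm_add _) f fun s hs => ?_
      · rw [add_cm, tmo_cm_zero, odl_cm_zero, add_zero]
      · obtain ⟨z, rfl⟩ := hdel hs
        rw [add_cm]
        simp only [Summand.val]
        rw [to_cm_dl, zero_add]
        cases o with
        | none => exact zero_cm_dl z
        | some w => exact dl_cm_dl w z
    · simp only [List.mem_filterMap]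
      rintro s' ⟨s, hs, h⟩
      obtain ⟨w, z, rfl, hz, rfl⟩ := hf s hs s' h
      rintro _ rfl
      exact ⟨hd (by simp), hl'.del_mem hz⟩
    · intro k hk
      obtain ⟨s, hs, h⟩ := List.mem_filterMap.1 hk
      obtain ⟨w, z, -, -, h⟩ := hf s hs _ h
      cases h
  · obtain ⟨l, hl⟩ := hx.hnf hm
    by_cases hm' : now ∈ m'
    · obtain ⟨k, -, o, ho, rfl, hd⟩ := hy.splits h2
      have hdel := fun {s} => hl.eq_del (fun h => h5 h hm') (s := s)
      let f : Summand γ → Option (Summand γ) := fun s => match s with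
        | .del z => o.map fun w => .del (Proc.cm z w)
        | _ => none
      have hf : ∀ s ∈ l, ∀ s', f s = some s' → ∃ w z, o = some w ∧ .del z ∈ l ∧
          s' = .del (Proc.cm z w) := by
        intro s hs s' h
        obtain ⟨z, rfl⟩ := hdel hs
        obtain ⟨w, hw, rfl⟩ := Option.map_eq_some_iff.1 h
        exact ⟨w, z, hw, hs, rfl⟩
      refine ⟨l.filterMap f, ⟨?_, ?_, ?_⟩, ?_⟩
      · simp only [List.mem_filterMap]
        rintro s' ⟨s, hs, h⟩
        obtain ⟨w, z, rfl, hz, rfl⟩ := hf s hs s' h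
        exact K.cm (hl.1 _ hz) (ho w rfl)
      · rw [hl.2.1]
        refine map_sumOf (Proc.cm · (Proc.tmo k + odl o)) ?_ (add_cm · · _) f fun s hs => ?_
        · rw [cm_add, zero_cm_tmo, zero_cm_odl, add_zero]
        · obtain ⟨z, rfl⟩ := hdel hs
          rw [cm_add]
          simp only [Summand.val]
          rw [dl_cm_to, zero_add]
          cases o with
          | none => exact dl_cm_zero z
          | some w => exact dl_cm_dl z w
      · simp only [List.mem_filterMap]
        rintro s' ⟨s, hs, h⟩
        obtain ⟨w, z, rfl, hz, rfl⟩ := hf s hs s' h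
        rintro _ rfl
        exact ⟨hl.del_mem hz, hd (by simp)⟩
      · intro k hk
        obtain ⟨s, hs, h⟩ := List.mem_filterMap.1 hk
        obtain ⟨w, z, -, -, h⟩ := hf s hs _ h
        cases h
    · obtain ⟨l', hl'⟩ := hy.hnf hm'
      refine ⟨_, hl.cm hγ hl', fun k hk => ?_⟩
      simp only [List.mem_flatMap, List.mem_filterMap] at hk
      obtain ⟨s, hs, s', hs', h⟩ := hk
      exact (Summand.cm_ne_pre hγ h).elim

theorem Faithful.cm (hγ : Visible γ) (hx : Faithful x m) (hy : Faithful y m') :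
    Faithful (cm x y) (Model.cmerge γ m m') := by
  refine ⟨K.cm hx.mem_K hy.mem_K, id, fun h => .inl ⟨h, rfl, rfl, rfl⟩, fun h => ?_, fun h => ?_,
    fun h => ?_⟩
  · obtain ⟨l, hl, -⟩ := hx.cm_settled hγ hy h
    exact hl.splits
  · obtain ⟨l, hl, -⟩ := hx.cm_settled hγ hy h
    exact ⟨l, hl⟩
  · exact hx.cm_settled hγ hy fun h' => h (.inl ⟨h', rfl, rfl, rfl⟩)

theorem Faithful.par (hγ : Visible γ) (hx : Faithful x m) (hy : Faithful y m') :
    Faithful (par x y) (Model.par γ m m') := by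
  rw [par_eq]
  exact ((hx.lm hγ hy).add (hy.lm hγ hx)).add (hx.cm hγ hy)

/-- Abstraction has to be excluded: it could turn an infinite chain of visible steps into an
infinite silent one. -/
theorem Faithful.pev (hγ : Visible γ) {C : (V : Set ℕ) → (V → Term A) → Prop}
    (hC : ∀ V E, C V E → (∀ j, (E j).AbstrFree) → ∀ X,
      Faithful (cls γ (recur V E X)) ((recOp γ V E).lfp X))
    {ρ : ℕ → Proc γ} {S : ℕ → Set (Obs A)} (hρ : ∀ x, Faithful (ρ x) (S x)) :
    ∀ {t : Term A}, t.IsOver .acp C → t.AbstrFree → Faithful (pev ρ t) (ev γ t S)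
  | var x, _, _ => hρ x
  | atom a, _, _ => .at' a
  | alt _ _, h, h' => (Faithful.pev hγ hC hρ h.1 h'.1).add (Faithful.pev hγ hC hρ h.2 h'.2)
  | seq _ _, h, h' => (Faithful.pev hγ hC hρ h.1 h'.1).mul (Faithful.pev hγ hC hρ h.2 h'.2)
  | delay t, h, h' => .dl (Faithful.pev hγ hC hρ (t := t) h h').mem_K
  | .par _ _, h, h' =>
    (Faithful.pev hγ hC hρ h.2.1 h'.1).par hγ (Faithful.pev hγ hC hρ h.2.2 h'.2)
  | lmerge _ _, h, h' =>
    (Faithful.pev hγ hC hρ h.2.1 h'.1).lm hγ (Faithful.pev hγ hC hρ h.2.2 h'.2)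
  | cmerge _ _, h, h' =>
    (Faithful.pev hγ hC hρ h.2.1 h'.1).cm hγ (Faithful.pev hγ hC hρ h.2.2 h'.2)
  | encap H t, h, h' => (Faithful.pev hγ hC hρ (t := t) h.2 h').enc H
  | timeout t, h, h' => (Faithful.pev hγ hC hρ (t := t) h h').tmo
  | recur V E X, h, h' => by
    rw [ev_recur]
    exact hC V E h h' X

theorem recVal_of_mem {V : Set ℕ} {E : V → Term A} (X : V) :
    recVal γ V E X = cls γ (recur V E X) := by
  simp [recVal]

theorem recVal_mem_K {b : Prop} {V : Set ℕ} {E : V → Term A} (h : IsRec γ .acp V E)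
    (hE : b → ∀ j, (E j).AbstrFree) (x : ℕ) : recVal γ V E x ∈ K γ b := by
  by_cases hx : x ∈ V
  · rw [recVal_of_mem ⟨x, hx⟩]; exact K.recur h hE _
  · rw [recVal, dif_neg hx]; exact K.zero

/-- The recursion constants without abstraction have head normal forms in which chains of silent
steps are well-founded. -/
theorem Faithful.recur (hγ : Visible γ) (n : ℕ) : ∀ (V : Set ℕ) (E : V → Term A),
    RecLevel γ .acp n V E → (∀ j, (E j).AbstrFree) → ∀ X,
      Faithful (cls γ (recur V E X)) ((recOp γ V E).lfp X) := by
  induction n with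
  | zero => exact fun _ _ h => h.elim
  | succ n ih =>
    rintro V E (h | ⟨hspec, hguard⟩) hE X
    · exact ih V E h hE X
    have hrec : IsRec γ .acp V E := ⟨n + 1, .inr ⟨hspec, hguard⟩⟩
    set F := recOp γ V E with hF
    have hknown : ∀ x, Model.Known (F.lfp x) := by
      intro x
      by_cases hx : x ∈ V
      · have := known_ev (γ := γ) (Term.recur V E ⟨x, hx⟩) (ρ := fun _ => ∅) (fun _ _ h => h.elim)
        rwa [ev_recur] at this
      · rw [← F.map_lfp]
        rintro o ⟨hx', -⟩
        exact (hx hx').elim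
    set v := recVal γ V E with hv
    let SP : ℕ → Prop := fun x => Splits (v x) (F.lfp x)
    let HN : ℕ → Prop := fun x => ∃ l, HNF (v x) (F.lfp x) l
    let SE : ℕ → Prop := fun x => ∃ l, HNF (v x) (F.lfp x) l ∧ Settles (F.lfp x) l
    have hSH : ∀ {x}, SE x → HN x := fun ⟨l, h, _⟩ => ⟨l, h⟩
    have hHS : ∀ {x}, HN x → SP x := fun ⟨_, h⟩ => h.splits
    -- The least solution, with a mark wherever the corresponding property fails. The properties
    -- refer to the least solution itself, so the definition of `S` is not circular.
    let S : ℕ → Set (Obs A) := fun x => F.lfp x ∪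
      {o | (o = raw ∧ ¬SP x) ∨ (o = now ∧ ¬HN x) ∨ (o = late ∧ ¬SE x)}
    have hlS : F.lfp ≤ S := fun x => Set.subset_union_left
    have hSl : ∀ x, Model.Le (fun _ => True) False (S x) (F.lfp x) := by
      rintro x o (ho | ⟨rfl, -⟩ | ⟨rfl, -⟩ | ⟨rfl, -⟩) - h'
      · exact ho
      · exact (h' trivial).elim
      · exact (h' trivial).elim
      · exact (h' rfl).elim
    have hfaith : ∀ x, Faithful (v x) (S x) := by
      intro x
      have hm : ∀ o ∈ F.lfp x, ¬Model.Unk o → o ∈ S x := fun o ho _ => .inl ho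
      refine ⟨recVal_mem_K hrec (fun _ => hE) x, ?_, ?_, fun h => ?_, fun h => ?_, fun h => ?_⟩
      · rintro (h | ⟨-, h⟩ | ⟨h, -⟩ | ⟨h, -⟩)
        · exact (hknown x _ h trivial).elim
        · exact .inr (.inr (.inl ⟨rfl, fun h' => h (hHS h')⟩))
        · cases h
        · cases h
      · rintro (h | ⟨h, -⟩ | ⟨-, h⟩ | ⟨h, -⟩)
        · exact (hknown x _ h trivial).elim
        · cases h
        · exact .inr (.inr (.inr ⟨rfl, fun h' => h (hSH h')⟩))
        · cases h
      · exact (not_not.1 fun h' => h (.inr (.inl ⟨rfl, h'⟩)) : SP x).mono hm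
      · obtain ⟨l, hl⟩ : HN x := not_not.1 fun h' => h (.inr (.inr (.inl ⟨rfl, h'⟩)))
        exact ⟨l, hl.mono hm⟩
      · obtain ⟨l, hl, hs⟩ : SE x := not_not.1 fun h' => h (.inr (.inr (.inr ⟨rfl, h'⟩)))
        exact ⟨l, hl.mono hm, hs.mono fun h => .inl h⟩
    -- If a mark were missing from the value of the right-hand side at `S`, faithfulness of that
    -- value would supply the very property whose failure put the mark into `S`.
    have hpost : S ≤ F S := by
      intro x o ho
      by_cases hx : x ∈ V
      · have hval : Proc.pev v (E ⟨x, hx⟩) = v x := by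
          rw [hv, recVal_of_mem ⟨x, hx⟩, cls_recur hrec]
        have hf := Faithful.pev hγ ih hfaith (hspec ⟨x, hx⟩).1 (hE ⟨x, hx⟩)
        rw [hval] at hf
        -- The marks create no known observations, so what is witnessed at `S` is witnessed in the
        -- least solution.
        have hm : ∀ o ∈ ev γ (E ⟨x, hx⟩) S, ¬Model.Unk o → o ∈ F.lfp x := by
          intro o ho hU
          rw [← ev_of_fixed F.map_lfp ⟨x, hx⟩]
          exact le_ev (fun _ _ _ _ => trivial) hSl (.inr fun _ => trivial) o ho trivial hU
        rw [hF, recOp_apply hx]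
        obtain ho | ⟨rfl, h⟩ | ⟨rfl, h⟩ | ⟨rfl, h⟩ := ho
        · rw [← ev_of_fixed F.map_lfp ⟨x, hx⟩] at ho
          exact ev_mono hlS _ ho
        · exact not_not.1 fun h' => h ((hf.splits h').mono hm)
        · refine not_not.1 fun h' => h ?_
          obtain ⟨l, hl⟩ := hf.hnf h'
          exact ⟨l, hl.mono hm⟩
        · refine not_not.1 fun h' => h ?_
          obtain ⟨l, hl, hs⟩ := hf.settled h'
          exact ⟨l, hl.mono hm, hs.mono fun h => hm _ h nofun⟩
      · have hx0 : v x = 0 := by rw [hv, recVal, dif_neg hx]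
        have hSE : SE x := by
          refine ⟨[], ⟨by simp, hx0, by simp⟩, fun _ h => nomatch h⟩
        obtain ho | ⟨rfl, h⟩ | ⟨rfl, h⟩ | ⟨rfl, h⟩ := ho
        · rw [← F.map_lfp] at ho
          obtain ⟨hx', -⟩ := ho
          exact (hx hx').elim
        · exact (h (hHS (hSH hSE))).elim
        · exact (h (hSH hSE)).elim
        · exact (h hSE).elim
    -- Coinduction, followed by uniqueness of solutions: all marks lie in the least solution, which
    -- contains none.
    have hle : S ≤ F.lfp := (F.le_gfp hpost).trans (GuardedModulo.gfp_le_lfp hγ hguard)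
    have hres := (hfaith X).settled fun h => hknown X _ (hle X h) rfl
    rw [hv, recVal_of_mem X] at hres
    obtain ⟨l, hl, hs⟩ := hres
    refine .of_settled (fun h => (hknown X _ h trivial).elim) (fun h => (hknown X _ h trivial).elim)
      (hl.mono fun o ho _ => hle X ho) (hs.mono fun h => hle X h)

/-- If communication is visible, then terms without abstraction are resolved. -/
theorem res_of_visible (hγ : Visible γ) (hx : x ∈ K γ True) : Res True True x := by
  obtain ⟨t, ht, hfree, rfl⟩ := hx
  have hf := Faithful.pev (C := IsRec γ .acp) hγ
    (fun V E ⟨n, h⟩ hE X => Faithful.recur hγ n V E h hE X) (fun _ => Faithful.zero) ht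
    (hfree trivial)
  exact (hf.res fun h => known_ev t (fun _ _ h => h.elim) _ h rfl).mono fun _ => trivial

end Proc

namespace Proc

variable {γ : Communication A} {x y : Proc γ}

/-! ### Silent communication

If a communication of two basic actions is silent, then `τ ⬝ X` equals a term in which `X` is
guarded, and all processes that start with a silent step are equal. -/

theorem isRec_of_guarded {T : Theory} {V : Set ℕ} {E : V → Term A}
    (h : IsRecSpec (IsOver T fun _ _ => False) V E) (h' : ∀ i, (E i).Guarded) : IsRec γ T V E :=
  ⟨1, .inr ⟨h, fun i => ⟨E i, .refl, h' i⟩⟩⟩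

/-- Every `z` with `τ·z = z` solves the guarded equation `X = a·X ∣ b`, because `a·z ∣ b =
γ(a,b)·z`. By RSP all such `z` coincide, and both `τ·x` and `τ` are among them since `τ·τ = τ`. -/
theorem tau_mul_of_silent {a b : A} (hab : γ.comm (.act a) (.act b) = .tau) (x : Proc γ) :
    at' .tau * x = at' .tau := by
  let E : ({0} : Set ℕ) → Term A := fun _ => cmerge (seq (atom (.act a)) (var 0)) (atom (.act b))
  have hE : IsRec γ .acp {0} E :=
    isRec_of_guarded (fun i => ⟨⟨rfl, ⟨trivial, trivial⟩, trivial⟩, by simp [E, vars]⟩)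
      fun i => .inr ⟨⟨⟨trivial, trivial⟩, trivial⟩, ⟨⟨trivial, .inl ⟨a, rfl⟩⟩, trivial⟩⟩
  have key : ∀ z : Proc γ, at' .tau * z = z → z = cls γ (recur {0} E ⟨0, rfl⟩) := by
    intro z hz
    obtain ⟨p, hp, rfl⟩ := exists_cls z
    refine (cls_eq (t := recur {0} E ⟨0, rfl⟩) hp hE).2
      (.rsp {0} E hE (fun _ => p) (fun _ => hp) (fun j => ?_) ⟨0, rfl⟩)
    have hj : IsTerm γ .acp (E j) := (hE.spec j).1
    rw [← cls_eq hp (Term.IsOver.subst hj fun _ _ => hp), cls_subst hj fun _ => hp]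
    change _ = cm (at' (.act a) * cls γ p) (at' (.act b))
    rw [cm5, cm_at, hab, hz]
  rw [key (at' .tau * x) (by rw [← Proc.mul_assoc, at_mul_tau]), ← key _ (at_mul_tau _)]

/-- `x` has a head normal form. -/
def HasHNF (x : Proc γ) : Prop := ∃ l : List (Summand γ), (∀ s ∈ l, s.Over False) ∧ x = sumOf l

theorem HasHNF.add (hx : HasHNF x) (hy : HasHNF y) : HasHNF (x + y) := by
  obtain ⟨l, hl, rfl⟩ := hx
  obtain ⟨l', hl', rfl⟩ := hy
  exact ⟨l ++ l', fun s hs => (List.mem_append.1 hs).elim (hl s) (hl' s), (sumOf_append _ _).symm⟩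

theorem HasHNF.at' (a : Atom A) : HasHNF (at' a : Proc γ) := by
  refine ⟨(a.exec?.map Summand.fin).toList, ?_, ?_⟩
  · intro s hs
    simp only [Option.mem_toList, Option.map_eq_some_iff] at hs
    obtain ⟨b, -, rfl⟩ := hs
    trivial
  · cases a
    · exact (add_zero _).symm
    · exact (add_zero _).symm
    · rfl

theorem HasHNF.mul (hx : HasHNF x) (hy : y ∈ K γ False) : HasHNF (x * y) := by
  obtain ⟨l, hl, rfl⟩ := hx
  refine ⟨_, ?_, sumOf_mul l y⟩
  simp only [List.mem_map, forall_exists_index, and_imp]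
  rintro _ s hs rfl
  exact (hl s hs).mulRight hy

theorem HasHNF.dl (hx : x ∈ K γ False) : HasHNF (dl x) :=
  ⟨[.del x], by simpa [Summand.Over] using hx, by simp [Summand.val]⟩

theorem HasHNF.filterMap {l : List (Summand γ)} (hl : ∀ s ∈ l, s.Over False)
    {f : Summand γ → Option (Summand γ)}
    (hf : ∀ s s' : Summand γ, s.Over False → f s = some s' → s'.Over False) :
    HasHNF (sumOf (l.filterMap f)) := by
  refine ⟨_, ?_, rfl⟩
  simp only [List.mem_filterMap, forall_exists_index, and_imp]
  exact fun s' s hs h => hf s s' (hl s hs) h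

theorem HasHNF.tmo (hx : HasHNF x) : HasHNF (tmo x) := by
  obtain ⟨l, hl, rfl⟩ := hx
  rw [tmo_sumOf]
  refine .filterMap hl fun s s' hs h => ?_
  cases s <;> cases h <;> exact hs

theorem HasHNF.enc (H : Set A) (hx : HasHNF x) : HasHNF (enc H x) := by
  obtain ⟨l, hl, rfl⟩ := hx
  rw [enc_sumOf]
  exact .filterMap hl fun s s' hs h => hs.enc h

theorem HasHNF.abs (I : Set A) (hx : HasHNF x) : HasHNF (abs I x) := by
  obtain ⟨l, hl, rfl⟩ := hx
  refine ⟨_, ?_, abs_sumOf I l⟩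
  simp only [List.mem_map, forall_exists_index, and_imp]
  rintro _ s hs rfl
  have := hl s hs
  cases s
  · trivial
  · exact K.abs id I this
  · exact K.abs id I this

theorem HasHNF.lm (hx : HasHNF x) (hy : HasHNF y) : HasHNF (lm x y) := by
  obtain ⟨l, hl, rfl⟩ := hx
  obtain ⟨l', hl', rfl⟩ := hy
  obtain ⟨o, ho, ho', -⟩ := sumOf_split l' hl'
  rw [lm_sumOf fun _ _ => ho]
  exact .filterMap hl fun s s' hs h => hs.lm (sumOf_mem_K hl') ho' h

theorem HasHNF.cm (hx : HasHNF x) (hy : HasHNF y) : HasHNF (cm x y) := by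
  obtain ⟨l, hl, rfl⟩ := hx
  obtain ⟨l', hl', rfl⟩ := hy
  refine ⟨_, ?_, sumOf_cm_sumOf l l'⟩
  simp only [List.mem_flatMap, List.mem_filterMap]
  rintro _ ⟨s, hs, s', hs', h⟩
  exact (hl s hs).cm (hl' s' hs') h

theorem HasHNF.par (hx : HasHNF x) (hy : HasHNF y) : HasHNF (par x y) := by
  rw [par_eq]
  exact ((hx.lm hy).add (hy.lm hx)).add (hx.cm hy)

theorem pev_mem_K {ρ : ℕ → Proc γ} (hρ : ∀ x, ρ x ∈ K γ False) {t : Term A}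
    (ht : IsTerm γ .acp t) : pev ρ t ∈ K γ False := by
  choose s hs _ hs' using hρ
  exact ⟨t.subst s, Term.IsOver.subst ht fun x _ => hs x, False.elim, by
    rw [pev_subst]; congr 1; funext x; exact hs' x⟩

/-- A product takes its head normal form from the first factor, and a delay needs none for its
argument. So the processes substituted for prefixed variables end up in continuations, which need
only be represented by terms. -/
theorem HasHNF.pev {C : (V : Set ℕ) → (V → Term A) → Prop} (hC : ∀ V E, C V E → IsRec γ .acp V E)
    (hC' : ∀ V E, C V E → ∀ X, HasHNF (cls γ (recur V E X)))
    {ρ : ℕ → Proc γ} (hρ : ∀ x, ρ x ∈ K γ False) : ∀ {t : Term A}, t.IsOver .acp C →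
      (t.Prefixed ∨ t.vars = ∅) → HasHNF (Proc.pev ρ t)
  | var x, _, h' => by simp [Prefixed, vars] at h'
  | atom a, _, _ => .at' a
  | alt s t, h, h' => by
    simp only [Prefixed, vars, Set.union_empty_iff] at h'
    exact (HasHNF.pev hC hC' hρ h.1 (h'.imp And.left And.left)).add
      (HasHNF.pev hC hC' hρ h.2 (h'.imp And.right And.right))
  | seq s t, h, h' => by
    simp only [Prefixed, vars, Set.union_empty_iff] at h'
    exact (HasHNF.pev hC hC' hρ h.1 (h'.imp And.left And.left)).mul
      (pev_mem_K hρ (h.2.mono hC))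
  | delay t, h, _ => .dl (pev_mem_K hρ (Term.IsOver.mono (t := t) hC h))
  | .par s t, h, h' => by
    simp only [Prefixed, vars, Set.union_empty_iff] at h'
    exact (HasHNF.pev hC hC' hρ h.2.1 (h'.imp And.left And.left)).par
      (HasHNF.pev hC hC' hρ h.2.2 (h'.imp And.right And.right))
  | lmerge s t, h, h' => by
    simp only [Prefixed, vars, Set.union_empty_iff] at h'
    exact (HasHNF.pev hC hC' hρ h.2.1 (h'.imp And.left And.left)).lm
      (HasHNF.pev hC hC' hρ h.2.2 (h'.imp And.right And.right))
  | cmerge s t, h, h' => by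
    simp only [Prefixed, vars, Set.union_empty_iff] at h'
    exact (HasHNF.pev hC hC' hρ h.2.1 (h'.imp And.left And.left)).cm
      (HasHNF.pev hC hC' hρ h.2.2 (h'.imp And.right And.right))
  | encap H t, h, h' => (HasHNF.pev hC hC' hρ (t := t) h.2 h').enc H
  | abstr I t, h, h' => (HasHNF.pev hC hC' hρ (t := t) h h').abs I
  | timeout t, h, h' => (HasHNF.pev hC hC' hρ (t := t) h h').tmo
  | recur V E X, h, _ => hC' V E h X

theorem pev_rewrite {n : ℕ} {V : Set ℕ} {E : V → Term A} (hE : IsRec γ .acp V E) {i : V}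
    {s t : Term A} (h : Relation.ReflTransGen (RewriteStep (IsOver .acp (RecLevel γ .acp n))
      (fun s t => BaseAxiom γ .acp s t ∨ RDPAxiom (RecLevel γ .acp n) s t) V E i) s t) :
    pev (recVal γ V E) s = pev (recVal γ V E) t := by
  have hax : ∀ s t, BaseAxiom γ .acp s t ∨ RDPAxiom (RecLevel γ .acp n) s t →
      pev (recVal γ V E) s = pev (recVal γ V E) t := by
    rintro s t (h | ⟨V, E, X, h⟩)
    · exact pev_axiom h _
    · exact pev_rdp (.rdp V E X ⟨n, h⟩) _
  induction h with
  | refl => rfl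
  | tail _ h ih =>
    rw [ih]
    refine pev_inContext ?_ h.2.2
    rintro s t (h | h | ⟨j, -, rfl, rfl⟩)
    · exact hax _ _ h
    · exact (hax _ _ h).symm
    · rw [← cls_recur hE, pev, recVal_of_mem]

/-- The head normal form is that of the guarded term obtained by rewriting. Abstraction must be
admitted throughout, as the rewriting may introduce it; this is why `K γ False` is used. -/
theorem HasHNF.recur (n : ℕ) : ∀ (V : Set ℕ) (E : V → Term A), RecLevel γ .acp n V E → ∀ X,
    HasHNF (cls γ (recur V E X)) := by
  induction n with
  | zero => exact fun _ _ h => h.elim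
  | succ n ih =>
    rintro V E (h | h) X
    · exact ih V E h X
    have hE : IsRec γ .acp V E := ⟨n + 1, .inr h⟩
    obtain ⟨g, hg, hg'⟩ := h.2 X
    have hover : g.IsOver .acp (RecLevel γ .acp n) := by
      cases hg with
      | refl => exact (h.1 X).1
      | tail _ h => exact h.2.1
    rw [cls_recur hE, pev_rewrite hE hg]
    exact .pev (fun V E h => ⟨n, h⟩) ih (recVal_mem_K hE False.elim) hover
      (hg'.symm.imp And.right id)

theorem hasHNF_of_mem (hx : x ∈ K γ False) : HasHNF x := by
  obtain ⟨t, ht, -, rfl⟩ := hx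
  -- Variables that occur in the representing term stand for deadlock and are replaced by it, to
  -- obtain a closed term.
  have h0 : pev (fun _ => (0 : Proc γ)) t = pev (fun _ => 0) (t.subst fun _ => atom .dead) :=
    (pev_subst (fun _ => (0 : Proc γ)) (fun _ => atom .dead) t).symm
  rw [h0]
  refine .pev (C := IsRec γ .acp) (fun _ _ h => h) (fun V E ⟨n, h⟩ X => HasHNF.recur n V E h X)
    (fun _ => K.zero) (Term.IsOver.subst ht fun _ _ => trivial) (.inr ?_)
  have : ∀ t : Term A, (t.subst fun _ => atom .dead).vars = ∅ := by
    intro t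
    induction t <;> simp_all [subst, vars]
  exact this t

/-- If some communication is silent, then closed terms are resolved. -/
theorem res_of_silent {a b : A} (hab : γ.comm (.act a) (.act b) = .tau) (hx : x ∈ K γ False) :
    Res False True x := by
  obtain ⟨l, hl, rfl⟩ := hasHNF_of_mem hx
  -- Replacing `τ·k` by the equal process `τ` removes all silent prefixes, so there are no silent
  -- chains left to follow.
  let f : Summand γ → Summand γ := fun s => match s with
    | .pre none _ => .fin none
    | s => s
  have hf : sumOf l = sumOf (l.map f) := by
    refine map_sumOf' id rfl (fun _ _ => rfl) f fun s _ => ?_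
    match s with
    | .pre none k => exact tau_mul_of_silent hab k
    | .pre (some _) _ => rfl
    | .fin _ => rfl
    | .del _ => rfl
  rw [hf]
  refine .mk _ ?_ (fun _ => trivial) ?_
  · simp only [List.mem_map, forall_exists_index, and_imp]
    rintro _ s hs rfl
    match s, hl s hs with
    | .pre none k, _ => trivial
    | .pre (some _) _, h => exact h
    | .fin _, _ => trivial
    | .del _, h => exact h
  · simp only [List.mem_map, forall_exists_index, and_imp]
    intro k s _ h
    match s, h with
    | .pre none _, h => cases h
    | .pre (some _) _, h => cases h

/-! ### Elimination -/

/-- Guarded terms without parallelism over processes in the place of variables. -/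
inductive Tree (γ : Communication A)
  | atom (a : Atom A)
  | alt (s t : Tree γ)
  | act (a : A) (k : Proc γ)
  | tau (t : Tree γ)
  | del (k : Proc γ)

namespace Tree

def val : Tree γ → Proc γ
  | atom a => at' a
  | alt s t => s.val + t.val
  | act a k => at' (.act a) * k
  | tau t => at' .tau * t.val
  | del k => dl k

def leaves : Tree γ → Set (Proc γ)
  | atom _ => ∅
  | alt s t => s.leaves ∪ t.leaves
  | act _ k => {k}
  | tau t => t.leaves
  | del k => {k}

def term (f : Proc γ → ℕ) : Tree γ → Term A
  | atom a => .atom a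
  | alt s t => .alt (s.term f) (t.term f)
  | act a k => .seq (.atom (.act a)) (.var (f k))
  | tau t => .seq (.atom .tau) (t.term f)
  | del k => .delay (.var (f k))

theorem countable_leaves : ∀ t : Tree γ, t.leaves.Countable
  | atom _ => Set.countable_empty
  | alt s t => s.countable_leaves.union t.countable_leaves
  | act _ k => Set.countable_singleton k
  | tau t => t.countable_leaves
  | del k => Set.countable_singleton k

theorem isOver_term (f : Proc γ → ℕ) (T : Theory) (C : (V : Set ℕ) → (V → Term A) → Prop) :
    ∀ t : Tree γ, (t.term f).IsOver T C
  | atom _ => trivial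
  | alt s t => ⟨s.isOver_term f T C, t.isOver_term f T C⟩
  | act _ _ => ⟨trivial, trivial⟩
  | tau t => ⟨trivial, t.isOver_term f T C⟩
  | del _ => trivial

theorem guarded_term (f : Proc γ → ℕ) (t : Tree γ) : (t.term f).Guarded := by
  refine .inr ?_
  induction t with
  | atom a => exact ⟨trivial, trivial⟩
  | alt s t ihs iht => exact ⟨⟨ihs.1, iht.1⟩, ihs.2, iht.2⟩
  | act a k => exact ⟨⟨trivial, trivial⟩, trivial, .inl ⟨a, rfl⟩⟩
  | tau t iht => exact ⟨⟨trivial, iht.1⟩, trivial, .inr iht.2⟩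
  | del k => exact ⟨trivial, trivial⟩

theorem pev_term {f : Proc γ → ℕ} {ρ : ℕ → Proc γ} {t : Tree γ} (h : ∀ k ∈ t.leaves, ρ (f k) = k) :
    pev ρ (t.term f) = t.val := by
  induction t with
  | atom a => rfl
  | alt s t ihs iht =>
    simp only [term, pev, val, ihs fun k hk => h k (.inl hk), iht fun k hk => h k (.inr hk)]
  | act a k => simp only [term, pev, val, h k rfl]
  | tau t iht => simp only [term, pev, val, iht h]
  | del k => simp only [term, pev, val, h k rfl]

end Tree

theorem exists_tree_sumOf {R : Set (Proc γ)} {l : List (Summand γ)}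
    (h : ∀ s ∈ l, ∃ g : Tree γ, g.val = s.val ∧ g.leaves ⊆ R) :
    ∃ g : Tree γ, g.val = sumOf l ∧ g.leaves ⊆ R := by
  induction l with
  | nil => exact ⟨.atom .dead, rfl, Set.empty_subset _⟩
  | cons s l ih =>
    obtain ⟨g, hg, hg'⟩ := h s (by simp)
    obtain ⟨g', hg1, hg2⟩ := ih fun s hs => h s (by simp [hs])
    exact ⟨.alt g g', by rw [sumOf_cons, Tree.val, hg, hg1], Set.union_subset hg' hg2⟩

/-- Silent prefixes are unfolded along their well-founded chains until every remaining process lies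
behind a visible action or a delay. -/
theorem Res.exists_tree {b p : Prop} (h : Res b p x) :
    ∃ g : Tree γ, g.val = x ∧ g.leaves ⊆ K γ b := by
  induction h with
  | mk l hl _ _ ih =>
    refine exists_tree_sumOf fun s hs => ?_
    have := hl s hs
    match s with
    | .fin c => exact ⟨.atom (exec c), rfl, Set.empty_subset _⟩
    | .pre (some a) k => exact ⟨.act a k, rfl, Set.singleton_subset_iff.2 this⟩
    | .pre none k =>
      obtain ⟨g, rfl, hg⟩ := ih k hs
      exact ⟨.tau g, rfl, hg⟩
    | .del k => exact ⟨.del k, rfl, Set.singleton_subset_iff.2 this⟩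

/-- The processes in a set of which each member unfolds to a guarded term over that set are
recursion constants of the theory without parallelism. -/
theorem exists_recur {R : Set (Proc γ)} (hR : ∀ x ∈ R, ∃ g : Tree γ, g.val = x ∧ g.leaves ⊆ R)
    (hx : x ∈ R) : ∃ (V : Set ℕ) (E : V → Term A) (X : V), IsRec γ .acp V E ∧ IsRec γ .bpa V E ∧
      x = cls γ (recur V E X) := by
  classical
  have : Nonempty (Tree γ) := ⟨.atom .dead⟩
  choose! G hG hGR using hR
  -- The processes reached by `n` unfoldings from `x`. Each tree has countably many leaves, so
  -- natural numbers suffice to name all processes reached.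
  let S : ℕ → Set (Proc γ) := fun n => n.rec {x} fun _ s => ⋃ y ∈ s, (G y).leaves
  have hS : ∀ n, (S n).Countable := by
    intro n
    induction n with
    | zero => exact Set.countable_singleton x
    | succ n ih => exact ih.biUnion fun y _ => (G y).countable_leaves
  have hSR : ∀ n, S n ⊆ R := by
    intro n
    induction n with
    | zero => exact Set.singleton_subset_iff.2 hx
    | succ n ih => exact Set.iUnion₂_subset fun y hy => hGR y (ih hy)
  have hxS : x ∈ ⋃ n, S n := Set.mem_iUnion.2 ⟨0, rfl⟩
  obtain ⟨dec, hdec⟩ := (Set.countable_iUnion hS).exists_eq_range ⟨x, hxS⟩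
  have hclosed : ∀ i, ∀ k ∈ (G (dec i)).leaves, ∃ j, dec j = k := by
    intro i k hk
    have hi : dec i ∈ ⋃ n, S n := hdec ▸ Set.mem_range_self i
    obtain ⟨n, hn⟩ := Set.mem_iUnion.1 hi
    have hk' : k ∈ ⋃ n, S n := Set.mem_iUnion.2 ⟨n + 1, Set.mem_biUnion hn hk⟩
    rwa [hdec] at hk'
  have hdecR : ∀ i, dec i ∈ R := by
    intro i
    have hi : dec i ∈ ⋃ n, S n := hdec ▸ Set.mem_range_self i
    obtain ⟨n, hn⟩ := Set.mem_iUnion.1 hi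
    exact hSR n hn
  -- Since `dec` may repeat processes, some code is chosen. The value `0` is a default that never
  -- matters, because all leaves of the trees used are enumerated.
  let idx : Proc γ → ℕ := fun k => if h : ∃ j, dec j = k then h.choose else 0
  have hidx : ∀ {k}, (∃ j, dec j = k) → dec (idx k) = k := by
    intro k h
    simp only [idx, dif_pos h]
    exact h.choose_spec
  let E : ↥(Set.univ : Set ℕ) → Term A := fun i => (G (dec i)).term idx
  have hE : ∀ T, IsRec γ T Set.univ E := fun T =>
    isRec_of_guarded (fun i => ⟨Tree.isOver_term _ _ _ _, Set.subset_univ _⟩)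
      fun i => Tree.guarded_term _ _
  choose σ hσ hσ' using fun i => exists_cls (dec i)
  obtain ⟨i, hi⟩ : ∃ i, dec i = x := by rwa [hdec] at hxS
  refine ⟨Set.univ, E, ⟨i, trivial⟩, hE _, hE _, ?_⟩
  rw [← hi, ← hσ' i]
  -- RSP applies to representatives of the enumerated processes: each equals the tree it was
  -- unfolded to, hence they solve `E`.
  refine (cls_eq (t := recur Set.univ E ⟨i, trivial⟩) (hσ i) (hE .acp)).2
    (.rsp Set.univ E (hE _) σ hσ (fun j => ?_) ⟨i, trivial⟩)
  have hj : IsTerm γ .acp (E j) := Tree.isOver_term _ _ _ _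
  rw [← cls_eq (hσ j) (Term.IsOver.subst hj fun x _ => hσ x), cls_subst hj hσ, hσ' j]
  simp only [hσ']
  rw [Tree.pev_term fun k hk => hidx (hclosed j k hk), hG _ (hdecR j)]

end Proc

end ACPdrt

/-! ### The elimination theorem. -/

theorem mainTheorem6 {A : Type*} [Finite A] (γ : ACPdrt.Communication A)
    (t : ACPdrt.Term A) (ht : ACPdrt.IsClosedTerm γ .acp t) (hfree : t.AbstrFree) :
    ∃ t' : ACPdrt.Term A,
      ACPdrt.IsClosedTerm γ .acp t' ∧ ACPdrt.IsClosedTerm γ .bpa t' ∧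
        ACPdrt.Derivable γ .acp t t' := by
  have hK : ∀ b, ACPdrt.Proc.cls γ t ∈ ACPdrt.Proc.K γ b := fun b =>
    ⟨t, ht.1, fun _ => hfree, ACPdrt.Proc.pev_eq_cls ht.1 ht.2 _⟩
  obtain ⟨V, E, X, h1, h2, h⟩ : ∃ (V : Set ℕ) (E : V → ACPdrt.Term A) (X : V),
      ACPdrt.IsRec γ .acp V E ∧ ACPdrt.IsRec γ .bpa V E ∧
        ACPdrt.Proc.cls γ t = ACPdrt.Proc.cls γ (.recur V E X) := by
    -- With visible communication the set of processes is that of the abstraction-free terms, since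
    -- abstraction could produce silent divergence. With a silent communication all terms are
    -- admitted, because the head normal forms found there may involve abstraction.
    by_cases hγ : ACPdrt.Proc.Visible γ
    · exact ACPdrt.Proc.exists_recur
        (fun x hx => (ACPdrt.Proc.res_of_visible hγ hx).exists_tree) (hK True)
    · obtain ⟨a, b, hab⟩ : ∃ a b, γ.comm (.act a) (.act b) = .tau := by
        simpa [ACPdrt.Proc.Visible] using hγ
      exact ACPdrt.Proc.exists_recur
        (fun x hx => (ACPdrt.Proc.res_of_silent hab hx).exists_tree) (hK False)
  exact ⟨.recur V E X, ⟨h1, rfl⟩, ⟨h2, rfl⟩,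
    (ACPdrt.Proc.cls_eq (t := .recur V E X) ht.1 h1).1 h⟩
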